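/- **Proposition 2.6.** Homology is singular homology with integer coefficients. Let $n\ge 1$, let $M$ be a smooth $n$-manifold with boundary $\partial M$ (orientable or not), and let the smooth $n$-manifold with boundary $M'$ be obtained from $M$ by adding an exterior collar $A\cong\partial M\times[0,1]$. That is, $M$ is a closed subset and a smooth $n$-dimensional submanifold with boundary of $M'$, and there is a homeomorphism of $\partial M\times[0,1]$ onto a closed subset $A\subset M'$ which is the inclusion of $\partial M$ on $\partial M\times\{0\}$ and maps $\partial M\times\{1\}$ onto $\partial M'$, with $M\cup A=M'$ and $M\cap A=\partial M$. For a compact oriented smooth embedded $p$-submanifold $K$ (possibly with boundary) of $M'$, an *orientation class* of $K$ is a class in $H_p(K,\partial K)$ whose image in $H_p(K,K\setminus\{x\})\cong\mathbb Z$ is the local orientation of $K$ at $x$, for every $x\in K\setminus\partial K$. If $K\subset S\subset M'$ and $\partial K\subset T\subset S$, we say that $K$ *represents* the image of its orientation class in $H_p(S,T)$. Call $K$ *admissible* if $\partial K\subset\partial M\times(0,1]$ and $K$ meets $\partial M$ transversely. Let $p\ge 0$. 1. Let $K$ be an admissible compact oriented smooth $p$-submanifold of $M'$. Then $K\cap M$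 is the disjoint union of a finite collection $\{L_i\}$ of compact connected smooth $p$-submanifolds with $\partial L_i\subset\partial M$, each oriented compatibly with $K$ (with $L_i\setminus\partial L_i\subset K\setminus\partial K$), and if $K$ represents $k\in H_p(M',A)$, then the $L_i$ represent classes $l_i\in H_p(M,\partial M)$ such that $\sum_i l_i$ is mapped to $k$ by the homomorphism $H_p(M,\partial M)\to H_p(M',A)$ induced by the inclusion. 2. The homomorphism $H_p(M,\partial M)\to H_p(M',A)$ induced by the inclusion is an isomorphism. 3. Consequently, if $z'\in H_p(M',A)$ is an integer linear combination of classes represented by admissible compact oriented smooth $p$-submanifolds of $M'$, then there is an element $z\in H_p(M,\partial M)$ which is an integer linear combination of classes represented by compact oriented smooth $p$-submanifolds $L\subset M$ with $\partial L\subset\partial M$, and which is mapped to $z'$ under the isomorphism $H_p(M,\partial M)\to H_p(M',A)$. -/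

import Mathlib

open CategoryTheory CategoryTheory.Limits AlgebraicTopology
open scoped Manifold ContDiff

universe u

noncomputable section

/-! ### Relative singular homology of subsets of a space, with integer coefficients -/

section Homology

theorem inter_subset_compl_singleton {X : Type*} {S T : Set X} {x : X} (h : x ∉ S ∩ T) : S ∩ T ⊆ {x}ᶜ :=
  fun y hy hyx => h (by rw [← Set.mem_singleton_iff.mp hyx]; exact hy)

variable {X : Type u} [TopologicalSpace X]

/-- The inclusion of one subspace of `X` into a larger one. -/
def subspaceIncl {S T : Set X} (h : S ⊆ T) : TopCat.of S ⟶ TopCat.of T :=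
  TopCat.ofHom ⟨Set.inclusion h, continuous_inclusion h⟩

/-- The singular chain complex functor with integer coefficients. -/
abbrev singularChains : TopCat.{u} ⥤ ChainComplex (ModuleCat.{u} ℤ) ℕ :=
  (singularChainComplexFunctor (ModuleCat.{u} ℤ)).obj (ModuleCat.of ℤ (ULift.{u} ℤ))

/-- The relative singular chain complex `C(S, S ∩ T) = C(S) / C(S ∩ T)` of subsets `S`, `T` of a
space `X`; it is `C(S, T)` if `T ⊆ S`. -/
def relChains (S T : Set X) : ChainComplex (ModuleCat.{u} ℤ) ℕ :=
  cokernel (singularChains.map (subspaceIncl (Set.inter_subset_left : S ∩ T ⊆ S)))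

/-- The chain map of relative chain complexes induced by an inclusion of pairs. -/
def relChainsMap {S T S' T' : Set X} (hS : S ⊆ S') (hT : S ∩ T ⊆ T') :
    relChains S T ⟶ relChains S' T' :=
  cokernel.map _ _
    (singularChains.map (subspaceIncl (fun _ hx => ⟨hS hx.1, hT hx⟩ : S ∩ T ⊆ S' ∩ T')))
    (singularChains.map (subspaceIncl hS))
    (by rw [← Functor.map_comp, ← Functor.map_comp]; rfl)

/-- The relative singular homology group `H_p(S, S ∩ T)` with integer coefficients. -/
def relHomology (p : ℕ) (S T : Set X) : ModuleCat.{u} ℤ :=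
  (relChains S T).homology p

/-- The homomorphism `H_p(S, S ∩ T) → H_p(S', S' ∩ T')` induced by inclusion. -/
def relHomologyMap (p : ℕ) {S T S' T' : Set X} (hS : S ⊆ S') (hT : S ∩ T ⊆ T') :
    relHomology p S T →ₗ[ℤ] relHomology p S' T' :=
  (HomologicalComplex.homologyMap (relChainsMap hS hT) p).hom

/-- The homomorphism `H_p(S, S ∩ T) → H_p(S, S \ {x})` for a point `x` outside `S ∩ T`. -/
def toLocalHomology (p : ℕ) (S T : Set X) {x : X} (h : x ∉ S ∩ T) :
    relHomology p S T →ₗ[ℤ] relHomology p S {x}ᶜ :=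
  relHomologyMap p (subset_refl S) (inter_subset_compl_singleton h)

end Homology

/-! ### Embedded submanifolds with boundary -/

/-- The closed half-space `{v | 0 ≤ v₀}` of `ℝ^p` (a single point if `p = 0`). -/
def halfSpace (p : ℕ) : Set (EuclideanSpace ℝ (Fin p)) :=
  {v | ∀ i : Fin p, i.val = 0 → 0 ≤ v i}

/-- The open half-space `{v | 0 < v₀}` of `ℝ^p` (a single point if `p = 0`). -/
def openHalfSpace (p : ℕ) : Set (EuclideanSpace ℝ (Fin p)) :=
  {v | ∀ i : Fin p, i.val = 0 → 0 < v i}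

section Submanifold

variable {E : Type*} [NormedAddCommGroup E] [NormedSpace ℝ E] {H : Type*} [TopologicalSpace H]
  (I : ModelWithCorners ℝ E H) {X : Type u} [TopologicalSpace X] [ChartedSpace H X]

/-- `φ`, restricted to the relatively open subset `V ∩ halfSpace p` of the half-space, is a smooth
embedding onto a relatively open subset of `S`: a local parametrization of `S` as a smooth
`p`-dimensional submanifold with boundary. -/
structure IsLocalParam (p : ℕ) (S : Set X) (V : Set (EuclideanSpace ℝ (Fin p)))
    (φ : EuclideanSpace ℝ (Fin p) → X) : Prop where
  isOpen : IsOpen V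
  smooth : ContMDiffOn 𝓘(ℝ, EuclideanSpace ℝ (Fin p)) I ∞ φ (V ∩ halfSpace p)
  immersion : ∀ v ∈ V ∩ halfSpace p, Function.Injective
    (mfderivWithin 𝓘(ℝ, EuclideanSpace ℝ (Fin p)) I φ (V ∩ halfSpace p) v)
  embedding : Topology.IsEmbedding fun v : ↥(V ∩ halfSpace p) => φ v
  image_open : ∃ U : Set X, IsOpen U ∧ φ '' (V ∩ halfSpace p) = S ∩ U

/-- `S` is a smooth embedded `p`-dimensional submanifold, possibly with boundary, of `X`. -/
def IsSubmanifold (p : ℕ) (S : Set X) : Prop :=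
  ∀ x ∈ S, ∃ V φ, IsLocalParam I p S V φ ∧ ∃ v ∈ V ∩ halfSpace p, φ v = x

/-- The manifold interior of a `p`-dimensional submanifold `S`: the points that some local
parametrization takes at an interior point of the half-space. -/
def manifoldInterior (p : ℕ) (S : Set X) : Set X :=
  {x | ∃ V φ, IsLocalParam I p S V φ ∧ ∃ v ∈ V ∩ openHalfSpace p, φ v = x}

/-- The manifold boundary `∂S` of a `p`-dimensional submanifold `S`. -/
def manifoldBoundary (p : ℕ) (S : Set X) : Set X :=
  S \ manifoldInterior I p S

/-- The tangent space `T_x S` of a `p`-dimensional submanifold `S` of `X`, as a subspace of `T_x X`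
(which in Mathlib is the model vector space `E`). -/
def submanifoldTangent (p : ℕ) (S : Set X) (x : X) : Submodule ℝ (TangentSpace I x) :=
  Submodule.span ℝ {w : E | ∃ V φ, IsLocalParam I p S V φ ∧ ∃ v ∈ V ∩ halfSpace p, φ v = x ∧
    ∃ a : EuclideanSpace ℝ (Fin p),
      mfderivWithin 𝓘(ℝ, EuclideanSpace ℝ (Fin p)) I φ (V ∩ halfSpace p) v a = w}

/-! ### Orientations -/

/-- `o` is an orientation of the `p`-dimensional submanifold `S`: for every point `x` of the
manifold interior, `o x` generates `H_p(S, S \ {x})`, and `o x` depends continuously on `x`, i.e.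
locally all the `o y` are images of one class in `H_p(S, S \ U)`, `U` a neighbourhood. (The values
of `o` outside the manifold interior are irrelevant.) -/
structure IsOrientation (p : ℕ) (S : Set X) (o : ∀ x : X, relHomology p S {x}ᶜ) : Prop where
  generator : ∀ x ∈ manifoldInterior I p S, Submodule.span ℤ {o x} = ⊤
  locally_consistent : ∀ x ∈ manifoldInterior I p S, ∃ U : Set X, IsOpen U ∧ x ∈ U ∧
    ∃ α : relHomology p S Uᶜ, ∀ y, ∀ hy : y ∈ U, y ∈ manifoldInterior I p S →
      toLocalHomology p S Uᶜ (fun h => h.2 hy) α = o y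

variable (X) in
/-- A compact oriented smooth `p`-dimensional submanifold, possibly with boundary, of `X`. -/
structure OrientedSubmanifold (p : ℕ) where
  carrier : Set X
  isSubmanifold : IsSubmanifold I p carrier
  isCompact : IsCompact carrier
  orientation : ∀ x : X, relHomology p carrier {x}ᶜ
  isOrientation : IsOrientation I p carrier orientation

namespace OrientedSubmanifold

variable {I} {p : ℕ}

/-- The manifold interior `K \ ∂K` of `K`. -/
def interior (K : OrientedSubmanifold I X p) : Set X := manifoldInterior I p K.carrier

/-- The manifold boundary `∂K` of `K`. -/
def boundary (K : OrientedSubmanifold I X p) : Set X := manifoldBoundary I p K.carrier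

/-- `κ ∈ H_p(K, ∂K)` is the orientation class of `K`, i.e. the class of an orientation `p`-chain
in `C_p(K, ∂K)`: its image in `H_p(K, K \ {x})` is the local orientation of `K` at `x`, for every
`x` in the manifold interior of `K`. -/
def IsOrientationClass (K : OrientedSubmanifold I X p)
    (κ : relHomology p K.carrier K.boundary) : Prop :=
  ∀ x, ∀ hx : x ∈ K.interior,
    toLocalHomology p K.carrier K.boundary (fun h => h.2.2 hx) κ = K.orientation x

/-- `z ∈ H_p(S, A)` is represented by `(K, ∂K)`, where `K ⊆ S` and `∂K ⊆ A`. -/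
def Represents (K : OrientedSubmanifold I X p) {S A : Set X} (z : relHomology p S A) : Prop :=
  ∃ (hS : K.carrier ⊆ S) (hA : K.carrier ∩ K.boundary ⊆ A)
    (κ : relHomology p K.carrier K.boundary),
    K.IsOrientationClass κ ∧ relHomologyMap p hS hA κ = z

/-- `L` is contained in `K` and is oriented compatibly with `K`. -/
def IsOrientedPieceOf (L K : OrientedSubmanifold I X p) : Prop :=
  ∃ h : L.carrier ⊆ K.carrier, L.interior ⊆ K.interior ∧ ∀ x ∈ L.interior,
    relHomologyMap p h (fun _ hz => hz.2) (L.orientation x) = K.orientation x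

end OrientedSubmanifold

end Submanifold

/-! ### Exterior collars -/

section Collar

variable {n : ℕ} [NeZero n] {X : Type u} [TopologicalSpace X]
  [ChartedSpace (EuclideanHalfSpace n) X]

/-- The `n`-manifold with boundary `X` is obtained from its closed smooth `n`-dimensional
submanifold `M` with boundary by adding an exterior collar `A ≅ ∂M × [0, 1]` of `∂M`. -/
structure ExteriorCollar (M : Set X) where
  isSubmanifold : IsSubmanifold (𝓡∂ n) n M
  isClosed : IsClosed M
  /-- the homeomorphism of `∂M × [0, 1]` onto the collar -/
  collar : manifoldBoundary (𝓡∂ n) n M × unitInterval → X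
  isClosedEmbedding : Topology.IsClosedEmbedding collar
  collar_zero : ∀ x, collar (x, 0) = x
  union_eq : M ∪ Set.range collar = Set.univ
  inter_eq : M ∩ Set.range collar = manifoldBoundary (𝓡∂ n) n M
  boundary_eq : (𝓡∂ n).boundary X = Set.range fun x => collar (x, 1)

namespace ExteriorCollar

variable {M : Set X} (C : ExteriorCollar (n := n) M)

/-- The boundary `∂M`. -/
def bd (_ : ExteriorCollar (n := n) M) : Set X := manifoldBoundary (𝓡∂ n) n M

/-- The collar `A`. -/
def A : Set X := Set.range C.collar

/-- The part `∂M × (0, 1]` of the collar. -/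
def openA : Set X := C.collar '' {y | 0 < y.2}

/-- The homomorphism `H_p(M, ∂M) → H_p(X, A)` induced by inclusion. -/
def homologyMap (p : ℕ) : relHomology p M C.bd →ₗ[ℤ] relHomology p (Set.univ : Set X) C.A :=
  relHomologyMap p (Set.subset_univ M)
    (fun _ hx => (C.inter_eq.symm.subset hx.2).2)

/-- The conditions on a compact oriented `p`-manifold `K` in `X`: its boundary is contained
in `∂M × (0, 1]`, and `K` meets `∂M` transversely. -/
structure Admissible {p : ℕ} (K : OrientedSubmanifold (𝓡∂ n) X p) : Prop where
  boundary_subset : K.boundary ⊆ C.openA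
  transverse : ∀ x ∈ K.carrier ∩ C.bd,
    submanifoldTangent (𝓡∂ n) p K.carrier x ⊔ submanifoldTangent (𝓡∂ n) (n - 1) C.bd x = ⊤

end ExteriorCollar

end Collar

end

/-!
Cutting a submanifold `K` along `∂M`, in homology.

That `H_p(M, ∂M) → H_p(X, A)` is bijective is homotopy invariance: contracting the collar to
`∂M × {0}` deforms the pair `(X, A)` to `(M, ∂M)` (`ExteriorCollar.homologyMap_bijective`). The last
assertion follows from the first one by linearity, so the substance is the first one.

*Homology.* The relative homology groups are computed by finitely supported functions on singular
simplices (`relClass`, `relClass_surjective`, `relClass_eq_zero_iff`, `relHomologyMap_relClass`).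
A universal chain on the prism `Δⁿ × [0, 1]` gives a natural operator on singular chains; coning
shows that two such natural chain maps are chain homotopic (`exists_prismOperator_homotopy`). This
applies to the two ends of a homotopy and to barycentric subdivision, and yields homotopy invariance
(`exists_pushChains_homotopy`) and excision (`relHomologyMap_bijective_of_excision`).

*Geometry.* Near a point of `∂M`, the sets `M` and `A` are `0 ≤ g` and `g ≤ 0` for a smooth function
`g` with nonzero differential (`ExteriorCollar.exists_defining_function`). The tangent space of `∂M`
lies in the kernel of the differential of `g`, so transversality says that `g` is not stationary
on `K`, and by the inverse function theorem `g` is the first coordinate of a parametrization of `K`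
(`ExteriorCollar.exists_adapted_param`). Hence `K ∩ M` is a submanifold
(`ExteriorCollar.isSubmanifold_inter`) whose boundary is `K ∩ ∂M`
(`ExteriorCollar.manifoldInterior_inter`). Being compact and locally connected, it has finitely many
components, all of them relatively open. A component agrees with `K` near each of its interior
points, and so by excision takes over the orientation of `K` (`IsOrientation.pullback`).

*Classes.* Let `c` be a cycle of `(K, ∂K)` in the orientation class of `K`. Lowering the first
coordinate of adapted parametrizations deforms `K` so that `K ∩ M` is preserved, `K ∩ A` is fixed and
a neighbourhood `G` of `K ∩ A` ends in `A` (`ExteriorCollar.exists_push`). By excision, `c` is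
homologous modulo `G` to a chain in `K ∩ M`; after the push, it is homologous modulo `K ∩ A` to a
relative cycle `a` of `(K ∩ M, K ∩ ∂M)` (`ExteriorCollar.exists_cut_cycle`). As simplices are
connected, `a` is the sum of relative cycles of the components; they represent the orientation
classes because the difference between `a` and `c` is invisible in the local homology of `K` at points
outside `A`, and the images of their classes add up to that of `c`.
-/

noncomputable section

/-! ### Singular chains as finitely supported functions -/

section Chains

variable {X Y Z : Type*} [TopologicalSpace X] [TopologicalSpace Y] [TopologicalSpace Z]

/-- Singular `n`-chains of `X` with integer coefficients. -/
abbrev Chains (n : ℕ) (X : Type*) [TopologicalSpace X] : Type _ :=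
  C(stdSimplex ℝ (Fin (n + 1)), X) →₀ ℤ

/-- The inclusion of the `i`-th face of the standard simplex. -/
def coface {n : ℕ} (i : Fin (n + 2)) :
    C(stdSimplex ℝ (Fin (n + 1)), stdSimplex ℝ (Fin (n + 2))) :=
  ⟨stdSimplex.map i.succAbove, stdSimplex.continuous_map _⟩

/-- The boundary operator in positive degrees. -/
def dChains (n : ℕ) : Chains (n + 1) X →ₗ[ℤ] Chains n X :=
  Finsupp.linearCombination ℤ fun σ =>
    ∑ i : Fin (n + 2), (-1 : ℤ) ^ i.val • Finsupp.single (σ.comp (coface i)) 1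

/-- The boundary operator in all degrees; in degree zero it is the zero map. -/
def bdry : ∀ n : ℕ, Chains n X →ₗ[ℤ] Chains (n - 1) X
  | 0 => 0
  | n + 1 => dChains n

/-- The singular chains of `X` that lie in the subset `S`. -/
def chainsIn (n : ℕ) (S : Set X) : Submodule ℤ (Chains n X) :=
  Finsupp.supported ℤ ℤ {σ | Set.range σ ⊆ S}

/-- The map of singular chains induced by a continuous map. -/
def pushChains (n : ℕ) (f : C(X, Y)) : Chains n X →ₗ[ℤ] Chains n Y :=
  Finsupp.lmapDomain ℤ ℤ f.comp

theorem dChains_single {n : ℕ} (σ : C(stdSimplex ℝ (Fin (n + 2)), X)) :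
    dChains n (Finsupp.single σ 1) =
      ∑ i : Fin (n + 2), (-1 : ℤ) ^ i.val • Finsupp.single (σ.comp (coface i)) 1 := by
  simp [dChains]

@[simp]
theorem pushChains_single {n : ℕ} (f : C(X, Y)) (σ : C(stdSimplex ℝ (Fin (n + 1)), X)) (a : ℤ) :
    pushChains n f (Finsupp.single σ a) = Finsupp.single (f.comp σ) a := by
  simp [pushChains]

theorem single_mem_chainsIn {n : ℕ} {S : Set X} {σ : C(stdSimplex ℝ (Fin (n + 1)), X)}
    (h : ∀ t, σ t ∈ S) (a : ℤ) : Finsupp.single σ a ∈ chainsIn n S :=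
  Finsupp.single_mem_supported ℤ a (by rintro _ ⟨t, rfl⟩; exact h t)

/-- Linear maps on the chains in `S` are controlled by their values on singular simplices. -/
theorem chainsIn_le {n : ℕ} {S : Set X} {N : Submodule ℤ (Chains n X)}
    (h : ∀ σ : C(stdSimplex ℝ (Fin (n + 1)), X), (∀ t, σ t ∈ S) → Finsupp.single σ 1 ∈ N) :
    chainsIn n S ≤ N := by
  rw [chainsIn, Finsupp.supported_eq_span_single, Submodule.span_le]
  rintro _ ⟨σ, hσ, rfl⟩
  exact h σ fun t => hσ ⟨t, rfl⟩

theorem chainsIn_mono {n : ℕ} {S T : Set X} (h : S ⊆ T) : chainsIn n S ≤ chainsIn n T :=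
  Finsupp.supported_mono fun _ hσ => hσ.trans h

theorem mem_chainsIn_inter {n : ℕ} {S T : Set X} {c : Chains n X} (hS : c ∈ chainsIn n S)
    (hT : c ∈ chainsIn n T) : c ∈ chainsIn n (S ∩ T) :=
  fun _ hσ => Set.subset_inter (hS hσ) (hT hσ)

theorem mem_chainsIn_univ {n : ℕ} (c : Chains n X) : c ∈ chainsIn n (Set.univ : Set X) :=
  fun _ _ => Set.subset_univ _

theorem dChains_mem {n : ℕ} {S : Set X} {c : Chains (n + 1) X} (hc : c ∈ chainsIn (n + 1) S) :
    dChains n c ∈ chainsIn n S := by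
  have : chainsIn (n + 1) S ≤ (chainsIn n S).comap (dChains n) := by
    refine chainsIn_le fun σ hσ => ?_
    rw [Submodule.mem_comap, dChains_single]
    exact Submodule.sum_mem _ fun i _ => Submodule.smul_mem _ _
      (single_mem_chainsIn (σ := σ.comp (coface i)) (fun t => hσ _) 1)
  exact this hc

theorem bdry_mem {n : ℕ} {S : Set X} {c : Chains n X} (hc : c ∈ chainsIn n S) :
    bdry n c ∈ chainsIn (n - 1) S := by
  cases n with
  | zero => exact Submodule.zero_mem _
  | succ n => exact dChains_mem hc

theorem pushChains_mem {n : ℕ} {f : C(X, Y)} {S : Set X} {T : Set Y} (h : Set.MapsTo f S T)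
    {c : Chains n X} (hc : c ∈ chainsIn n S) : pushChains n f c ∈ chainsIn n T := by
  have : chainsIn n S ≤ (chainsIn n T).comap (pushChains n f) := by
    refine chainsIn_le fun σ hσ => ?_
    rw [Submodule.mem_comap, pushChains_single]
    exact single_mem_chainsIn (fun t => h (hσ t)) 1
  exact this hc

theorem dChains_pushChains {n : ℕ} (f : C(X, Y)) (c : Chains (n + 1) X) :
    dChains n (pushChains (n + 1) f c) = pushChains n f (dChains n c) := by
  have : dChains n ∘ₗ pushChains (n + 1) f = pushChains n f ∘ₗ dChains n := by
    refine Finsupp.lhom_ext' fun σ => LinearMap.ext_ring ?_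
    simp only [LinearMap.comp_apply, Finsupp.lsingle_apply, pushChains_single,
      dChains_single, map_sum, map_smul]
    rfl
  exact LinearMap.congr_fun this c

theorem bdry_pushChains {n : ℕ} (f : C(X, Y)) (c : Chains n X) :
    bdry n (pushChains n f c) = pushChains (n - 1) f (bdry n c) := by
  cases n with
  | zero => simp [bdry]
  | succ n => exact dChains_pushChains f c

theorem pushChains_pushChains {n : ℕ} (f : C(X, Y)) (g : C(Y, Z)) (c : Chains n X) :
    pushChains n g (pushChains n f c) = pushChains n (g.comp f) c := by
  have : pushChains n g ∘ₗ pushChains n f = pushChains n (g.comp f) := by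
    refine Finsupp.lhom_ext' fun σ => LinearMap.ext_ring ?_
    simp only [LinearMap.comp_apply, Finsupp.lsingle_apply, pushChains_single]
    rfl
  exact LinearMap.congr_fun this c

/-- Two continuous maps that agree on `S` induce the same map on the chains in `S`. -/
theorem pushChains_congr {n : ℕ} {f g : C(X, Y)} {S : Set X} (h : Set.EqOn f g S)
    {c : Chains n X} (hc : c ∈ chainsIn n S) : pushChains n f c = pushChains n g c := by
  have : chainsIn n S ≤ LinearMap.eqLocus (pushChains n f) (pushChains n g) := by
    refine chainsIn_le fun σ hσ => ?_
    rw [LinearMap.mem_eqLocus, pushChains_single, pushChains_single]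
    congr 1
    ext t
    exact h (hσ t)
  exact this hc

theorem pushChains_id {n : ℕ} (c : Chains n X) : pushChains n (ContinuousMap.id X) c = c := by
  have : pushChains n (ContinuousMap.id X) = LinearMap.id := by
    refine Finsupp.lhom_ext' fun σ => LinearMap.ext_ring ?_
    simp only [LinearMap.comp_apply, Finsupp.lsingle_apply, pushChains_single]
    rfl
  exact LinearMap.congr_fun this c

/-! ### Chains in a subspace -/

/-- The inclusion of a subset, as a continuous map. -/
def inclMap (S : Set X) : C(S, X) := ⟨Subtype.val, continuous_subtype_val⟩

theorem pushChains_inclMap_injective (n : ℕ) (S : Set X) :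
    Function.Injective (pushChains n (inclMap S)) := by
  refine Finsupp.mapDomain_injective fun σ τ h => ?_
  ext t
  exact congrArg (fun ρ : C(stdSimplex ℝ (Fin (n + 1)), X) => ρ t) h

/-- A chain in `S` comes from the subspace `S`. -/
theorem exists_pushChains_inclMap {n : ℕ} {S : Set X} {c : Chains n X} (hc : c ∈ chainsIn n S) :
    ∃ c' : Chains n S, pushChains n (inclMap S) c' = c := by
  have : chainsIn n S ≤ LinearMap.range (pushChains n (inclMap S)) := by
    refine chainsIn_le fun σ hσ => ?_
    refine ⟨Finsupp.single ⟨fun t => ⟨σ t, hσ t⟩, by fun_prop⟩ 1, ?_⟩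
    rw [pushChains_single]
    rfl
  exact this hc

theorem pushChains_inclMap_mem {n : ℕ} {S T : Set X} {c : Chains n S} :
    pushChains n (inclMap S) c ∈ chainsIn n T ↔ c ∈ chainsIn n (Subtype.val ⁻¹' T : Set S) := by
  refine ⟨fun h => ?_, fun h => pushChains_mem (fun _ hx => hx) h⟩
  intro σ hσ
  have hinj : Function.Injective (fun ρ : C(stdSimplex ℝ (Fin (n + 1)), S) =>
      (inclMap S).comp ρ) := fun σ τ h => by
    ext t
    exact congrArg (fun ρ : C(stdSimplex ℝ (Fin (n + 1)), X) => ρ t) h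
  have h2 : (inclMap S).comp σ ∈ (pushChains n (inclMap S) c).support := by
    rw [Finsupp.mem_support_iff, pushChains, Finsupp.lmapDomain_apply,
      Finsupp.mapDomain_apply hinj]
    exact Finsupp.mem_support_iff.mp hσ
  rintro _ ⟨t, rfl⟩
  exact h h2 ⟨t, rfl⟩

end Chains

/-! ### Comparison with the singular chain complex of Mathlib -/

section Compare

open Simplicial

variable {X Y : Type u} [TopologicalSpace X] [TopologicalSpace Y]

/-- The singular `n`-simplices in the simplicial set of `X` are the continuous maps from the
standard simplex to `X`. -/
def simplexEquiv (n : ℕ) (X : Type u) [TopologicalSpace X] :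
    (TopCat.toSSet.obj (TopCat.of X)) _⦋n⦌ ≃ C(stdSimplex ℝ (Fin (n + 1)), X) :=
  TopCat.toSSetObjEquiv (TopCat.of X) (Opposite.op ⦋n⦌)

theorem simplexEquiv_δ {n : ℕ} (x : (TopCat.toSSet.obj (TopCat.of X)) _⦋n + 1⦌) (i : Fin (n + 2)) :
    simplexEquiv n X ((TopCat.toSSet.obj (TopCat.of X)).δ i x) =
      (simplexEquiv (n + 1) X x).comp (coface i) := by
  rfl

theorem simplexEquiv_map {n : ℕ} (f : C(X, Y)) (x : (TopCat.toSSet.obj (TopCat.of X)) _⦋n⦌) :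
    simplexEquiv n Y ((TopCat.toSSet.map (TopCat.ofHom f)).app _ x) =
      f.comp (simplexEquiv n X x) := by
  rfl

/-- The generator of the singular chain group given by a singular simplex. -/
def chainGen {n : ℕ} (x : (TopCat.toSSet.obj (TopCat.of X)) _⦋n⦌) :
    (singularChains.obj (TopCat.of X)).X n :=
  (SSet.ιChainComplex (TopCat.toSSet.obj (TopCat.of X)) (R := ModuleCat.of ℤ (ULift.{u} ℤ)) x).hom
    (ULift.up 1)

/-- The comparison of the singular chain groups of Mathlib with finitely supported functions. -/
def toChainsHom (n : ℕ) (X : Type u) [TopologicalSpace X] :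
    (singularChains.obj (TopCat.of X)).X n ⟶ ModuleCat.of ℤ (Chains n X) :=
  (SSet.isColimitChainComplexXCofan (TopCat.toSSet.obj (TopCat.of X))
    (ModuleCat.of ℤ (ULift.{u} ℤ)) n).desc
    (Cofan.mk _ fun x => ModuleCat.ofHom
      ((Finsupp.lsingle (simplexEquiv n X x)) ∘ₗ ULift.moduleEquiv.toLinearMap))

theorem toChainsHom_gen {n : ℕ} (x : (TopCat.toSSet.obj (TopCat.of X)) _⦋n⦌) :
    (toChainsHom n X).hom (chainGen x) = Finsupp.single (simplexEquiv n X x) 1 := by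
  have := (SSet.isColimitChainComplexXCofan (TopCat.toSSet.obj (TopCat.of X))
    (ModuleCat.of ℤ (ULift.{u} ℤ)) n).fac
    (Cofan.mk (ModuleCat.of ℤ (Chains n X)) fun x => ModuleCat.ofHom
      ((Finsupp.lsingle (simplexEquiv n X x)) ∘ₗ ULift.moduleEquiv.toLinearMap)) ⟨x⟩
  exact congrArg (fun f => f.hom (ULift.up 1)) this

theorem ulift_int_hom_ext {A : Type*} [AddCommGroup A] [Module ℤ A] {f g : ULift.{u} ℤ →ₗ[ℤ] A}
    (h : f (ULift.up 1) = g (ULift.up 1)) : f = g := by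
  have : f ∘ₗ ULift.moduleEquiv.symm.toLinearMap = g ∘ₗ ULift.moduleEquiv.symm.toLinearMap :=
    LinearMap.ext_ring h
  exact LinearMap.ext fun r => LinearMap.congr_fun this r.down

theorem chains_hom_ext {n : ℕ} {A : ModuleCat.{u} ℤ}
    {f g : (singularChains.obj (TopCat.of X)).X n ⟶ A}
    (h : ∀ x : (TopCat.toSSet.obj (TopCat.of X)) _⦋n⦌, f.hom (chainGen x) = g.hom (chainGen x)) :
    f = g := by
  refine SSet.chainComplex_hom_ext fun x => ModuleCat.hom_ext ?_
  exact ulift_int_hom_ext (h x)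

theorem map_chainGen {n : ℕ} (f : C(X, Y)) (x : (TopCat.toSSet.obj (TopCat.of X)) _⦋n⦌) :
    ((singularChains.map (TopCat.ofHom f)).f n).hom (chainGen x) =
      chainGen ((TopCat.toSSet.map (TopCat.ofHom f)).app _ x) := by
  have := SSet.ι_chainComplexMap_f (TopCat.toSSet.obj (TopCat.of X))
    (TopCat.toSSet.obj (TopCat.of Y)) (TopCat.toSSet.map (TopCat.ofHom f)) (ModuleCat.of ℤ (ULift.{u} ℤ)) x
  exact congrArg (fun f => f.hom (ULift.up 1)) this

theorem d_chainGen {n : ℕ} (x : (TopCat.toSSet.obj (TopCat.of X)) _⦋n + 1⦌) :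
    ((singularChains.obj (TopCat.of X)).d (n + 1) n).hom (chainGen x) =
      ∑ i : Fin (n + 2), (-1 : ℤ) ^ i.val •
        chainGen ((TopCat.toSSet.obj (TopCat.of X)).δ i x) := by
  have := SSet.ιChainComplex_d (TopCat.toSSet.obj (TopCat.of X))
    (ModuleCat.of ℤ (ULift.{u} ℤ)) x
  refine (congrArg (fun f => f.hom (ULift.up 1)) this).trans ?_
  simp only [ModuleCat.hom_sum, ModuleCat.hom_zsmul, LinearMap.sum_apply]
  rfl

/-- The singular chain groups of Mathlib are the groups of finitely supported functions on
singular simplices. -/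
def chainsEquiv (n : ℕ) (X : Type u) [TopologicalSpace X] :
    (singularChains.obj (TopCat.of X)).X n ≃ₗ[ℤ] Chains n X :=
  LinearEquiv.ofLinearMap (toChainsHom n X).hom
    (Finsupp.linearCombination ℤ fun σ => chainGen ((simplexEquiv n X).symm σ))
    (by
      refine Finsupp.lhom_ext' fun σ => LinearMap.ext_ring ?_
      have h : Finsupp.linearCombination ℤ (fun σ => chainGen ((simplexEquiv n X).symm σ))
          (Finsupp.single σ (1 : ℤ)) = chainGen ((simplexEquiv n X).symm σ) := by
        rw [Finsupp.linearCombination_single]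
        exact @one_smul ℤ _ _ (_) _
      refine (congrArg (toChainsHom n X).hom h).trans ((toChainsHom_gen _).trans ?_)
      rw [Equiv.apply_symm_apply]
      rfl)
    (by
      have : toChainsHom n X ≫ ModuleCat.ofHom
          (Finsupp.linearCombination ℤ fun σ => chainGen ((simplexEquiv n X).symm σ)) = 𝟙 _ := by
        refine chains_hom_ext fun x => ?_
        refine (congrArg (Finsupp.linearCombination ℤ fun σ =>
          chainGen ((simplexEquiv n X).symm σ)) (toChainsHom_gen x)).trans ?_
        refine (Finsupp.linearCombination_single ℤ _ _).trans ?_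
        rw [Equiv.symm_apply_apply]
        exact @one_smul ℤ _ _ (_) _
      exact congrArg (fun f => f.hom) this)

theorem chainsEquiv_map {n : ℕ} (f : C(X, Y)) (c : (singularChains.obj (TopCat.of X)).X n) :
    chainsEquiv n Y (((singularChains.map (TopCat.ofHom f)).f n).hom c) =
      pushChains n f (chainsEquiv n X c) := by
  have : (singularChains.map (TopCat.ofHom f)).f n ≫ toChainsHom n Y =
      toChainsHom n X ≫ ModuleCat.ofHom (pushChains n f) := by
    refine chains_hom_ext fun x => ?_
    rw [ModuleCat.comp_apply, ModuleCat.comp_apply, map_chainGen, toChainsHom_gen, toChainsHom_gen,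
      simplexEquiv_map]
    exact (pushChains_single _ _ _).symm
  exact congrArg (fun f => f.hom c) this

theorem chainsEquiv_d {n : ℕ} (c : (singularChains.obj (TopCat.of X)).X n) :
    chainsEquiv (n - 1) X (((singularChains.obj (TopCat.of X)).d n (n - 1)).hom c) =
      bdry n (chainsEquiv n X c) := by
  cases n with
  | zero =>
    rw [(singularChains.obj (TopCat.of X)).shape _ _ (by simp)]
    simp [bdry]
  | succ n =>
    have : (singularChains.obj (TopCat.of X)).d (n + 1) n ≫ toChainsHom n X =
        toChainsHom (n + 1) X ≫ ModuleCat.ofHom (dChains n) := by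
      refine chains_hom_ext fun x => ?_
      rw [ModuleCat.comp_apply, ModuleCat.comp_apply, d_chainGen, toChainsHom_gen, map_sum]
      refine Eq.trans ?_ (dChains_single _).symm
      refine Finset.sum_congr rfl fun i _ => ?_
      rw [map_zsmul, toChainsHom_gen, simplexEquiv_δ]
    exact congrArg (fun f => f.hom c) this

end Compare

/-! ### Relative homology classes of relative cycles -/

section Relative

variable {X : Type u} [TopologicalSpace X] {S T S' T' : Set X} {n p : ℕ}

/-- The chains of the subspace `S` as chains of `X`. -/
def ambientChain (n : ℕ) (S : Set X) : (singularChains.obj (TopCat.of S)).X n →ₗ[ℤ] Chains n X :=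
  pushChains n (inclMap S) ∘ₗ (chainsEquiv n S).toLinearMap

theorem ambientChain_injective (n : ℕ) (S : Set X) : Function.Injective (ambientChain n S) :=
  (pushChains_inclMap_injective n S).comp (chainsEquiv n S).injective

theorem ambientChain_mem (c : (singularChains.obj (TopCat.of S)).X n) :
    ambientChain n S c ∈ chainsIn n S :=
  pushChains_inclMap_mem.mpr fun _ _ => by rintro _ ⟨t, rfl⟩; exact Subtype.property _

theorem exists_ambientChain {c : Chains n X} (hc : c ∈ chainsIn n S) :
    ∃ s, ambientChain n S s = c := by
  obtain ⟨c', rfl⟩ := exists_pushChains_inclMap hc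
  obtain ⟨s, rfl⟩ := (chainsEquiv n S).surjective c'
  exact ⟨s, rfl⟩

theorem ambientChain_map (h : S ⊆ S') (c : (singularChains.obj (TopCat.of S)).X n) :
    ambientChain n S' (((singularChains.map (subspaceIncl h)).f n).hom c) = ambientChain n S c := by
  refine (congrArg (pushChains n (inclMap S')) (chainsEquiv_map _ c)).trans ?_
  rw [pushChains_pushChains]
  rfl

theorem ambientChain_d (c : (singularChains.obj (TopCat.of S)).X n) :
    ambientChain (n - 1) S (((singularChains.obj (TopCat.of S)).d n (n - 1)).hom c) =
      bdry n (ambientChain n S c) := by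
  refine (congrArg (pushChains (n - 1) (inclMap S)) (chainsEquiv_d c)).trans ?_
  exact (bdry_pushChains _ _).symm

/-- The quotient map from the chains in `S` to the relative chains. -/
def relProj (S T : Set X) : singularChains.obj (TopCat.of S) ⟶ relChains S T :=
  cokernel.π _

theorem relProj_surjective (n : ℕ) (S T : Set X) :
    Function.Surjective ((relProj S T).f n).hom := by
  have : Epi (relProj S T) := ⟨fun _ _ h => coequalizer.hom_ext h⟩
  exact (ModuleCat.epi_iff_surjective _).mp inferInstance

theorem relProj_eq_zero_iff (c : (singularChains.obj (TopCat.of S)).X n) :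
    ((relProj S T).f n).hom c = 0 ↔ ambientChain n S c ∈ chainsIn n (S ∩ T) := by
  let j := singularChains.map (subspaceIncl (Set.inter_subset_left : S ∩ T ⊆ S))
  let Q : ShortComplex (ChainComplex (ModuleCat.{u} ℤ) ℕ) :=
    ShortComplex.mk j (relProj S T) (cokernel.condition _)
  have hQ : Q.Exact := ShortComplex.exact_of_g_is_cokernel _ (cokernelIsCokernel j)
  have hQn := hQ.map (HomologicalComplex.eval (ModuleCat.{u} ℤ) (ComplexShape.down ℕ) n)
  rw [ShortComplex.moduleCat_exact_iff] at hQn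
  constructor
  · intro h
    obtain ⟨b, hb⟩ := hQn c h
    have h1 := ambientChain_map (n := n) (Set.inter_subset_left : S ∩ T ⊆ S) b
    have h2 : ambientChain n S c = ambientChain n (S ∩ T) b :=
      (congrArg (ambientChain n S) hb.symm).trans h1
    rw [h2]
    exact ambientChain_mem (n := n) (S := S ∩ T) b
  · intro h
    obtain ⟨b, hb⟩ := exists_ambientChain h
    have : ((singularChains.map (subspaceIncl (Set.inter_subset_left : S ∩ T ⊆ S))).f n).hom b =
        c := by
      apply ambientChain_injective n S
      rw [ambientChain_map, hb]
    rw [← this]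
    exact congrArg (fun f => (f.f n).hom b) (cokernel.condition j)

/-- The relative cycles of the pair `(S, S ∩ T)`. -/
def relCycles (p : ℕ) (S T : Set X) : Submodule ℤ (Chains p X) :=
  chainsIn p S ⊓ (chainsIn (p - 1) (S ∩ T)).comap (bdry p)

/-- The chains in `S`, as chains of the subspace `S`. -/
def ambientEquiv (n : ℕ) (S : Set X) :
    (singularChains.obj (TopCat.of S)).X n ≃ₗ[ℤ] chainsIn n S :=
  LinearEquiv.ofBijective ((ambientChain n S).codRestrict _ ambientChain_mem)
    ⟨fun _ _ h => ambientChain_injective n S (congrArg Subtype.val h),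
      fun c => (exists_ambientChain c.2).imp fun _ h => Subtype.ext h⟩

theorem ambientChain_ambientEquiv_symm (c : chainsIn n S) :
    ambientChain n S ((ambientEquiv n S).symm c) = c :=
  congrArg Subtype.val ((ambientEquiv n S).apply_symm_apply c)

/-- The relative chain given by a relative cycle. -/
def relCyclesToChains (p : ℕ) (S T : Set X) :
    ModuleCat.of ℤ (relCycles p S T) ⟶ (relChains S T).X p :=
  ModuleCat.ofHom (((relProj S T).f p).hom ∘ₗ (ambientEquiv p S).symm.toLinearMap ∘ₗ
    Submodule.inclusion inf_le_left)

theorem relCyclesToChains_d (p : ℕ) (S T : Set X) :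
    relCyclesToChains p S T ≫ (relChains S T).d p (p - 1) = 0 := by
  ext c
  have h := congrArg (fun f => f.hom ((ambientEquiv p S).symm ⟨c.1, c.2.1⟩))
    ((relProj S T).comm p (p - 1))
  refine h.trans ?_
  refine (relProj_eq_zero_iff _).mpr ?_
  have h2 := ambientChain_d ((ambientEquiv p S).symm ⟨c.1, c.2.1⟩)
  rw [ambientChain_ambientEquiv_symm] at h2
  have h3 : bdry p c.1 ∈ chainsIn (p - 1) (S ∩ T) := c.2.2
  rw [← h2] at h3
  exact h3

/-- The relative homology class of a relative cycle. -/
def relClass (p : ℕ) (S T : Set X) : relCycles p S T →ₗ[ℤ] relHomology p S T :=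
  ((relChains S T).liftCycles (relCyclesToChains p S T) (p - 1) (by cases p <;> simp)
    (relCyclesToChains_d p S T) ≫ (relChains S T).homologyπ p).hom


theorem homologyπ_eq_zero_iff {K : ChainComplex (ModuleCat.{u} ℤ) ℕ} (z : K.cycles p) :
    (K.homologyπ p).hom z = 0 ↔ ∃ w : K.X (p + 1), (K.toCycles (p + 1) p).hom w = z := by
  let Q := ShortComplex.mk (K.toCycles (p + 1) p) (K.homologyπ p) (K.toCycles_comp_homologyπ _ _)
  have hQ : Q.Exact := ShortComplex.exact_of_g_is_cokernel _
    (K.homologyIsCokernel (p + 1) p (by simp))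
  rw [ShortComplex.moduleCat_exact_iff] at hQ
  refine ⟨fun h => hQ z h, ?_⟩
  rintro ⟨w, rfl⟩
  exact congrArg (fun f => f.hom w) (K.toCycles_comp_homologyπ (p + 1) p)

theorem iCycles_injective (K : ChainComplex (ModuleCat.{u} ℤ) ℕ) (p : ℕ) :
    Function.Injective (K.iCycles p).hom :=
  (ModuleCat.mono_iff_injective _).mp inferInstance

theorem iCycles_liftCycles (c : relCycles p S T) (h1 h2) :
    ((relChains S T).iCycles p).hom (((relChains S T).liftCycles (relCyclesToChains p S T) (p - 1)
      h1 h2).hom c) = ((relProj S T).f p).hom ((ambientEquiv p S).symm ⟨c.1, c.2.1⟩) :=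
  congrArg (fun f => f.hom c) ((relChains S T).liftCycles_i (relCyclesToChains p S T) (p - 1) h1 h2)

theorem relClass_surjective (p : ℕ) (S T : Set X) : Function.Surjective (relClass p S T) := by
  intro z
  obtain ⟨y, rfl⟩ := (ModuleCat.epi_iff_surjective ((relChains S T).homologyπ p)).mp
    inferInstance z
  obtain ⟨s, hs⟩ := relProj_surjective p S T (((relChains S T).iCycles p).hom y)
  have hd : bdry p (ambientChain p S s) ∈ chainsIn (p - 1) (S ∩ T) := by
    rw [← ambientChain_d, ← relProj_eq_zero_iff]
    have h := congrArg (fun f => f.hom s) ((relProj S T).comm p (p - 1))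
    refine h.symm.trans ?_
    refine (congrArg ((relChains S T).d p (p - 1)).hom hs).trans ?_
    exact congrArg (fun f => f.hom y) ((relChains S T).iCycles_d p (p - 1))
  refine ⟨⟨ambientChain p S s, ambientChain_mem s, hd⟩, ?_⟩
  refine congrArg ((relChains S T).homologyπ p).hom ?_
  apply iCycles_injective
  refine (iCycles_liftCycles _ _ _).trans (Eq.trans ?_ hs)
  refine congrArg ((relProj S T).f p).hom ?_
  exact (ambientEquiv p S).symm_apply_apply s

/-- A relative cycle is null-homologous if it is, up to a chain in `S ∩ T`, a boundary in `S`. -/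
theorem relClass_eq_zero_iff (c : relCycles p S T) :
    relClass p S T c = 0 ↔
      ∃ d ∈ chainsIn (p + 1) S, c.1 - dChains p d ∈ chainsIn p (S ∩ T) := by
  have key : ∀ s : (singularChains.obj (TopCat.of S)).X (p + 1),
      ((relChains S T).d (p + 1) p).hom (((relProj S T).f (p + 1)).hom s) =
        ((relProj S T).f p).hom ((ambientEquiv p S).symm ⟨c.1, c.2.1⟩) ↔
      c.1 - dChains p (ambientChain (p + 1) S s) ∈ chainsIn p (S ∩ T) := by
    intro s
    have h := congrArg (fun f => f.hom s) ((relProj S T).comm (p + 1) p)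
    have h1 : ambientChain p S (((singularChains.obj (TopCat.of S)).d (p + 1) p).hom s) =
      dChains p (ambientChain (p + 1) S s) := ambientChain_d s
    have h2 : ambientChain p S ((ambientEquiv p S).symm ⟨c.1, c.2.1⟩) = c.1 :=
      ambientChain_ambientEquiv_symm ⟨c.1, c.2.1⟩
    have h3 := relProj_eq_zero_iff (T := T) ((ambientEquiv p S).symm ⟨c.1, c.2.1⟩ -
      ((singularChains.obj (TopCat.of S)).d (p + 1) p).hom s)
    rw [map_sub, map_sub, h1, h2, sub_eq_zero] at h3
    rw [← h3, eq_comm]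
    exact Iff.of_eq (congrArg _ h)
  refine (homologyπ_eq_zero_iff _).trans ⟨?_, ?_⟩
  · rintro ⟨w, hw⟩
    obtain ⟨s, rfl⟩ := relProj_surjective (p + 1) S T w
    refine ⟨ambientChain (p + 1) S s, ambientChain_mem s, (key s).mp ?_⟩
    have h := congrArg ((relChains S T).iCycles p).hom hw
    replace h := h.trans (iCycles_liftCycles c _ _)
    refine Eq.trans ?_ h
    exact (congrArg (fun f => f.hom (((relProj S T).f (p + 1)).hom s))
      ((relChains S T).toCycles_i (p + 1) p)).symm
  · rintro ⟨d, hd, h⟩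
    obtain ⟨s, rfl⟩ := exists_ambientChain hd
    refine ⟨((relProj S T).f (p + 1)).hom s, ?_⟩
    apply iCycles_injective
    refine Eq.trans ?_ (((key s).mpr h).trans (iCycles_liftCycles c _ _).symm)
    exact congrArg (fun f => f.hom (((relProj S T).f (p + 1)).hom s))
      ((relChains S T).toCycles_i (p + 1) p)

theorem relCycles_mono (hS : S ⊆ S') (hT : S ∩ T ⊆ T') : relCycles p S T ≤ relCycles p S' T' :=
  inf_le_inf (chainsIn_mono hS) (Submodule.comap_mono
    (chainsIn_mono (Set.subset_inter (Set.inter_subset_left.trans hS) hT)))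

theorem relHomologyMap_relClass (hS : S ⊆ S') (hT : S ∩ T ⊆ T') (c : relCycles p S T) :
    relHomologyMap p hS hT (relClass p S T c) =
      relClass p S' T' ⟨c.1, relCycles_mono hS hT c.2⟩ := by
  have h1 := congrArg (fun f => f.hom (((relChains S T).liftCycles (relCyclesToChains p S T) (p - 1)
      (by cases p <;> simp) (relCyclesToChains_d p S T)).hom c))
    (HomologicalComplex.homologyπ_naturality (relChainsMap hS hT) p)
  refine h1.trans ?_
  refine congrArg ((relChains S' T').homologyπ p).hom ?_
  apply iCycles_injective
  refine Eq.trans ?_ (iCycles_liftCycles _ _ _).symm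
  have h2 := congrArg (fun f => f.hom (((relChains S T).liftCycles (relCyclesToChains p S T) (p - 1)
      (by cases p <;> simp) (relCyclesToChains_d p S T)).hom c))
    (HomologicalComplex.cyclesMap_i (relChainsMap hS hT) p)
  refine h2.trans ?_
  refine (congrArg ((relChainsMap hS hT).f p).hom (iCycles_liftCycles c _ _)).trans ?_
  have h3 : relProj S T ≫ relChainsMap hS hT =
      singularChains.map (subspaceIncl hS) ≫ relProj S' T' := cokernel.π_desc _ _ _
  refine (congrArg (fun f => (f.f p).hom ((ambientEquiv p S).symm ⟨c.1, c.2.1⟩)) h3).trans ?_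
  refine congrArg ((relProj S' T').f p).hom ?_
  apply ambientChain_injective
  refine (ambientChain_map hS _).trans ?_
  rw [ambientChain_ambientEquiv_symm, ambientChain_ambientEquiv_symm]

end Relative

/-! ### Ordered chains on a set -/

section OrderedChains

variable {Q R : Type*}

theorem alternating_sum_eq_zero {A : Type*} [AddCommGroup A] {n : ℕ}
    (g : Fin (n + 3) → Fin (n + 2) → A)
    (h : ∀ i j : Fin (n + 2), i ≤ j → g i.castSucc j = g j.succ i) :
    ∑ i, ∑ j, (-1 : ℤ) ^ i.val • (-1 : ℤ) ^ j.val • g i j = 0 := by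
  rw [← Finset.sum_product' Finset.univ Finset.univ
    (fun (i : Fin (n + 3)) (j : Fin (n + 2)) => (-1 : ℤ) ^ i.val • (-1 : ℤ) ^ j.val • g i j)]
  refine Finset.sum_involution (fun x _ => if hx : x.1.val ≤ x.2.val then
    (x.2.succ, ⟨x.1.val, by omega⟩) else (x.2.castSucc, ⟨x.1.val - 1, by omega⟩)) ?_ ?_ ?_ ?_
  · rintro ⟨i, j⟩ -
    by_cases hx : i.val ≤ j.val
    · have := h ⟨i.val, by omega⟩ j hx
      rw [show (⟨i.val, by omega⟩ : Fin (n + 2)).castSucc = i from rfl] at this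
      simp only [hx, dif_pos]
      rw [this, Fin.val_succ, pow_succ]
      simp only [smul_smul, ← add_smul]
      convert zero_smul ℤ _
      ring
    · have := h j ⟨i.val - 1, by omega⟩ (Fin.le_def.mpr (by simp; omega))
      rw [show (⟨i.val - 1, by omega⟩ : Fin (n + 2)).succ = i from Fin.ext (by simp; omega)] at this
      simp only [hx, dif_neg, not_false_eq_true]
      rw [this]
      obtain ⟨k, hk⟩ : ∃ k, i.val = k + 1 := ⟨i.val - 1, by omega⟩
      simp only [hk, Fin.val_castSucc, Nat.add_sub_cancel, pow_succ]
      simp only [smul_smul, ← add_smul]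
      convert zero_smul ℤ _
      ring
  · rintro ⟨i, j⟩ - - heq
    by_cases hx : i.val ≤ j.val
    · simp only [hx, dif_pos, Prod.mk.injEq, Fin.ext_iff, Fin.val_succ] at heq
      omega
    · simp only [hx, dif_neg, not_false_eq_true, Prod.mk.injEq, Fin.ext_iff,
        Fin.val_castSucc] at heq
      omega
  · exact fun _ _ => Finset.mem_product.mpr ⟨Finset.mem_univ _, Finset.mem_univ _⟩
  · rintro ⟨i, j⟩ -
    by_cases hx : i.val ≤ j.val
    · have h2 : ¬ (j.val + 1 ≤ i.val) := by omega
      simp [hx, h2]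
    · have h2 : j.val ≤ i.val - 1 := by omega
      simp only [hx, h2, dif_neg, dif_pos, not_false_eq_true, Fin.val_castSucc, Prod.mk.injEq,
        Fin.ext_iff, Fin.val_succ]
      have h3 : j.val < i.val := not_le.mp hx
      exact ⟨by omega, trivial⟩

/-- The ordered `m`-chains on a set `Q`: the integer combinations of `(m + 1)`-tuples of points. -/
abbrev OrderedChains (m : ℕ) (Q : Type*) : Type _ := (Fin (m + 1) → Q) →₀ ℤ

/-- The boundary of ordered chains. -/
def dOrdered (m : ℕ) : OrderedChains (m + 1) Q →ₗ[ℤ] OrderedChains m Q :=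
  Finsupp.linearCombination ℤ fun w =>
    ∑ i : Fin (m + 2), (-1 : ℤ) ^ i.val • Finsupp.single (w ∘ i.succAbove) 1

/-- The cone with apex `b` over an ordered chain. -/
def cone (m : ℕ) (b : Q) : OrderedChains m Q →ₗ[ℤ] OrderedChains (m + 1) Q :=
  Finsupp.lmapDomain ℤ ℤ fun w : Fin (m + 1) → Q => (Fin.cons b w : Fin (m + 2) → Q)

/-- The sum of the coefficients of an ordered chain. -/
def augmentation : OrderedChains 0 Q →ₗ[ℤ] ℤ :=
  Finsupp.linearCombination ℤ fun _ => 1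

/-- The map of ordered chains induced by a map of sets. -/
def mapOrdered (m : ℕ) (g : Q → R) : OrderedChains m Q →ₗ[ℤ] OrderedChains m R :=
  Finsupp.lmapDomain ℤ ℤ (g ∘ ·)

theorem dOrdered_single {m : ℕ} (w : Fin (m + 2) → Q) :
    dOrdered m (Finsupp.single w 1) =
      ∑ i : Fin (m + 2), (-1 : ℤ) ^ i.val • Finsupp.single (w ∘ i.succAbove) 1 := by
  simp [dOrdered]

theorem cone_single {m : ℕ} (b : Q) (w : Fin (m + 1) → Q) :
    cone m b (Finsupp.single w 1) = Finsupp.single (Fin.cons b w : Fin (m + 2) → Q) 1 := by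
  simp [cone]

theorem mapOrdered_single {m : ℕ} (g : Q → R) (w : Fin (m + 1) → Q) :
    mapOrdered m g (Finsupp.single w 1) = Finsupp.single (g ∘ w) 1 := by
  simp [mapOrdered]

theorem augmentation_single (w : Fin 1 → Q) : augmentation (Finsupp.single w 1) = 1 := by
  simp [augmentation]

theorem augmentation_mapOrdered (g : Q → R) (c : OrderedChains 0 Q) :
    augmentation (mapOrdered 0 g c) = augmentation c := by
  have : augmentation ∘ₗ mapOrdered 0 g = augmentation := by
    refine Finsupp.lhom_ext' fun w => LinearMap.ext_ring ?_
    simp only [LinearMap.comp_apply, Finsupp.lsingle_apply, mapOrdered_single, augmentation_single]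
  exact LinearMap.congr_fun this c

theorem dOrdered_mapOrdered {m : ℕ} (g : Q → R) (c : OrderedChains (m + 1) Q) :
    dOrdered m (mapOrdered (m + 1) g c) = mapOrdered m g (dOrdered m c) := by
  have : dOrdered m ∘ₗ mapOrdered (m + 1) g = mapOrdered m g ∘ₗ dOrdered m := by
    refine Finsupp.lhom_ext' fun w => LinearMap.ext_ring ?_
    simp only [LinearMap.comp_apply, Finsupp.lsingle_apply, mapOrdered_single, dOrdered_single,
      map_sum, map_smul]
    rfl
  exact LinearMap.congr_fun this c

theorem cons_comp_succAbove {m : ℕ} (b : Q) (w : Fin (m + 2) → Q) (i : Fin (m + 2)) :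
    (Fin.cons b w : Fin (m + 3) → Q) ∘ i.succ.succAbove =
      (Fin.cons b (w ∘ i.succAbove) : Fin (m + 2) → Q) := by
  funext j
  refine Fin.cases ?_ (fun k => ?_) j <;> simp

theorem dOrdered_cone {m : ℕ} (b : Q) (c : OrderedChains (m + 1) Q) :
    dOrdered (m + 1) (cone (m + 1) b c) = c - cone m b (dOrdered m c) := by
  have : dOrdered (m + 1) ∘ₗ cone (m + 1) b = LinearMap.id - cone m b ∘ₗ dOrdered m := by
    refine Finsupp.lhom_ext' fun w => LinearMap.ext_ring ?_
    simp only [LinearMap.comp_apply, Finsupp.lsingle_apply, cone_single, dOrdered_single,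
      LinearMap.sub_apply, LinearMap.id_apply, map_sum, map_smul]
    rw [Fin.sum_univ_succ, sub_eq_add_neg, ← Finset.sum_neg_distrib]
    congr 1
    · simp only [Fin.val_zero, pow_zero, one_smul]
      congr 1
    · refine Finset.sum_congr rfl fun i _ => ?_
      rw [cons_comp_succAbove, Fin.val_succ, pow_succ]
      simp
  exact LinearMap.congr_fun this c

theorem dOrdered_cone_zero (b : Q) (c : OrderedChains 0 Q) :
    dOrdered 0 (cone 0 b c) = c - augmentation c • Finsupp.single (fun _ => b) 1 := by
  have : dOrdered 0 ∘ₗ cone 0 b =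
      LinearMap.id - augmentation.smulRight (Finsupp.single (fun _ : Fin 1 => b) (1 : ℤ)) := by
    refine Finsupp.lhom_ext' fun w => LinearMap.ext_ring ?_
    simp only [LinearMap.comp_apply, Finsupp.lsingle_apply, cone_single, dOrdered_single,
      LinearMap.sub_apply, LinearMap.id_apply, LinearMap.smulRight_apply, augmentation_single]
    rw [show ∀ f : Fin (0 + 2) → OrderedChains 0 Q, ∑ i, f i = f 0 + f 1 from
      fun f => Fin.sum_univ_two f]
    simp only [Fin.val_zero, pow_zero, Fin.val_one, pow_one, one_smul, neg_smul, sub_eq_add_neg]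
    have e0 : (Fin.cons b w : Fin (0 + 2) → Q) ∘ (0 : Fin (0 + 2)).succAbove = w := by
      funext j
      simp
    have e1 : (Fin.cons b w : Fin (0 + 2) → Q) ∘ (1 : Fin (0 + 2)).succAbove = fun _ => b := by
      funext j
      fin_cases j
      rfl
    rw [e0, e1]
  exact LinearMap.congr_fun this c

end OrderedChains

/-! ### Universal chains on the prism over the standard simplex -/

section Prism

/-- The prism over the standard `n`-simplex. -/
abbrev Prism (n : ℕ) : Type := stdSimplex ℝ (Fin (n + 1)) × unitInterval

/-- The inclusion of a face of the prism. -/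
def prismFace {n : ℕ} (i : Fin (n + 2)) : C(Prism n, Prism (n + 1)) :=
  (coface i).prodMap (ContinuousMap.id _)

/-- The alternating sum of the maps induced by the inclusions of the faces. -/
def faceSum (m n : ℕ) : OrderedChains m (Prism n) →ₗ[ℤ] OrderedChains m (Prism (n + 1)) :=
  ∑ i : Fin (n + 2), (-1 : ℤ) ^ i.val • mapOrdered m (prismFace i)

theorem prismFace_prismFace {n : ℕ} {i j : Fin (n + 2)} (h : i ≤ j) (x : Prism n) :
    prismFace i.castSucc (prismFace j x) = prismFace j.succ (prismFace i x) := by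
  refine Prod.ext ?_ rfl
  change stdSimplex.map _ (stdSimplex.map _ _) = stdSimplex.map _ (stdSimplex.map _ _)
  rw [stdSimplex.map_comp_apply, stdSimplex.map_comp_apply]
  congr 1
  funext k
  ext
  simp only [Function.comp_apply, Fin.succAbove, Fin.lt_def, Fin.val_castSucc, Fin.val_succ]
  rw [Fin.le_def] at h
  split_ifs <;> simp at * <;> omega

theorem faceSum_faceSum {m n : ℕ} (c : OrderedChains m (Prism n)) :
    faceSum m (n + 1) (faceSum m n c) = 0 := by
  have : faceSum m (n + 1) ∘ₗ faceSum m n = 0 := by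
    refine Finsupp.lhom_ext' fun w => LinearMap.ext_ring ?_
    simp only [LinearMap.comp_apply, Finsupp.lsingle_apply, faceSum, LinearMap.sum_apply,
      LinearMap.smul_apply, mapOrdered_single, map_sum, map_smul, LinearMap.zero_apply,
      Finset.smul_sum]
    refine Eq.trans ?_ (alternating_sum_eq_zero (n := n) (fun i j => Finsupp.single
      (prismFace i ∘ (prismFace j ∘ w)) (1 : ℤ)) fun i j hij => ?_)
    · rw [Finset.sum_comm]
      refine Finset.sum_congr rfl fun i _ => Finset.sum_congr rfl fun j _ => ?_
      rw [smul_comm]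
    · congr 1
      funext k
      exact prismFace_prismFace hij _
  exact LinearMap.congr_fun this c

theorem dOrdered_faceSum {m n : ℕ} (c : OrderedChains (m + 1) (Prism n)) :
    dOrdered m (faceSum (m + 1) n c) = faceSum m n (dOrdered m c) := by
  simp only [faceSum, LinearMap.sum_apply, LinearMap.smul_apply, map_sum, map_smul,
    dOrdered_mapOrdered]

theorem augmentation_faceSum (c : OrderedChains 0 (Prism 0)) :
    augmentation (faceSum 0 0 c) = 0 := by
  simp [faceSum, augmentation_mapOrdered, Fin.sum_univ_two]

/-- The apex of all cones: the barycenter of the bottom of the prism. -/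
def apex (n : ℕ) : Prism n := (stdSimplex.barycenter, 0)

/-- A family of universal chains `u n` on the prisms defining a natural chain map. -/
structure IsChainModel (u : ∀ n, OrderedChains n (Prism n)) : Prop where
  augmentation : augmentation (u 0) = 1
  d_eq : ∀ n, dOrdered n (u (n + 1)) = faceSum n n (u n)

/-- The universal chain of the homotopy between two natural chain maps, constructed by coning. -/
def homotopyModel (u u' : ∀ n, OrderedChains n (Prism n)) :
    ∀ n, OrderedChains (n + 1) (Prism n)
  | 0 => cone 0 (apex 0) (u 0 - u' 0)
  | n + 1 => cone (n + 1) (apex (n + 1))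
      (u (n + 1) - u' (n + 1) - faceSum (n + 1) n (homotopyModel u u' n))

variable {u u' : ∀ n, OrderedChains n (Prism n)}

theorem dOrdered_homotopyModel_zero (hu : IsChainModel u) (hu' : IsChainModel u') :
    dOrdered 0 (homotopyModel u u' 0) = u 0 - u' 0 := by
  rw [homotopyModel, dOrdered_cone_zero, map_sub, hu.augmentation, hu'.augmentation]
  simp

theorem dOrdered_homotopyModel_succ (hu : IsChainModel u) (hu' : IsChainModel u') (n : ℕ) :
    dOrdered (n + 1) (homotopyModel u u' (n + 1)) =
      u (n + 1) - u' (n + 1) - faceSum (n + 1) n (homotopyModel u u' n) := by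
  have key : dOrdered n
      (u (n + 1) - u' (n + 1) - faceSum (n + 1) n (homotopyModel u u' n)) = 0 := by
    rw [map_sub, map_sub, hu.d_eq, hu'.d_eq, dOrdered_faceSum]
    cases n with
    | zero => rw [dOrdered_homotopyModel_zero hu hu', map_sub, sub_self]
    | succ n =>
      rw [dOrdered_homotopyModel_succ hu hu' n, map_sub, map_sub, faceSum_faceSum, sub_zero,
        sub_self]
  rw [homotopyModel, dOrdered_cone, key, map_zero, sub_zero]

/-- The universal chain of the inclusion of the simplex as the slice of the prism at height `s`. -/
def sliceModel (s : unitInterval) (n : ℕ) : OrderedChains n (Prism n) :=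
  Finsupp.single (fun j => (stdSimplex.vertex j, s)) 1

theorem isChainModel_sliceModel (s : unitInterval) : IsChainModel (sliceModel s) where
  augmentation := augmentation_single _
  d_eq n := by
    rw [sliceModel, dOrdered_single, faceSum, LinearMap.sum_apply]
    refine Finset.sum_congr rfl fun i _ => ?_
    rw [LinearMap.smul_apply, sliceModel, mapOrdered_single]
    congr 2
    funext j
    exact Prod.ext (stdSimplex.map_vertex _ _).symm rfl

/-- The universal chain of barycentric subdivision. -/
def sdModel : ∀ n, OrderedChains n (Prism n)
  | 0 => Finsupp.single (fun _ => apex 0) 1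
  | n + 1 => cone n (apex (n + 1)) (faceSum n n (sdModel n))

theorem dOrdered_sdModel : ∀ n, dOrdered n (sdModel (n + 1)) = faceSum n n (sdModel n)
  | 0 => by
    change dOrdered 0 (cone 0 (apex 1) (faceSum 0 0 (sdModel 0))) = _
    rw [dOrdered_cone_zero, augmentation_faceSum, zero_smul, sub_zero]
  | n + 1 => by
    rw [sdModel, dOrdered_cone, dOrdered_faceSum, dOrdered_sdModel n, faceSum_faceSum, map_zero,
      sub_zero]

theorem isChainModel_sdModel : IsChainModel sdModel :=
  ⟨augmentation_single _, dOrdered_sdModel⟩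

end Prism

/-! ### Affine simplices and natural operators on singular chains -/

section Affine

variable {E F : Type*} [AddCommGroup E] [Module ℝ E] [TopologicalSpace E]
  [IsTopologicalAddGroup E] [ContinuousSMul ℝ E]

/-- The affine simplex with vertices `w` in a convex set. -/
def affineSimplex {Q : Set E} (hQ : Convex ℝ Q) {m : ℕ} (w : Fin (m + 1) → Q) :
    C(stdSimplex ℝ (Fin (m + 1)), Q) where
  toFun t := ⟨∑ i, t i • (w i : E),
    hQ.sum_mem (fun i _ => t.2.1 i) t.2.2 fun i _ => (w i).2⟩
  continuous_toFun := by
    refine Continuous.subtype_mk (continuous_finsetSum _ fun i _ => ?_) _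
    exact ((continuous_apply i).comp continuous_subtype_val).smul continuous_const

variable {Q : Set E} (hQ : Convex ℝ Q) {m n : ℕ}

theorem affineSimplex_map (w : Fin (n + 1) → Q) (f : Fin (m + 1) → Fin (n + 1))
    (t : stdSimplex ℝ (Fin (m + 1))) :
    affineSimplex hQ w (stdSimplex.map f t) = affineSimplex hQ (w ∘ f) t := by
  ext
  change ∑ j, (stdSimplex.map f t) j • (w j : E) = ∑ i, t i • (w (f i) : E)
  simp only [stdSimplex.map_coe, FunOnFinite.linearMap_apply_apply, Finset.sum_smul]
  rw [← Finset.sum_fiberwise Finset.univ f fun i => t i • (w (f i) : E)]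
  refine Finset.sum_congr rfl fun j _ => Finset.sum_congr rfl fun i hi => ?_
  rw [(Finset.mem_filter.mp hi).2]

/-- The vertices of an affine simplex are its values at the vertices, and affine simplices compose
to affine simplices. -/
theorem affineSimplex_affineSimplex (v : Fin (n + 1) → Q)
    (w : Fin (m + 1) → stdSimplex ℝ (Fin (n + 1))) (t : stdSimplex ℝ (Fin (m + 1))) :
    affineSimplex hQ v (affineSimplex (convex_stdSimplex ℝ _) w t) =
      affineSimplex hQ (fun j => affineSimplex hQ v (w j)) t := by
  ext
  change ∑ i, (∑ j, t j • (w j : Fin (n + 1) → ℝ)) i • (v i : E) =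
    ∑ j, t j • ∑ i, (w j) i • (v i : E)
  simp only [Finset.sum_apply, Finset.sum_smul, Finset.smul_sum, Pi.smul_apply, smul_smul,
    smul_eq_mul]
  exact Finset.sum_comm

theorem stdSimplex_map_affineSimplex {k : ℕ} (f : Fin (n + 1) → Fin (k + 1))
    (w : Fin (m + 1) → stdSimplex ℝ (Fin (n + 1))) (t : stdSimplex ℝ (Fin (m + 1))) :
    stdSimplex.map f (affineSimplex (convex_stdSimplex ℝ _) w t) =
      affineSimplex (convex_stdSimplex ℝ _) (fun j => stdSimplex.map f (w j)) t := by
  refine Subtype.ext ?_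
  change FunOnFinite.linearMap ℝ ℝ f (∑ j, t j • (w j : Fin (n + 1) → ℝ)) =
    ∑ j, t j • FunOnFinite.linearMap ℝ ℝ f (w j)
  simp only [map_sum, map_smul]

theorem affineSimplex_vertex (t : stdSimplex ℝ (Fin (n + 1))) :
    affineSimplex (convex_stdSimplex ℝ _) (fun j => stdSimplex.vertex j) t = t := by
  ext k
  change (∑ j, t j • (Pi.single j (1 : ℝ) : Fin (n + 1) → ℝ)) k = t k
  simp [Finset.sum_apply, Pi.single_apply]

theorem affineSimplex_const (q : Q) (t : stdSimplex ℝ (Fin (m + 1))) :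
    affineSimplex hQ (fun _ => q) t = q := by
  ext
  change ∑ j, t j • (q : E) = q
  rw [← Finset.sum_smul, stdSimplex.sum_eq_one, one_smul]

/-- The affine simplex with vertices `w` in a prism. -/
def prismSimplex (w : Fin (m + 1) → Prism n) : C(stdSimplex ℝ (Fin (m + 1)), Prism n) :=
  (affineSimplex (convex_stdSimplex ℝ _) fun i => (w i).1).prodMk
    (affineSimplex (Q := unitInterval) (convex_Icc 0 1) fun i => (w i).2)

theorem prismSimplex_comp_coface (w : Fin (m + 2) → Prism n) (i : Fin (m + 2)) :
    (prismSimplex w).comp (coface i) = prismSimplex (w ∘ i.succAbove) :=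
  ContinuousMap.ext fun t => Prod.ext (affineSimplex_map _ _ i.succAbove t)
    (affineSimplex_map _ _ i.succAbove t)

theorem prismFace_comp_prismSimplex (w : Fin (m + 1) → Prism n) (i : Fin (n + 2)) :
    (prismFace i).comp (prismSimplex w) = prismSimplex (prismFace i ∘ w) :=
  ContinuousMap.ext fun t => Prod.ext (stdSimplex_map_affineSimplex i.succAbove _ t) rfl

end Affine

section Operators

variable {X Y : Type*} [TopologicalSpace X] [TopologicalSpace Y] {m n : ℕ}

/-- The singular chain in `X` given by an ordered chain on a prism and a map to `X`. -/
def realize (m : ℕ) (f : C(Prism n, X)) : OrderedChains m (Prism n) →ₗ[ℤ] Chains m X :=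
  Finsupp.linearCombination ℤ fun w => Finsupp.single (f.comp (prismSimplex w)) 1

theorem realize_single (f : C(Prism n, X)) (w : Fin (m + 1) → Prism n) :
    realize m f (Finsupp.single w 1) = Finsupp.single (f.comp (prismSimplex w)) 1 := by
  simp [realize]

theorem dChains_realize (f : C(Prism n, X)) (u : OrderedChains (m + 1) (Prism n)) :
    dChains m (realize (m + 1) f u) = realize m f (dOrdered m u) := by
  have : dChains m ∘ₗ realize (m + 1) f = realize m f ∘ₗ dOrdered m := by
    refine Finsupp.lhom_ext' fun w => LinearMap.ext_ring ?_
    simp only [LinearMap.comp_apply, Finsupp.lsingle_apply, realize_single, dChains_single,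
      dOrdered_single, map_sum, map_smul]
    refine Finset.sum_congr rfl fun i _ => ?_
    rw [← prismSimplex_comp_coface]
    rfl
  exact LinearMap.congr_fun this u

theorem realize_comp_prismFace (f : C(Prism (n + 1), X)) (i : Fin (n + 2))
    (u : OrderedChains m (Prism n)) :
    realize m (f.comp (prismFace i)) u = realize m f (mapOrdered m (prismFace i) u) := by
  have : realize m (f.comp (prismFace i)) = realize m f ∘ₗ mapOrdered m (prismFace i) := by
    refine Finsupp.lhom_ext' fun w => LinearMap.ext_ring ?_
    simp only [LinearMap.comp_apply, Finsupp.lsingle_apply, realize_single, mapOrdered_single]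
    rw [← prismFace_comp_prismSimplex]
    rfl
  exact LinearMap.congr_fun this u

theorem realize_mem {f : C(Prism n, X)} {S : Set X} (h : ∀ x, f x ∈ S)
    (u : OrderedChains m (Prism n)) : realize m f u ∈ chainsIn m S := by
  rw [realize, Finsupp.linearCombination_apply]
  exact Submodule.sum_mem _ fun w _ => Submodule.smul_mem _ _
    (single_mem_chainsIn (σ := f.comp (prismSimplex w)) (fun _ => h _) 1)

/-- The natural operator on singular chains that is given by a universal chain on the prism and a
family of maps `D` from `Y` to `X` parametrized by the unit interval. -/
def prismOperator (D : C(Y × unitInterval, X)) :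
    OrderedChains m (Prism n) →ₗ[ℤ] Chains n Y →ₗ[ℤ] Chains m X :=
  (Finsupp.linearCombination ℤ fun σ : C(stdSimplex ℝ (Fin (n + 1)), Y) =>
    realize m (D.comp (σ.prodMap (ContinuousMap.id _)))).flip

variable (D : C(Y × unitInterval, X))

theorem prismOperator_single (u : OrderedChains m (Prism n))
    (σ : C(stdSimplex ℝ (Fin (n + 1)), Y)) :
    prismOperator D u (Finsupp.single σ 1) =
      realize m (D.comp (σ.prodMap (ContinuousMap.id _))) u := by
  simp [prismOperator]

theorem dChains_prismOperator (u : OrderedChains (m + 1) (Prism n)) (c : Chains n Y) :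
    dChains m (prismOperator D u c) = prismOperator D (dOrdered m u) c := by
  have : dChains m ∘ₗ prismOperator D u = prismOperator D (dOrdered m u) := by
    refine Finsupp.lhom_ext' fun σ => LinearMap.ext_ring ?_
    simp only [LinearMap.comp_apply, Finsupp.lsingle_apply, prismOperator_single, dChains_realize]
  exact LinearMap.congr_fun this c

theorem prismOperator_dChains (u : OrderedChains m (Prism n)) (c : Chains (n + 1) Y) :
    prismOperator D u (dChains n c) = prismOperator D (faceSum m n u) c := by
  have : prismOperator D u ∘ₗ dChains n = prismOperator D (faceSum m n u) := by
    refine Finsupp.lhom_ext' fun σ => LinearMap.ext_ring ?_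
    simp only [LinearMap.comp_apply, Finsupp.lsingle_apply, prismOperator_single, dChains_single,
      faceSum, LinearMap.sum_apply, LinearMap.smul_apply, map_sum, map_smul]
    refine Finset.sum_congr rfl fun i _ => ?_
    rw [← realize_comp_prismFace]
    rfl
  exact LinearMap.congr_fun this c

variable {D}

theorem prismOperator_mem {S : Set Y} {T : Set X} (h : ∀ x ∈ S, ∀ s, D (x, s) ∈ T)
    (u : OrderedChains m (Prism n)) {c : Chains n Y} (hc : c ∈ chainsIn n S) :
    prismOperator D u c ∈ chainsIn m T := by
  have : chainsIn n S ≤ (chainsIn m T).comap (prismOperator D u) := by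
    refine chainsIn_le fun σ hσ => ?_
    rw [Submodule.mem_comap, prismOperator_single]
    exact realize_mem (fun x => h _ (hσ _) _) u
  exact this hc

theorem prismOperator_sliceModel {s : unitInterval} {f : C(Y, X)} (hf : ∀ y, D (y, s) = f y)
    (c : Chains n Y) : prismOperator D (sliceModel s n) c = pushChains n f c := by
  have : prismOperator D (sliceModel s n) = pushChains n f := by
    refine Finsupp.lhom_ext' fun σ => LinearMap.ext_ring ?_
    simp only [LinearMap.comp_apply, Finsupp.lsingle_apply, prismOperator_single, sliceModel,
      realize_single, pushChains_single]
    congr 1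
    ext t
    refine Eq.trans ?_ (hf (σ t))
    refine congrArg D (Prod.ext (congrArg σ (affineSimplex_vertex t)) ?_)
    exact affineSimplex_const (Q := unitInterval) (convex_Icc 0 1) s t
  exact LinearMap.congr_fun this c

/-- Natural chain maps given by universal chains are naturally chain homotopic, hence they agree
on relative cycles up to a boundary and a chain in the second space of the pair. -/
theorem exists_prismOperator_homotopy {u u' : ∀ n, OrderedChains n (Prism n)}
    (hu : IsChainModel u) (hu' : IsChainModel u') {S T : Set Y} {S' T' : Set X}
    (hS : ∀ x ∈ S, ∀ s, D (x, s) ∈ S') (hT : ∀ x ∈ T, ∀ s, D (x, s) ∈ T') {c : Chains n Y}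
    (hc : c ∈ chainsIn n S) (hdc : bdry n c ∈ chainsIn (n - 1) T) :
    ∃ d ∈ chainsIn (n + 1) S',
      prismOperator D (u n) c - prismOperator D (u' n) c - dChains n d ∈ chainsIn n T' := by
  refine ⟨prismOperator D (homotopyModel u u' n) c, prismOperator_mem hS _ hc, ?_⟩
  rw [dChains_prismOperator]
  cases n with
  | zero =>
    rw [dOrdered_homotopyModel_zero hu hu', map_sub, LinearMap.sub_apply, sub_self]
    exact Submodule.zero_mem _
  | succ n =>
    rw [dOrdered_homotopyModel_succ hu hu', map_sub, map_sub, LinearMap.sub_apply,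
      LinearMap.sub_apply, sub_sub_cancel, ← prismOperator_dChains]
    exact prismOperator_mem hT _ hdc

/-- Homotopy invariance for relative cycles. -/
theorem exists_pushChains_homotopy {f g : C(Y, X)} (D : C(Y × unitInterval, X))
    (hf : ∀ y, D (y, 0) = f y) (hg : ∀ y, D (y, 1) = g y) {S T : Set Y} {S' T' : Set X}
    (hS : ∀ x ∈ S, ∀ s, D (x, s) ∈ S') (hT : ∀ x ∈ T, ∀ s, D (x, s) ∈ T') {c : Chains n Y}
    (hc : c ∈ chainsIn n S) (hdc : bdry n c ∈ chainsIn (n - 1) T) :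
    ∃ d ∈ chainsIn (n + 1) S',
      pushChains n f c - pushChains n g c - dChains n d ∈ chainsIn n T' := by
  have := exists_prismOperator_homotopy (isChainModel_sliceModel 0) (isChainModel_sliceModel 1)
    hS hT hc hdc
  rwa [prismOperator_sliceModel hf, prismOperator_sliceModel hg] at this

/-! ### Barycentric subdivision -/

/-- Barycentric subdivision of singular chains. -/
def subdivide (n : ℕ) : Module.End ℤ (Chains n X) :=
  prismOperator ⟨Prod.fst, continuous_fst⟩ (sdModel n)

theorem subdivide_mem {S : Set X} {c : Chains n X} (hc : c ∈ chainsIn n S) :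
    subdivide n c ∈ chainsIn n S :=
  prismOperator_mem (fun _ hx _ => hx) _ hc

theorem subdivide_pow_mem {S : Set X} {c : Chains n X} (hc : c ∈ chainsIn n S) (m : ℕ) :
    (subdivide n ^ m) c ∈ chainsIn n S := by
  induction m with
  | zero => exact hc
  | succ m ih =>
    rw [pow_succ', Module.End.mul_apply]
    exact subdivide_mem ih

theorem dChains_subdivide (c : Chains (n + 1) X) :
    dChains n (subdivide (n + 1) c) = subdivide n (dChains n c) := by
  rw [subdivide, dChains_prismOperator, dOrdered_sdModel, ← prismOperator_dChains]
  rfl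

theorem dChains_subdivide_pow (c : Chains (n + 1) X) (m : ℕ) :
    dChains n ((subdivide (n + 1) ^ m) c) = (subdivide n ^ m) (dChains n c) := by
  induction m with
  | zero => rfl
  | succ m ih =>
    rw [pow_succ', pow_succ', Module.End.mul_apply, Module.End.mul_apply, dChains_subdivide, ih]

theorem bdry_subdivide_pow_mem {S : Set X} {c : Chains n X} (hc : bdry n c ∈ chainsIn (n - 1) S)
    (m : ℕ) : bdry n ((subdivide n ^ m) c) ∈ chainsIn (n - 1) S := by
  cases n with
  | zero => exact Submodule.zero_mem _
  | succ n =>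
    rw [show bdry (n + 1) ((subdivide (n + 1) ^ m) c) = (subdivide n ^ m) (dChains n c) from
      dChains_subdivide_pow c m]
    exact subdivide_pow_mem hc m

/-- An iterated subdivision of a relative cycle is homologous to it. -/
theorem exists_subdivide_homotopy {S T : Set X} {c : Chains n X} (hc : c ∈ chainsIn n S)
    (hdc : bdry n c ∈ chainsIn (n - 1) T) (m : ℕ) :
    ∃ d ∈ chainsIn (n + 1) S, c - (subdivide n ^ m) c - dChains n d ∈ chainsIn n T := by
  induction m with
  | zero => exact ⟨0, Submodule.zero_mem _, by simp⟩
  | succ m ih =>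
    obtain ⟨d, hd, h⟩ := ih
    obtain ⟨d', hd', h'⟩ := exists_prismOperator_homotopy
      (D := (⟨Prod.fst, continuous_fst⟩ : C(X × unitInterval, X)))
      (isChainModel_sliceModel 0) isChainModel_sdModel (fun _ hx _ => hx) (fun _ hx _ => hx)
      (subdivide_pow_mem hc m) (bdry_subdivide_pow_mem hdc m)
    rw [prismOperator_sliceModel (f := ContinuousMap.id X) (fun _ => rfl), pushChains_id] at h'
    refine ⟨d + d', Submodule.add_mem _ hd hd', ?_⟩
    rw [pow_succ', Module.End.mul_apply]
    have := Submodule.add_mem _ h h'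
    convert this using 1
    rw [map_add, subdivide]
    abel

end Operators

/-! ### The pieces of an iterated subdivision are small -/

section Small

variable {m n : ℕ}

theorem dist_affineSimplex_le {N : ℕ} (v : Fin (m + 1) → stdSimplex ℝ (Fin (N + 1)))
    (z : stdSimplex ℝ (Fin (N + 1))) {r : ℝ} (h : ∀ i, dist (v i) z ≤ r)
    (t : stdSimplex ℝ (Fin (m + 1))) : dist (affineSimplex (convex_stdSimplex ℝ _) v t) z ≤ r :=
  (convex_closedBall (z : Fin (N + 1) → ℝ) r).sum_mem (fun i _ => t.2.1 i) t.2.2 fun i _ => h i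

theorem dist_barycenter_le {N : ℕ} (v : Fin (n + 1) → stdSimplex ℝ (Fin (N + 1))) {ε : ℝ}
    (h : ∀ i j, dist (v i) (v j) ≤ ε) (k : Fin (n + 1)) :
    dist (v k) (affineSimplex (convex_stdSimplex ℝ _) v stdSimplex.barycenter) ≤
      n / (n + 1) * ε := by
  have hn : (0 : ℝ) < n + 1 := by positivity
  rw [dist_comm, Subtype.dist_eq, dist_eq_norm]
  have hb : (affineSimplex (convex_stdSimplex ℝ _) v stdSimplex.barycenter).1 =
      ∑ j, ((n : ℝ) + 1)⁻¹ • (v j).1 := by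
    change ∑ j : Fin (n + 1), (Fintype.card (Fin (n + 1)) : ℝ)⁻¹ • (v j).1 = _
    simp
  have e : (affineSimplex (convex_stdSimplex ℝ _) v stdSimplex.barycenter).1 - (v k).1 =
      ∑ j, ((n : ℝ) + 1)⁻¹ • ((v j).1 - (v k).1) := by
    rw [hb, ← Finset.smul_sum, ← Finset.smul_sum, Finset.sum_sub_distrib, smul_sub,
      Finset.sum_const, Finset.card_univ, Fintype.card_fin, ← Nat.cast_smul_eq_nsmul ℝ, smul_smul]
    push_cast
    rw [inv_mul_cancel₀ hn.ne', one_smul]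
  rw [e]
  refine (norm_sum_le _ _).trans ?_
  have h1 : ∀ j, ‖((n : ℝ) + 1)⁻¹ • ((v j).1 - (v k).1)‖ ≤
      if j = k then 0 else ((n : ℝ) + 1)⁻¹ * ε := by
    intro j
    split_ifs with hj
    · simp [hj]
    · rw [norm_smul, Real.norm_of_nonneg (by positivity)]
      exact mul_le_mul_of_nonneg_left (h j k) (by positivity)
  refine (Finset.sum_le_sum fun j _ => h1 j).trans (le_of_eq ?_)
  rw [Finset.sum_ite, Finset.sum_const_zero, zero_add, Finset.sum_const,
    Finset.filter_ne' Finset.univ k, Finset.card_erase_of_mem (Finset.mem_univ k),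
    Finset.card_univ, Fintype.card_fin]
  simp only [Nat.add_sub_cancel, nsmul_eq_mul]
  field_simp

/-- The tuple `w` of points of a prism shrinks the diameter of every affine simplex by the factor
`n / (n + 1)`. -/
def IsShrinking (w : Fin (m + 1) → Prism n) : Prop :=
  ∀ (N : ℕ) (v : Fin (n + 1) → stdSimplex ℝ (Fin (N + 1))) (ε : ℝ),
    (∀ i j, dist (v i) (v j) ≤ ε) → ∀ i j,
      dist (affineSimplex (convex_stdSimplex ℝ _) v (w i).1)
        (affineSimplex (convex_stdSimplex ℝ _) v (w j).1) ≤ n / (n + 1) * ε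

theorem IsShrinking.cons {w : Fin (m + 1) → Prism n} (hw : IsShrinking w) (k : Fin (n + 2)) :
    IsShrinking (Fin.cons (apex (n + 1)) (prismFace k ∘ w) : Fin (m + 2) → Prism (n + 1)) := by
  intro N v ε hv
  have hε : 0 ≤ ε := dist_nonneg.trans (hv 0 0)
  have hmono : (n : ℝ) / (n + 1) * ε ≤ ((n + 1 : ℕ) : ℝ) / ((n + 1 : ℕ) + 1) * ε := by
    refine mul_le_mul_of_nonneg_right ?_ hε
    rw [div_le_div_iff₀ (by positivity) (by positivity)]
    push_cast
    nlinarith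
  have hb : ∀ x, dist (affineSimplex (convex_stdSimplex ℝ _) v x)
      (affineSimplex (convex_stdSimplex ℝ _) v stdSimplex.barycenter) ≤
        ((n + 1 : ℕ) : ℝ) / ((n + 1 : ℕ) + 1) * ε :=
    dist_affineSimplex_le v _ (dist_barycenter_le v hv)
  intro i j
  refine Fin.cases ?_ (fun i => ?_) i
  · refine Fin.cases ?_ (fun j => ?_) j
    · rw [dist_self]
      positivity
    · rw [dist_comm]
      exact hb _
  · refine Fin.cases (hb _) (fun j => ?_) j
    refine le_trans ?_ hmono
    have := hw N (v ∘ k.succAbove) ε (fun _ _ => hv _ _) i j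
    rwa [← affineSimplex_map, ← affineSimplex_map] at this

theorem sdModel_mem (n : ℕ) :
    sdModel n ∈ Finsupp.supported ℤ ℤ {w : Fin (n + 1) → Prism n | IsShrinking w} := by
  induction n with
  | zero =>
    refine Finsupp.single_mem_supported ℤ _ ?_
    intro N v ε hv i j
    simp
  | succ n ih =>
    have : Finsupp.supported ℤ ℤ {w : Fin (n + 1) → Prism n | IsShrinking w} ≤
        (Finsupp.supported ℤ ℤ {w : Fin (n + 2) → Prism (n + 1) | IsShrinking w}).comap
          (cone n (apex (n + 1)) ∘ₗ faceSum n n) := by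
      rw [Finsupp.supported_eq_span_single, Submodule.span_le]
      rintro _ ⟨w, hw, rfl⟩
      simp only [Submodule.comap_coe, Set.mem_preimage, SetLike.mem_coe, LinearMap.comp_apply,
        faceSum, LinearMap.sum_apply, LinearMap.smul_apply, mapOrdered_single, map_sum, map_smul,
        cone_single]
      exact Submodule.sum_mem _ fun k _ => Submodule.smul_mem _ _
        (Finsupp.single_mem_supported ℤ _ (IsShrinking.cons hw k))
    exact this ih

variable {X : Type*} [TopologicalSpace X]

/-- The chains spanned by the affine simplices of diameter at most `ε` in a singular simplex. -/
def smallChains (σ : C(stdSimplex ℝ (Fin (n + 1)), X)) (ε : ℝ) : Submodule ℤ (Chains n X) :=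
  Submodule.span ℤ {c | ∃ w : Fin (n + 1) → stdSimplex ℝ (Fin (n + 1)),
    (∀ i j, dist (w i) (w j) ≤ ε) ∧
      c = Finsupp.single (σ.comp (affineSimplex (convex_stdSimplex ℝ _) w)) 1}

theorem subdivide_mem_smallChains (σ : C(stdSimplex ℝ (Fin (n + 1)), X)) {ε : ℝ}
    {c : Chains n X} (hc : c ∈ smallChains σ ε) :
    subdivide n c ∈ smallChains σ (n / (n + 1) * ε) := by
  have : smallChains σ ε ≤ (smallChains σ (n / (n + 1) * ε)).comap (subdivide n) := by
    rw [smallChains, Submodule.span_le]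
    rintro _ ⟨v, hv, rfl⟩
    refine Submodule.mem_comap.mpr ?_
    rw [subdivide, prismOperator_single]
    obtain ⟨f, hf⟩ : ∃ f : C(Prism n, X), f = ContinuousMap.comp
        (⟨Prod.fst, continuous_fst⟩ : C(X × unitInterval, X))
        (((σ.comp (affineSimplex (convex_stdSimplex ℝ _) v))).prodMap (ContinuousMap.id _)) :=
      ⟨_, rfl⟩
    rw [← hf]
    have h2 : Finsupp.supported ℤ ℤ {w : Fin (n + 1) → Prism n | IsShrinking w} ≤
        (smallChains σ (n / (n + 1) * ε)).comap (realize n f) := by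
      rw [Finsupp.supported_eq_span_single, Submodule.span_le]
      rintro _ ⟨w, hw, rfl⟩
      refine Submodule.mem_comap.mpr ?_
      rw [realize_single]
      refine Submodule.subset_span ⟨fun j => affineSimplex (convex_stdSimplex ℝ _) v (w j).1,
        hw n v ε hv, ?_⟩
      congr 1
      ext t
      rw [hf]
      exact congrArg σ (affineSimplex_affineSimplex (convex_stdSimplex ℝ _) v (fun j => (w j).1) t)
    exact h2 (sdModel_mem n)
  exact this hc

theorem subdivide_pow_mem_smallChains (σ : C(stdSimplex ℝ (Fin (n + 1)), X)) (m : ℕ) :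
    (subdivide n ^ m) (Finsupp.single σ 1) ∈ smallChains σ ((n / (n + 1) : ℝ) ^ m) := by
  induction m with
  | zero =>
    refine Submodule.subset_span ⟨fun j => stdSimplex.vertex j, fun i j => ?_, ?_⟩
    · rw [pow_zero, Subtype.dist_eq]
      refine (Metric.dist_le_diam_of_mem (bounded_stdSimplex _) (Subtype.property _)
        (Subtype.property _)).trans diam_stdSimplex_le
    · change Finsupp.single σ 1 = _
      congr 1
      ext t
      exact congrArg σ (affineSimplex_vertex t).symm
  | succ m ih =>
    rw [pow_succ', pow_succ', Module.End.mul_apply]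
    exact subdivide_mem_smallChains σ ih

/-- By the Lebesgue number lemma, an iterated subdivision of a singular chain in `O₁ ∪ O₂` is a
sum of chains in `O₁` and in `O₂`, where `O₁` and `O₂` are open. -/
theorem exists_subdivide_pow_mem {S O₁ O₂ : Set X} (h₁ : IsOpen O₁) (h₂ : IsOpen O₂)
    (hS : S ⊆ O₁ ∪ O₂) {c : Chains n X} (hc : c ∈ chainsIn n S) :
    ∃ m, ∀ k, m ≤ k → (subdivide n ^ k) c ∈ chainsIn n (S ∩ O₁) ⊔ chainsIn n (S ∩ O₂) := by
  let N : Submodule ℤ (Chains n X) :=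
    { carrier := {c | ∃ m, ∀ k, m ≤ k →
        (subdivide n ^ k) c ∈ chainsIn n (S ∩ O₁) ⊔ chainsIn n (S ∩ O₂)}
      add_mem' := by
        rintro a b ⟨m, hm⟩ ⟨m', hm'⟩
        refine ⟨max m m', fun k hk => ?_⟩
        rw [map_add]
        exact Submodule.add_mem _ (hm k (le_of_max_le_left hk)) (hm' k (le_of_max_le_right hk))
      zero_mem' := ⟨0, fun k _ => by rw [map_zero]; exact Submodule.zero_mem _⟩
      smul_mem' := by
        rintro r a ⟨m, hm⟩
        refine ⟨m, fun k hk => ?_⟩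
        rw [map_smul]
        exact Submodule.smul_mem _ _ (hm k hk) }
  have : chainsIn n S ≤ N := by
    refine chainsIn_le fun σ hσ => ?_
    obtain ⟨δ, hδ, hball⟩ := lebesgue_number_lemma_of_metric (c := fun b : Bool =>
      σ ⁻¹' (cond b O₁ O₂)) (isCompact_univ (X := stdSimplex ℝ (Fin (n + 1))))
      (fun b => by cases b; exacts [h₂.preimage σ.continuous, h₁.preimage σ.continuous])
      (fun t _ => by
        rcases hS (hσ t) with h | h
        · exact Set.mem_iUnion.mpr ⟨true, h⟩
        · exact Set.mem_iUnion.mpr ⟨false, h⟩)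
    have hlt : (n / (n + 1) : ℝ) < 1 := by
      rw [div_lt_one (by positivity)]
      linarith
    obtain ⟨m, hm⟩ := exists_pow_lt_of_lt_one hδ hlt
    refine ⟨m, fun k hk => ?_⟩
    have hk' : (n / (n + 1) : ℝ) ^ k < δ :=
      (pow_le_pow_of_le_one (by positivity) hlt.le hk).trans_lt hm
    refine (show smallChains σ ((n / (n + 1) : ℝ) ^ k) ≤ _ from ?_)
      (subdivide_pow_mem_smallChains σ k)
    rw [smallChains, Submodule.span_le]
    rintro _ ⟨w, hw, rfl⟩
    obtain ⟨b, hb⟩ := hball (w 0) (Set.mem_univ _)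
    have hmem : ∀ t, affineSimplex (convex_stdSimplex ℝ _) w t ∈ σ ⁻¹' (cond b O₁ O₂) := fun t =>
      hb (Metric.mem_ball.mpr ((dist_affineSimplex_le w (w 0) (fun i => hw i 0) t).trans_lt hk'))
    cases b
    · exact Submodule.mem_sup_right (single_mem_chainsIn
        (σ := σ.comp (affineSimplex (convex_stdSimplex ℝ _) w)) (fun t => Set.mem_inter (hσ _) (hmem t)) 1)
    · exact Submodule.mem_sup_left (single_mem_chainsIn
        (σ := σ.comp (affineSimplex (convex_stdSimplex ℝ _) w)) (fun t => Set.mem_inter (hσ _) (hmem t)) 1)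
  exact this hc

end Small

/-! ### Excision -/

section Excision

variable {X : Type u} [TopologicalSpace X] {S P T O₁ O₂ : Set X} {p : ℕ}

theorem mem_relCycles {c : Chains p X} (hc : c ∈ chainsIn p S)
    (hdc : bdry p c ∈ chainsIn (p - 1) T) : c ∈ relCycles p S T :=
  ⟨hc, mem_chainsIn_inter (bdry_mem hc) hdc⟩

theorem relClass_eq_of_sub {c c' : relCycles p S T} {d : Chains (p + 1) X}
    (hd : d ∈ chainsIn (p + 1) S) (h : c.1 - c'.1 - dChains p d ∈ chainsIn p T) :
    relClass p S T c = relClass p S T c' := by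
  rw [← sub_eq_zero, ← map_sub, relClass_eq_zero_iff]
  exact ⟨d, hd, mem_chainsIn_inter
    (Submodule.sub_mem _ (Submodule.sub_mem _ c.2.1 c'.2.1) (dChains_mem hd)) h⟩

/-- **Excision** for singular homology: if `S` is covered by two open sets `O₁` and `O₂` with
`S ∩ O₁ ⊆ P` and `S ∩ O₂ ⊆ T`, then the inclusion of `(P, P ∩ T)` into `(S, S ∩ T)` induces an
isomorphism in homology. -/
theorem relHomologyMap_bijective_of_excision (hP : P ⊆ S) (h₁ : IsOpen O₁) (h₂ : IsOpen O₂)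
    (hS : S ⊆ O₁ ∪ O₂) (hO₁ : S ∩ O₁ ⊆ P) (hO₂ : S ∩ O₂ ⊆ T) :
    Function.Bijective (relHomologyMap p hP (Set.inter_subset_right : P ∩ T ⊆ T)) := by
  have small : ∀ {n : ℕ} {c : Chains n X}, c ∈ chainsIn n S → ∃ m, ∃ a ∈ chainsIn n P,
      ∃ b ∈ chainsIn n T, a + b = (subdivide n ^ m) c := by
    intro n c hc
    obtain ⟨m, hm⟩ := exists_subdivide_pow_mem h₁ h₂ hS hc
    obtain ⟨a, ha, b, hb, hab⟩ := Submodule.mem_sup.mp (hm m le_rfl)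
    exact ⟨m, a, chainsIn_mono hO₁ ha, b, chainsIn_mono hO₂ hb, hab⟩
  constructor
  · rw [← LinearMap.ker_eq_bot, LinearMap.ker_eq_bot']
    intro z hz
    obtain ⟨c, rfl⟩ := relClass_surjective p P T z
    rw [relHomologyMap_relClass, relClass_eq_zero_iff] at hz
    obtain ⟨d, hd, h⟩ := hz
    obtain ⟨m, a, ha, b, hb, hab⟩ := small hd
    have hdc : bdry p c.1 ∈ chainsIn (p - 1) T := chainsIn_mono Set.inter_subset_right c.2.2
    obtain ⟨d', hd', h'⟩ := exists_subdivide_homotopy c.2.1 hdc m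
    rw [relClass_eq_zero_iff]
    refine ⟨d' + a, Submodule.add_mem _ hd' ha, mem_chainsIn_inter
      (Submodule.sub_mem _ c.2.1 (dChains_mem (Submodule.add_mem _ hd' ha))) ?_⟩
    have h2 := subdivide_pow_mem (chainsIn_mono Set.inter_subset_right h) m
    have h3 := Submodule.add_mem _ (Submodule.add_mem _ h' h2) (dChains_mem hb)
    convert h3 using 1
    rw [map_sub, ← dChains_subdivide_pow, ← hab]
    simp only [map_add]
    abel
  · intro z
    obtain ⟨c, rfl⟩ := relClass_surjective p S T z
    obtain ⟨m, a, ha, b, hb, hab⟩ := small c.2.1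
    have hdc : bdry p c.1 ∈ chainsIn (p - 1) T := chainsIn_mono Set.inter_subset_right c.2.2
    obtain ⟨d, hd, h⟩ := exists_subdivide_homotopy c.2.1 hdc m
    have hda : bdry p a ∈ chainsIn (p - 1) T := by
      rw [show a = (subdivide p ^ m) c.1 - b from eq_sub_of_add_eq hab, map_sub]
      exact Submodule.sub_mem _ (bdry_subdivide_pow_mem hdc m) (bdry_mem hb)
    refine ⟨relClass p P T ⟨a, mem_relCycles ha hda⟩, ?_⟩
    rw [relHomologyMap_relClass]
    symm
    refine relClass_eq_of_sub hd ?_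
    convert Submodule.add_mem _ h hb using 1
    change c.1 - a - dChains p d = _
    rw [← hab]
    abel

theorem relHomologyMap_comp {S' T' S'' T'' : Set X} (hS : S ⊆ S') (hT : S ∩ T ⊆ T')
    (hS' : S' ⊆ S'') (hT' : S' ∩ T' ⊆ T'') (hT'' : S ∩ T ⊆ T'') (z : relHomology p S T) :
    relHomologyMap p hS' hT' (relHomologyMap p hS hT z) =
      relHomologyMap p (hS.trans hS') hT'' z := by
  obtain ⟨c, rfl⟩ := relClass_surjective p S T z
  simp only [relHomologyMap_relClass]

/-- If a pair `(S', T')` deforms into a pair `(S, T)` that it contains, through a homotopy that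
keeps `S`, `T`, `S'`, `T'` in themselves and ends with a map fixing `S`, then the inclusion induces
an isomorphism in homology. -/
theorem relHomologyMap_bijective_of_deformation {S' T' : Set X} (hS : S ⊆ S') (hT : S ∩ T ⊆ T')
    {f : C(X, X)} (D : C(X × unitInterval, X)) (hD₀ : ∀ x, D (x, 0) = x)
    (hD₁ : ∀ x, D (x, 1) = f x) (hDS : ∀ x ∈ S', ∀ s, D (x, s) ∈ S')
    (hDT : ∀ x ∈ T', ∀ s, D (x, s) ∈ T') (hfS : Set.MapsTo f S' S) (hfT : Set.MapsTo f T' T)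
    (hf : Set.EqOn f id S) : Function.Bijective (relHomologyMap p hS hT) := by
  constructor
  · rw [← LinearMap.ker_eq_bot, LinearMap.ker_eq_bot']
    intro z hz
    obtain ⟨c, rfl⟩ := relClass_surjective p S T z
    rw [relHomologyMap_relClass, relClass_eq_zero_iff] at hz
    obtain ⟨d, hd, h⟩ := hz
    rw [relClass_eq_zero_iff]
    have hfc : pushChains p f c.1 = c.1 :=
      (pushChains_congr (g := ContinuousMap.id X) hf c.2.1).trans (pushChains_id _)
    have hfd : pushChains (p + 1) f d ∈ chainsIn (p + 1) S := pushChains_mem hfS hd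
    refine ⟨_, hfd, mem_chainsIn_inter (Submodule.sub_mem _ c.2.1 (dChains_mem hfd)) ?_⟩
    rw [dChains_pushChains]
    have := pushChains_mem hfT (chainsIn_mono Set.inter_subset_right h)
    rwa [map_sub, hfc] at this
  · intro z
    obtain ⟨c, rfl⟩ := relClass_surjective p S' T' z
    have hdc : bdry p c.1 ∈ chainsIn (p - 1) T' := chainsIn_mono Set.inter_subset_right c.2.2
    obtain ⟨d, hd, h⟩ := exists_pushChains_homotopy (f := ContinuousMap.id X) D hD₀ hD₁ hDS hDT
      c.2.1 hdc
    rw [pushChains_id] at h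
    refine ⟨relClass p S T ⟨pushChains p f c.1, mem_relCycles (pushChains_mem hfS c.2.1) ?_⟩, ?_⟩
    · rw [bdry_pushChains]
      exact pushChains_mem hfT hdc
    · rw [relHomologyMap_relClass]
      symm
      refine relClass_eq_of_sub hd ?_
      exact h

end Excision

/-! ### Pushing the collar into the boundary -/

section Collar

variable {n : ℕ} [NeZero n] {X : Type u} [TopologicalSpace X]
  [ChartedSpace (EuclideanHalfSpace n) X] {M : Set X}

namespace ExteriorCollar

variable (C : ExteriorCollar (n := n) M)

theorem bd_subset : C.bd ⊆ M := Set.sdiff_subset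

theorem isClosed_A : IsClosed C.A := C.isClosedEmbedding.isClosed_range

theorem M_inter_A : M ∩ C.A = C.bd := C.inter_eq

theorem mem_or_mem (x : X) : x ∈ M ∨ x ∈ C.A :=
  C.union_eq.symm.subset (Set.mem_univ x)

theorem bd_subset_A : C.bd ⊆ C.A := by
  rw [← C.M_inter_A]
  exact Set.inter_subset_right

theorem collar_mem_M_iff (y : manifoldBoundary (𝓡∂ n) n M × unitInterval) :
    C.collar y ∈ M ↔ y.2 = 0 := by
  constructor
  · intro h
    have h2 : C.collar y ∈ C.bd := by rw [← C.M_inter_A]; exact ⟨h, y, rfl⟩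
    have h3 : C.collar (⟨C.collar y, h2⟩, 0) = C.collar y := C.collar_zero _
    exact (congrArg Prod.snd (C.isClosedEmbedding.injective h3)).symm
  · intro h
    have : y = (y.1, 0) := Prod.ext rfl h
    rw [this, C.collar_zero]
    exact C.bd_subset y.1.2

theorem openA_eq : C.openA = Mᶜ := by
  ext x
  constructor
  · rintro ⟨y, hy, rfl⟩ hM
    exact hy.ne' ((C.collar_mem_M_iff y).mp hM)
  · intro hx
    rcases C.mem_or_mem x with h | ⟨y, rfl⟩
    · exact absurd h hx
    · refine ⟨y, ?_, rfl⟩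
      exact bot_lt_iff_ne_bot.mpr fun h => hx ((C.collar_mem_M_iff y).mpr h)

/-- The deformation of `X` into `M` that contracts the collar along the unit interval. -/
theorem exists_deformation : ∃ (D : C(X × unitInterval, X)) (f : C(X, X)),
    (∀ x, D (x, 0) = x) ∧ (∀ x, D (x, 1) = f x) ∧ (∀ x ∈ C.A, ∀ s, D (x, s) ∈ C.A) ∧
    (∀ x, f x ∈ M) ∧ (∀ x ∈ C.A, f x ∈ C.bd) ∧ Set.EqOn f id M := by
  classical
  let e := C.isClosedEmbedding.isEmbedding.toHomeomorph
  let g : C.A × unitInterval → X := fun y =>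
    C.collar ((e.symm y.1).1, (e.symm y.1).2 * unitInterval.symm y.2)
  have hg : Continuous g := by
    refine C.isClosedEmbedding.continuous.comp ?_
    have := e.symm.continuous.comp (continuous_fst (X := C.A) (Y := unitInterval))
    exact this.fst.prodMk (this.snd.mul (unitInterval.continuous_symm.comp continuous_snd))
  have hgM : ∀ (x : C.A) (s : unitInterval), x.1 ∈ M → g (x, s) = x := by
    intro x s hx
    have h1 : C.collar (e.symm x) = x.1 := congrArg Subtype.val (e.apply_symm_apply x)
    have h2 : (e.symm x).2 = 0 := by rw [← C.collar_mem_M_iff, h1]; exact hx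
    have h3 : e.symm x = ((e.symm x).1, 0) := Prod.ext rfl h2
    change C.collar ((e.symm x).1, (e.symm x).2 * unitInterval.symm s) = x
    rw [h2, zero_mul, ← h3, h1]
  let D : X × unitInterval → X := fun y => if h : y.1 ∈ C.A then g (⟨y.1, h⟩, y.2) else y.1
  have hDA : ∀ (x : C.A) (s : unitInterval), D (x, s) = g (x, s) := fun x s => dif_pos x.2
  have hDM : ∀ x ∈ M, ∀ s, D (x, s) = x := by
    intro x hx s
    by_cases h : x ∈ C.A
    · rw [hDA ⟨x, h⟩ s, hgM ⟨x, h⟩ s hx]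
    · exact dif_neg h
  have hD : Continuous D := by
    rw [← continuousOn_univ]
    have hcov : (Set.univ : Set (X × unitInterval)) = (M ×ˢ Set.univ) ∪ (C.A ×ˢ Set.univ) := by
      ext y
      simpa using C.mem_or_mem y.1
    rw [hcov]
    refine ContinuousOn.union_of_isClosed ?_ ?_ (C.isClosed.prod isClosed_univ)
      (C.isClosed_A.prod isClosed_univ)
    · exact continuousOn_fst.congr fun y hy => hDM y.1 hy.1 y.2
    · rw [continuousOn_iff_continuous_domRestrict]
      have : (C.A ×ˢ Set.univ).domRestrict D = g ∘ fun y => (⟨y.1.1, y.2.1⟩, y.1.2) :=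
        funext fun y => hDA ⟨y.1.1, y.2.1⟩ y.1.2
      rw [this]
      exact hg.comp (by fun_prop)
  have hgbd : ∀ x : C.A, g (x, 1) ∈ C.bd := by
    intro x
    change C.collar ((e.symm x).1, (e.symm x).2 * unitInterval.symm 1) ∈ C.bd
    rw [unitInterval.symm_one, mul_zero, C.collar_zero]
    exact (e.symm x).1.2
  refine ⟨⟨D, hD⟩, ⟨fun x => D (x, 1), by fun_prop⟩, ?_, fun _ => rfl, ?_, ?_, ?_, ?_⟩
  · intro x
    by_cases h : x ∈ C.A
    · refine (hDA ⟨x, h⟩ 0).trans ?_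
      change C.collar ((e.symm ⟨x, h⟩).1, (e.symm ⟨x, h⟩).2 * unitInterval.symm 0) = x
      rw [unitInterval.symm_zero, mul_one]
      exact congrArg Subtype.val (e.apply_symm_apply ⟨x, h⟩)
    · exact dif_neg h
  · intro x hx s
    change D (x, s) ∈ C.A
    rw [hDA ⟨x, hx⟩ s]
    exact ⟨_, rfl⟩
  · intro x
    change D (x, 1) ∈ M
    by_cases h : x ∈ C.A
    · rw [hDA ⟨x, h⟩ 1]
      exact C.bd_subset (hgbd _)
    · rw [show D (x, 1) = x from dif_neg h]
      exact (C.mem_or_mem x).resolve_right h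
  · intro x hx
    change D (x, 1) ∈ C.bd
    rw [hDA ⟨x, hx⟩ 1]
    exact hgbd _
  · exact fun x hx => hDM x hx 1

/-- The homomorphism `H_p(M, ∂M) → H_p(X, A)` is an isomorphism, because the pair `(X, A)` deforms
to `(M, ∂M)`. -/
theorem homologyMap_bijective (p : ℕ) : Function.Bijective (C.homologyMap p) := by
  obtain ⟨D, f, h0, h1, hA, hM, hbd, hf⟩ := C.exists_deformation
  exact relHomologyMap_bijective_of_deformation _ _ D h0 h1 (fun _ _ _ => Set.mem_univ _) hA
    (fun x _ => hM x) hbd hf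

end ExteriorCollar

end Collar

/-! ### Half-spaces and the inverse function theorem -/

section HalfSpace

/-- Euclidean space of dimension `p`. -/
abbrev Euc (p : ℕ) : Type := EuclideanSpace ℝ (Fin p)

variable {p : ℕ}

theorem mem_halfSpace_iff {i : Fin p} (hi : i.val = 0) {v : Euc p} :
    v ∈ halfSpace p ↔ 0 ≤ v i := by
  refine ⟨fun h => h i hi, fun h j hj => ?_⟩
  rwa [Fin.ext (hj.trans hi.symm)]

theorem mem_openHalfSpace_iff {i : Fin p} (hi : i.val = 0) {v : Euc p} :
    v ∈ openHalfSpace p ↔ 0 < v i := by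
  refine ⟨fun h => h i hi, fun h j hj => ?_⟩
  rwa [Fin.ext (hj.trans hi.symm)]

theorem openHalfSpace_subset : openHalfSpace p ⊆ halfSpace p := fun _ h i hi => (h i hi).le

theorem isOpen_openHalfSpace : IsOpen (openHalfSpace p) := by
  have : openHalfSpace p = ⋂ i : Fin p, {v | i.val = 0 → 0 < v i} := by
    ext v
    simp [openHalfSpace]
  rw [this]
  refine isOpen_iInter_of_finite fun i => ?_
  by_cases hi : i.val = 0
  · simpa [hi] using isOpen_lt continuous_const (EuclideanSpace.proj (𝕜 := ℝ) i).continuous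
  · simp [hi]

theorem convex_halfSpace : Convex ℝ (halfSpace p) := by
  intro v hv w hw a b ha hb _ i hi
  have h1 := hv i hi
  have h2 := hw i hi
  simp only [PiLp.add_apply, PiLp.smul_apply, smul_eq_mul]
  positivity

theorem uniqueDiffOn_inter_halfSpace {V : Set (Euc p)} (hV : IsOpen V) :
    UniqueDiffOn ℝ (V ∩ halfSpace p) := by
  rw [Set.inter_comm]
  refine (uniqueDiffOn_convex convex_halfSpace ⟨WithLp.toLp 2 fun _ => 1, ?_⟩).inter hV
  exact interior_mono openHalfSpace_subset
    (isOpen_openHalfSpace.interior_eq.symm ▸ fun i _ => by simp)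

theorem inter_halfSpace_mem_nhds {V : Set (Euc p)} (hV : IsOpen V) {v : Euc p}
    (hv : v ∈ V ∩ openHalfSpace p) : V ∩ halfSpace p ∈ nhds v :=
  Filter.inter_mem (hV.mem_nhds hv.1)
    (Filter.mem_of_superset (isOpen_openHalfSpace.mem_nhds hv.2) openHalfSpace_subset)

end HalfSpace

section InverseFunction

variable {E F : Type*} [NormedAddCommGroup E] [NormedSpace ℝ E] [CompleteSpace E]
  [NormedAddCommGroup F] [NormedSpace ℝ F]

/-- A smooth map whose derivative at a point is invertible restricts to a diffeomorphism of open
neighbourhoods. -/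
theorem exists_smooth_localInverse {f : E → F} {S : Set E} (hS : IsOpen S)
    (hf : ContDiffOn ℝ ∞ f S) {v : E} (hv : v ∈ S) {f' : E ≃L[ℝ] F}
    (hf' : HasFDerivAt f (f' : E →L[ℝ] F) v) :
    ∃ e : OpenPartialHomeomorph E F, (e : E → F) = f ∧ v ∈ e.source ∧ e.source ⊆ S ∧
      ContDiffOn ℝ ∞ e.symm e.target ∧
      ∀ u ∈ e.source, ∃ A : E ≃L[ℝ] F, HasFDerivAt f (A : E →L[ℝ] F) u := by
  have hfat : ∀ u ∈ S, ContDiffAt ℝ ∞ f u := fun u hu => hf.contDiffAt (hS.mem_nhds hu)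
  let O : Set E := S ∩ fderiv ℝ f ⁻¹' Set.range ((↑) : (E ≃L[ℝ] F) → E →L[ℝ] F)
  have hO : IsOpen O :=
    (hf.continuousOn_fderiv_of_isOpen hS (by simp)).isOpen_inter_preimage hS
      ContinuousLinearEquiv.isOpen
  have hder : ∀ u ∈ O, ∃ A : E ≃L[ℝ] F, HasFDerivAt f (A : E →L[ℝ] F) u := by
    rintro u ⟨hu, A, hA⟩
    exact ⟨A, hA ▸ ((hfat u hu).differentiableAt (by simp)).hasFDerivAt⟩
  let e₀ := (hfat v hv).toOpenPartialHomeomorph f hf' (by simp)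
  refine ⟨e₀.restrOpen O hO, rfl, ?_, ?_, ?_, ?_⟩
  · exact ⟨(hfat v hv).mem_toOpenPartialHomeomorph_source hf' (by simp), hv, f', hf'.fderiv.symm⟩
  · exact fun u hu => hu.2.1
  · intro z hz
    have hz' : (e₀.restrOpen O hO).symm z ∈ (e₀.restrOpen O hO).source :=
      (e₀.restrOpen O hO).map_target hz
    obtain ⟨A, hA⟩ := hder _ hz'.2
    exact ((e₀.restrOpen O hO).contDiffAt_symm hz hA (hfat _ hz'.2.1)).contDiffWithinAt
  · exact fun u hu => hder u hu.2

end InverseFunction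

section Straighten

variable {n : ℕ} [NeZero n]

/-- The projection of `ℝⁿ` onto the hyperplane `v₀ = 0`. -/
def flatten (n : ℕ) [NeZero n] : Euc n →L[ℝ] Euc n :=
  ContinuousLinearMap.id ℝ _ -
    (EuclideanSpace.proj (𝕜 := ℝ) (0 : Fin n)).smulRight (EuclideanSpace.single 0 1)

theorem flatten_apply (v : Euc n) : flatten n v = v - v 0 • EuclideanSpace.single 0 1 := rfl

theorem flatten_zero (v : Euc n) : (flatten n v) 0 = 0 := by
  simp [flatten_apply]

theorem flatten_eq_self {v : Euc n} (h : v 0 = 0) : flatten n v = v := by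
  simp [flatten_apply, h]

theorem flatten_mem (v : Euc n) : flatten n v ∈ halfSpace n :=
  (mem_halfSpace_iff (i := (0 : Fin n)) rfl).mpr (flatten_zero v).ge

/-- A map that is smooth and immersive up to the boundary of the half-space agrees, on the boundary
hyperplane, with a local diffeomorphism with the same derivative at the given point. -/
theorem exists_openPartialHomeomorph_flatten {F : Euc n → Euc n} {S : Set (Euc n)} (hS : IsOpen S)
    (hF : ContDiffOn ℝ ∞ F (S ∩ halfSpace n)) {v : Euc n} (hv : v ∈ S) (hv0 : v 0 = 0)
    (hinj : Function.Injective (fderivWithin ℝ F (S ∩ halfSpace n) v)) :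
    ∃ e : OpenPartialHomeomorph (Euc n) (Euc n), v ∈ e.source ∧ e.source ⊆ S ∧
      ContDiffOn ℝ ∞ e.symm e.target ∧ (∀ u ∈ e.source, u 0 = 0 → e u = F u) ∧
      ∃ A : Euc n ≃L[ℝ] Euc n, HasFDerivAt e (A : Euc n →L[ℝ] Euc n) v ∧
        HasFDerivWithinAt F (A : Euc n →L[ℝ] Euc n) (S ∩ halfSpace n) v := by
  have hvh : v ∈ S ∩ halfSpace n := ⟨hv, (mem_halfSpace_iff (i := (0 : Fin n)) rfl).mpr hv0.ge⟩
  have hd : HasFDerivWithinAt F (fderivWithin ℝ F (S ∩ halfSpace n) v) (S ∩ halfSpace n) v :=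
    ((hF.contDiffWithinAt hvh).differentiableWithinAt (by simp)).hasFDerivWithinAt
  set A₀ := fderivWithin ℝ F (S ∩ halfSpace n) v with hA₀
  let A : Euc n ≃L[ℝ] Euc n :=
    (LinearEquiv.ofInjectiveEndo (A₀ : Euc n →ₗ[ℝ] Euc n) hinj).toContinuousLinearEquiv
  have hA : (A : Euc n →L[ℝ] Euc n) = A₀ := by
    ext1 x
    rfl
  let Ψ : Euc n → Euc n := fun u => F (flatten n u) + u 0 • A₀ (EuclideanSpace.single 0 1)
  let S' := S ∩ flatten n ⁻¹' S
  have hS' : IsOpen S' := hS.inter (hS.preimage (flatten n).continuous)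
  have hvS' : v ∈ S' := ⟨hv, by rw [Set.mem_preimage, flatten_eq_self hv0]; exact hv⟩
  have hmaps : Set.MapsTo (flatten n) S' (S ∩ halfSpace n) := fun u hu => ⟨hu.2, flatten_mem u⟩
  have hΨ : ContDiffOn ℝ ∞ Ψ S' := by
    refine (hF.comp (flatten n).contDiff.contDiffOn hmaps).add ?_
    exact ((EuclideanSpace.proj (𝕜 := ℝ) (0 : Fin n)).contDiff.smul contDiff_const).contDiffOn
  have hΨ' : HasFDerivAt Ψ (A : Euc n →L[ℝ] Euc n) v := by
    have h1 : HasFDerivAt (F ∘ flatten n) (A₀.comp (flatten n)) v := by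
      have := HasFDerivWithinAt.comp (t := S ∩ halfSpace n) (g := F) (g' := A₀) v
        (by rw [flatten_eq_self hv0]; exact hd) (flatten n).hasFDerivWithinAt hmaps
      exact this.hasFDerivAt (hS'.mem_nhds hvS')
    have h2 := h1.add ((EuclideanSpace.proj (𝕜 := ℝ) (0 : Fin n)).hasFDerivAt.smul_const
      (A₀ (EuclideanSpace.single 0 1)) (x := v))
    refine h2.congr_fderiv ?_
    rw [hA]
    ext1 x
    simp [flatten_apply]
  obtain ⟨e, he, hve, hes, hsymm, -⟩ := exists_smooth_localInverse hS' hΨ hvS' hΨ'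
  refine ⟨e, hve, fun u hu => (hes hu).1, hsymm, fun u _ hu0 => ?_, A, he ▸ hΨ', hA ▸ hd⟩
  rw [he]
  change F (flatten n u) + u 0 • _ = _
  rw [hu0, zero_smul, add_zero, flatten_eq_self hu0]

end Straighten

/-! ### Maps from Euclidean space to a manifold in a chart -/

section Chart

variable {E : Type*} [NormedAddCommGroup E] [NormedSpace ℝ E] {H : Type*} [TopologicalSpace H]
  {I : ModelWithCorners ℝ E H} {X : Type u} [TopologicalSpace X] [ChartedSpace H X]
  {p : ℕ} {φ : Euc p → X} {s : Set (Euc p)} {v : Euc p}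

theorem contDiffOn_extChartAt_comp [IsManifold I ∞ X]
    (hφ : ContMDiffOn 𝓘(ℝ, Euc p) I ∞ φ s) (x : X) :
    ContDiffOn ℝ ∞ (extChartAt I x ∘ φ) (s ∩ φ ⁻¹' (extChartAt I x).source) := by
  rw [← contMDiffOn_iff_contDiffOn]
  refine (contMDiffOn_extChartAt (I := I) (n := ∞) (x := x)).comp (hφ.mono Set.inter_subset_left) ?_
  intro y hy
  rw [← extChartAt_source I]
  exact hy.2

theorem mfderivWithin_eq_fderivWithin_extChartAt
    (hφ : MDifferentiableWithinAt 𝓘(ℝ, Euc p) I φ s v) :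
    mfderivWithin 𝓘(ℝ, Euc p) I φ s v = fderivWithin ℝ (extChartAt I (φ v) ∘ φ) s v := by
  refine hφ.mfderivWithin.trans ?_
  simp only [writtenInExtChartAt, mfld_simps]
  rfl

theorem extChartAt_target_mem_nhds_of_not_boundary {x : X} (hx : x ∉ I.boundary X) :
    (extChartAt I x).target ∈ nhds (extChartAt I x x) := by
  have : I.IsInteriorPoint x := (I.isInteriorPoint_or_isBoundaryPoint x).resolve_right hx
  exact mem_interior_iff_mem_nhds.mp (ModelWithCorners.isInteriorPoint_iff.mp this)

theorem IsLocalParam.mdifferentiableWithinAt {S : Set X} {V : Set (Euc p)}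
    (h : IsLocalParam I p S V φ) (hv : v ∈ V ∩ halfSpace p) :
    MDifferentiableWithinAt 𝓘(ℝ, Euc p) I φ (V ∩ halfSpace p) v :=
  (h.smooth v hv).mdifferentiableWithinAt (by simp)

theorem IsLocalParam.mapsTo {S : Set X} {V : Set (Euc p)} (h : IsLocalParam I p S V φ) :
    Set.MapsTo φ (V ∩ halfSpace p) S := by
  obtain ⟨U, -, hU⟩ := h.image_open
  exact fun u hu => (hU.subset ⟨u, hu, rfl⟩).1

theorem IsLocalParam.injOn {S : Set X} {V : Set (Euc p)} (h : IsLocalParam I p S V φ) :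
    Set.InjOn φ (V ∩ halfSpace p) := fun a ha b hb hab =>
  congrArg Subtype.val (h.embedding.injective (a₁ := ⟨a, ha⟩) (a₂ := ⟨b, hb⟩) hab)

/-- A local parametrization of `S` maps relatively open sets to relatively open subsets of `S`. -/
theorem IsLocalParam.exists_isOpen {S : Set X} {V : Set (Euc p)} (h : IsLocalParam I p S V φ)
    {B : Set (Euc p)} (hB : IsOpen B) :
    ∃ O : Set X, IsOpen O ∧ φ '' (V ∩ halfSpace p ∩ B) = S ∩ O := by
  obtain ⟨U, hU, hUS⟩ := h.image_open
  obtain ⟨O, hO, hOB⟩ := h.embedding.isInducing.isOpen_iff.mp (hB.preimage continuous_subtype_val)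
  refine ⟨U ∩ O, hU.inter hO, ?_⟩
  ext y
  constructor
  · rintro ⟨u, ⟨hu, huB⟩, rfl⟩
    have h1 := hUS.subset ⟨u, hu, rfl⟩
    exact ⟨h1.1, h1.2, (Set.ext_iff.mp hOB ⟨u, hu⟩).mpr huB⟩
  · rintro ⟨hyS, hyU, hyO⟩
    obtain ⟨u, hu, rfl⟩ := hUS.symm.subset ⟨hyS, hyU⟩
    exact ⟨u, ⟨hu, (Set.ext_iff.mp hOB ⟨u, hu⟩).mp hyO⟩, rfl⟩

end Chart

/-! ### A local defining function of the boundary -/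

section Sides

variable {n : ℕ} [NeZero n] {X : Type u} [TopologicalSpace X]

theorem tendsto_add_smul_single (v : Euc n) (c : ℝ) :
    Filter.Tendsto (fun t : ℝ => v + (c * t) • (EuclideanSpace.single 0 1 : Euc n))
      (nhdsWithin 0 (Set.Ioi 0)) (nhds v) := by
  have : Continuous fun t : ℝ => v + (c * t) • (EuclideanSpace.single 0 1 : Euc n) := by fun_prop
  have h := this.tendsto 0
  simp only [mul_zero, zero_smul, add_zero] at h
  exact h.mono_left nhdsWithin_le_nhds

/-- If a ball is mapped to a space covered by the closed sets `M` and `A` so that only points of the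
hyperplane `v₀ = 0` go to `M ∩ A`, then each open half-ball goes to one of `M` and `A`; unless they
go to the same set, `M` and `A` correspond to the two closed half-balls. -/
theorem exists_sign_of_ball {M A : Set X} (hM : IsClosed M) (hA : IsClosed A)
    (hMA : ∀ x, x ∈ M ∨ x ∈ A) {v : Euc n} {ε : ℝ} {Ξ : Euc n → X}
    (hΞ : ContinuousOn Ξ (Metric.ball v ε)) (h0 : ∀ u ∈ Metric.ball v ε, u 0 = 0 → Ξ u ∈ M)
    (hbd : ∀ u ∈ Metric.ball v ε, Ξ u ∈ M → Ξ u ∈ A → u 0 = 0)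
    (h1 : ∃ u ∈ Metric.ball v ε, u 0 ≠ 0 ∧ Ξ u ∈ M) (h2 : ∃ u ∈ Metric.ball v ε, Ξ u ∉ M) :
    ∃ s : ℝ, s ≠ 0 ∧ ∀ u ∈ Metric.ball v ε,
      (Ξ u ∈ M ↔ 0 ≤ s * u 0) ∧ (Ξ u ∈ A ↔ s * u 0 ≤ 0) := by
  let B (s : ℝ) : Set (Euc n) := Metric.ball v ε ∩ {u | 0 < s * u 0}
  have side : ∀ s : ℝ, s ≠ 0 → (∀ u ∈ B s, Ξ u ∉ A) ∨ (∀ u ∈ B s, Ξ u ∉ M) := by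
    intro s hs
    have hconv : Convex ℝ (B s) := by
      refine (convex_ball v ε).inter ?_
      intro a ha b hb x y hx hy hxy
      have ha' : 0 < s * a 0 := ha
      have hb' : 0 < s * b 0 := hb
      change 0 < s * (x • a + y • b) 0
      have e : s * (x • a + y • b) 0 = x * (s * a 0) + y * (s * b 0) := by
        simp only [PiLp.add_apply, PiLp.smul_apply, smul_eq_mul]
        ring
      rw [e]
      rcases hx.eq_or_lt with rfl | hx'
      · rw [zero_add] at hxy
        rw [hxy, zero_mul, zero_add, one_mul]
        exact hb'
      · exact add_pos_of_pos_of_nonneg (mul_pos hx' ha') (mul_nonneg hy hb'.le)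
    have hpre : IsPreconnected (Ξ '' B s) :=
      hconv.isPreconnected.image Ξ (hΞ.mono Set.inter_subset_left)
    have hne : ∀ u ∈ B s, u 0 ≠ 0 := fun u hu h => by
      have : 0 < s * u 0 := hu.2
      rw [h, mul_zero] at this
      exact this.false
    have hd : Disjoint (Aᶜ) (Mᶜ) := Set.disjoint_left.mpr fun y hyA hyM =>
      (hMA y).elim hyM hyA
    have hsub : Ξ '' B s ⊆ Aᶜ ∪ Mᶜ := by
      rintro _ ⟨u, hu, rfl⟩
      by_cases h : Ξ u ∈ A
      · exact Or.inr fun h' => hne u hu (hbd u hu.1 h' h)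
      · exact Or.inl h
    rcases hpre.subset_or_subset hA.isOpen_compl hM.isOpen_compl hd hsub with h | h
    · exact Or.inl fun u hu => h ⟨u, hu, rfl⟩
    · exact Or.inr fun u hu => h ⟨u, hu, rfl⟩
  have concl : ∀ s : ℝ, s ≠ 0 → (∀ u ∈ B s, Ξ u ∉ A) → (∀ u ∈ B (-s), Ξ u ∉ M) →
      ∀ u ∈ Metric.ball v ε, (Ξ u ∈ M ↔ 0 ≤ s * u 0) ∧ (Ξ u ∈ A ↔ s * u 0 ≤ 0) := by
    intro s hs hp hm u hu
    rcases lt_trichotomy (s * u 0) 0 with h | h | h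
    · have h3 : Ξ u ∉ M := hm u ⟨hu, by change 0 < -s * u 0; linarith⟩
      have h4 := (hMA (Ξ u)).resolve_left h3
      exact ⟨⟨fun h5 => absurd h5 h3, fun h5 => absurd h (not_lt.mpr h5)⟩, fun _ => h.le,
        fun _ => h4⟩
    · have hu0 : u 0 = 0 := (mul_eq_zero.mp h).resolve_left hs
      refine ⟨⟨fun _ => h.ge, fun _ => h0 u hu hu0⟩, fun _ => h.le, fun _ => ?_⟩
      by_contra hnA
      have hO : Metric.ball v ε ∩ Ξ ⁻¹' Aᶜ ∈ nhds u :=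
        (hΞ.isOpen_inter_preimage Metric.isOpen_ball hA.isOpen_compl).mem_nhds ⟨hu, hnA⟩
      obtain ⟨t, ht, htpos⟩ := ((tendsto_add_smul_single u (-s)).eventually hO |>.and
        (self_mem_nhdsWithin (s := Set.Ioi (0 : ℝ)))).exists
      have htpos : 0 < t := htpos
      refine (hMA (Ξ (u + (-s * t) • EuclideanSpace.single 0 1))).elim (hm _ ⟨ht.1, ?_⟩) ht.2
      have e : -s * (u + (-s * t) • (EuclideanSpace.single 0 1 : Euc n)) 0 = s ^ 2 * t := by
        simp only [PiLp.add_apply, PiLp.smul_apply, smul_eq_mul, hu0,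
          PiLp.single_apply, if_true]
        ring
      change 0 < -s * (u + (-s * t) • (EuclideanSpace.single 0 1 : Euc n)) 0
      rw [e]
      positivity
    · have h3 : Ξ u ∉ A := hp u ⟨hu, h⟩
      have h4 := (hMA (Ξ u)).resolve_right h3
      exact ⟨⟨fun _ => h.le, fun _ => h4⟩, fun h5 => absurd h5 h3,
        fun h5 => absurd h (not_lt.mpr h5)⟩
  have cover : ∀ u ∈ Metric.ball v ε, u 0 ≠ 0 → u ∈ B 1 ∨ u ∈ B (-1) := by
    intro u hu hu0
    rcases hu0.lt_or_gt with h | h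
    · exact Or.inr ⟨hu, by change 0 < -1 * u 0; linarith⟩
    · exact Or.inl ⟨hu, by change 0 < 1 * u 0; linarith⟩
  rcases side 1 one_ne_zero with hp | hp <;> rcases side (-1) (by norm_num) with hm | hm
  · obtain ⟨u, hu, huM⟩ := h2
    have huA := (hMA (Ξ u)).resolve_left huM
    exact ((cover u hu fun h => huM (h0 u hu h)).elim (fun h => hp u h huA)
      (fun h => hm u h huA)).elim
  · exact ⟨1, one_ne_zero, concl 1 one_ne_zero hp hm⟩
  · exact ⟨-1, by norm_num, concl (-1) (by norm_num) hm (by simpa using hp)⟩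
  · obtain ⟨u, hu, hu0, huM⟩ := h1
    exact ((cover u hu hu0).elim (fun h => hp u h huM) (fun h => hm u h huM)).elim

end Sides

section DefiningFunction

variable {n : ℕ} [NeZero n] {X : Type u} [TopologicalSpace X]
  [ChartedSpace (EuclideanHalfSpace n) X] {M : Set X}

namespace ExteriorCollar

variable (C : ExteriorCollar (n := n) M)

theorem not_mem_boundary (C : ExteriorCollar (n := n) M) {x : X} (hx : x ∈ M) : x ∉ (𝓡∂ n).boundary X := by
  rw [C.boundary_eq]
  rintro ⟨y, rfl⟩
  exact one_ne_zero ((C.collar_mem_M_iff (y, 1)).mp hx)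

/-- Every neighbourhood of a boundary point of `M` leaves `M`, along the collar. -/
theorem exists_notMem_of_mem_nhds {x : X} (hx : x ∈ C.bd) {N : Set X} (hN : N ∈ nhds x) :
    ∃ y ∈ N, y ∉ M := by
  have hc : Continuous fun t : ℝ =>
      C.collar (⟨x, hx⟩, Set.projIcc (0 : ℝ) 1 zero_le_one t) :=
    C.isClosedEmbedding.continuous.comp (continuous_const.prodMk continuous_projIcc)
  have h := hc.tendsto 0
  rw [show Set.projIcc (0 : ℝ) 1 zero_le_one 0 = 0 from Set.projIcc_left _,
    C.collar_zero ⟨x, hx⟩] at h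
  obtain ⟨t, ht, ht'⟩ := (((h.mono_left nhdsWithin_le_nhds).eventually hN).and
    (Ioo_mem_nhdsGT (zero_lt_one (α := ℝ)))).exists
  refine ⟨_, ht, fun hM => ?_⟩
  have h0 := (C.collar_mem_M_iff _).mp hM
  rw [Set.projIcc_of_mem _ ⟨ht'.1.le, ht'.2.le⟩] at h0
  exact ht'.1.ne' (congrArg Subtype.val h0)

/-- Near a boundary point of `M`, there is a smooth function `g` with nonvanishing differential such
that `M` is given by `0 ≤ g` and the collar by `g ≤ 0`. -/
theorem exists_defining_function [IsManifold (𝓡∂ n) ∞ X] {x : X} (hx : x ∈ C.bd) :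
    ∃ (N : Set X) (g : X → ℝ), IsOpen N ∧ x ∈ N ∧ ContMDiffOn (𝓡∂ n) 𝓘(ℝ, ℝ) ∞ g N ∧
      mfderiv (𝓡∂ n) 𝓘(ℝ, ℝ) g x ≠ 0 ∧ ∀ y ∈ N, (y ∈ M ↔ 0 ≤ g y) ∧ (y ∈ C.A ↔ g y ≤ 0) := by
  have hxM := C.bd_subset hx
  have h00 : (0 : Fin n).val = 0 := rfl
  obtain ⟨V, φ, hφ, v, hv, rfl⟩ := C.isSubmanifold x hxM
  set x := φ v with hxdef
  set χ := extChartAt (𝓡∂ n) x with hχ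
  have hxχ : x ∈ χ.source := mem_extChartAt_source x
  -- A boundary point has no interior parameter.
  have hbd0 : ∀ u ∈ V ∩ halfSpace n, φ u ∈ C.bd → u 0 = 0 := by
    intro u hu hub
    refine le_antisymm (not_lt.mp fun h => ?_) ((mem_halfSpace_iff h00).mp hu.2)
    exact hub.2 ⟨V, φ, hφ, u, ⟨hu.1, (mem_openHalfSpace_iff h00).mpr h⟩, rfl⟩
  have hv0 : v 0 = 0 := hbd0 v hv hx
  obtain ⟨V₁, hV₁, hV₁eq⟩ := (continuousOn_iff'.mp hφ.smooth.continuousOn) χ.source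
    (isOpen_extChartAt_source x)
  let S := V ∩ V₁
  have hS : IsOpen S := hφ.isOpen.inter hV₁
  have hSeq : S ∩ halfSpace n = (V ∩ halfSpace n) ∩ φ ⁻¹' χ.source := by
    rw [Set.inter_comm (V ∩ halfSpace n), hV₁eq]
    ext u
    simp only [S, Set.mem_inter_iff]
    tauto
  have hvS : v ∈ S ∩ halfSpace n := by rw [hSeq]; exact ⟨hv, hxχ⟩
  have hF : ContDiffOn ℝ ∞ (χ ∘ φ) (S ∩ halfSpace n) := by
    rw [hSeq]
    exact contDiffOn_extChartAt_comp hφ.smooth x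
  have hinj : Function.Injective (fderivWithin ℝ (χ ∘ φ) (S ∩ halfSpace n) v) := by
    have h1 := hφ.immersion v hv
    rw [mfderivWithin_eq_fderivWithin_extChartAt (hφ.mdifferentiableWithinAt hv)] at h1
    have h2 : fderivWithin ℝ (χ ∘ φ) (S ∩ halfSpace n) v =
        fderivWithin ℝ (χ ∘ φ) (V ∩ halfSpace n) v := by
      rw [show S ∩ halfSpace n = (V ∩ halfSpace n) ∩ V₁ by
        simp only [S, Set.inter_right_comm]]
      exact fderivWithin_inter (hV₁.mem_nhds hvS.1.2)
    rw [h2]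
    exact h1
  obtain ⟨e, hve, heS, hesymm, heF, A, hA, hFA⟩ :=
    exists_openPartialHomeomorph_flatten hS hF hvS.1 hv0 hinj
  have hev : e v = χ x := heF v hve hv0
  obtain ⟨O, hO, hOM⟩ := hφ.exists_isOpen e.open_source
  have hxO : x ∈ O := (hOM.subset ⟨v, ⟨hv, hve⟩, rfl⟩).2
  -- A ball in the straightened chart, and its parametrization of a neighbourhood of `x`.
  have hcont : ContinuousAt χ.symm (e v) := by
    rw [hev]
    exact continuousAt_extChartAt_symm x
  have hW : e.source ∩ e ⁻¹' interior (χ.target) ∩ (χ.symm ∘ e) ⁻¹' O ∈ nhds v := by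
    refine Filter.inter_mem (Filter.inter_mem (e.open_source.mem_nhds hve) ?_) ?_
    · refine (e.continuousAt hve).preimage_mem_nhds (isOpen_interior.mem_nhds ?_)
      rw [hev]
      exact mem_interior_iff_mem_nhds.mpr
        (extChartAt_target_mem_nhds_of_not_boundary (C.not_mem_boundary hxM))
    · refine (hcont.comp (e.continuousAt hve)).preimage_mem_nhds (hO.mem_nhds ?_)
      rw [Function.comp_apply, hev, extChartAt_to_inv x]
      exact hxO
  obtain ⟨ε, hε, hball⟩ := Metric.mem_nhds_iff.mp hW
  let Ξ : Euc n → X := χ.symm ∘ e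
  let N : Set X := χ.source ∩ χ ⁻¹' (e.target ∩ e.symm ⁻¹' Metric.ball v ε)
  have hN : IsOpen N := (continuousOn_extChartAt x).isOpen_inter_preimage
    (isOpen_extChartAt_source x) (e.isOpen_inter_preimage_symm Metric.isOpen_ball)
  have hxN : x ∈ N := by
    refine ⟨hxχ, ?_, ?_⟩
    · rw [← hev]
      exact e.map_source hve
    · rw [Set.mem_preimage, ← hev, e.left_inv hve]
      exact Metric.mem_ball_self hε
  have hΞN : ∀ y ∈ N, Ξ (e.symm (χ y)) = y := fun y hy => by
    change χ.symm (e (e.symm (χ y))) = y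
    rw [e.right_inv hy.2.1]
    exact χ.left_inv hy.1
  have hΞ : ContinuousOn Ξ (Metric.ball v ε) := by
    refine (continuousOn_extChartAt_symm x).comp (e.continuousOn.mono fun u hu => ?_) ?_
    · exact (hball hu).1.1
    · exact fun u hu => interior_subset (hball hu).1.2
  have hflat : ∀ u ∈ e.source, u 0 = 0 → u ∈ V ∩ halfSpace n ∧ Ξ u = φ u := by
    intro u hu hu0
    have hu' : u ∈ S ∩ halfSpace n := ⟨heS hu, (mem_halfSpace_iff h00).mpr hu0.ge⟩
    refine ⟨⟨hu'.1.1, hu'.2⟩, ?_⟩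
    change χ.symm (e u) = φ u
    rw [heF u hu hu0]
    exact χ.left_inv (hSeq.subset hu').2
  obtain ⟨s, hs, hside⟩ := exists_sign_of_ball C.isClosed C.isClosed_A C.mem_or_mem hΞ
    (fun u hu hu0 => by
      obtain ⟨h1, h2⟩ := hflat u (hball hu).1.1 hu0
      rw [h2]
      exact hφ.mapsTo h1)
    (fun u hu huM huA => by
      have hub : Ξ u ∈ C.bd := by rw [← C.M_inter_A]; exact ⟨huM, huA⟩
      obtain ⟨u', ⟨hu', hu'e⟩, hu'eq⟩ := hOM.symm.subset ⟨huM, (hball hu).2⟩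
      have hu'0 : u' 0 = 0 := hbd0 u' hu' (by rw [hu'eq]; exact hub)
      have h1 := (hflat u' hu'e hu'0).2
      have h2 : e u' = e u := by
        have h3 : χ.symm (e u') = χ.symm (e u) := h1.trans hu'eq
        refine χ.symm.injOn ?_ (interior_subset (hball hu).1.2) h3
        rw [heF u' hu'e hu'0]
        exact χ.map_source (hSeq.subset ⟨heS hu'e, hu'.2⟩).2
      rw [← e.injOn hu'e (hball hu).1.1 h2]
      exact hu'0)
    (by
      have h1 : Filter.Tendsto (fun t : ℝ => v + (1 * t) • (EuclideanSpace.single 0 1 : Euc n))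
          (nhdsWithin 0 (Set.Ioi 0)) (nhdsWithin v (V ∩ halfSpace n)) := by
        rw [nhdsWithin_inter]
        refine Filter.tendsto_inf.mpr ⟨tendsto_nhdsWithin_iff.mpr
          ⟨tendsto_add_smul_single v 1, (tendsto_add_smul_single v 1).eventually
            (hφ.isOpen.mem_nhds hv.1)⟩, tendsto_nhdsWithin_iff.mpr
          ⟨tendsto_add_smul_single v 1, ?_⟩⟩
        filter_upwards [self_mem_nhdsWithin (s := Set.Ioi (0 : ℝ))] with t ht
        have ht : 0 < t := ht
        refine (mem_halfSpace_iff h00).mpr ?_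
        simp only [PiLp.add_apply, PiLp.smul_apply, smul_eq_mul, hv0, PiLp.single_apply, if_true]
        linarith
      have h2 : ∀ᶠ u in nhdsWithin v (V ∩ halfSpace n), φ u ∈ N :=
        (hφ.smooth.continuousOn v hv).eventually (hN.mem_nhds hxN)
      obtain ⟨t, ⟨ht, htN⟩, htpos⟩ := (((h1.eventually self_mem_nhdsWithin).and
        (h1.eventually h2)).and (self_mem_nhdsWithin (s := Set.Ioi (0 : ℝ)))).exists
      have htpos : 0 < t := htpos
      refine ⟨e.symm (χ (φ (v + (1 * t) • EuclideanSpace.single 0 1))), htN.2.2, ?_, ?_⟩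
      · intro h0
        obtain ⟨h3, h4⟩ := hflat _ (e.map_target htN.2.1) h0
        rw [hΞN _ htN] at h4
        have h5 := hφ.injOn ht h3 h4
        rw [← h5] at h0
        simp only [PiLp.add_apply, PiLp.smul_apply, smul_eq_mul, hv0, PiLp.single_apply, if_true]
          at h0
        linarith
      · rw [hΞN _ htN]
        exact hφ.mapsTo ht)
    (by
      obtain ⟨y, hy, hyM⟩ := C.exists_notMem_of_mem_nhds hx (hN.mem_nhds hxN)
      exact ⟨e.symm (χ y), hy.2.2, by rw [hΞN y hy]; exact hyM⟩)
  let ℓ : Euc n →L[ℝ] ℝ := s • EuclideanSpace.proj (𝕜 := ℝ) (0 : Fin n)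
  let g : X → ℝ := fun y => ℓ (e.symm (χ y))
  have hg : ContMDiffOn (𝓡∂ n) 𝓘(ℝ, ℝ) ∞ g N := by
    have h1 : ContMDiffOn 𝓘(ℝ, Euc n) 𝓘(ℝ, ℝ) ∞ (ℓ ∘ e.symm) e.target :=
      contMDiffOn_iff_contDiffOn.mpr (ℓ.contDiff.comp_contDiffOn hesymm)
    refine h1.comp ((contMDiffOn_extChartAt (I := 𝓡∂ n) (n := ∞) (x := x)).mono ?_) ?_
    · exact fun y hy => by rw [← extChartAt_source (𝓡∂ n)]; exact hy.1
    · exact fun y hy => hy.2.1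
  refine ⟨N, g, hN, hxN, hg, fun h0 => ?_, fun y hy => ?_⟩
  · -- The differential of `g ∘ φ` at `v` is the multiple `ℓ` of the first coordinate.
    have h1 : HasFDerivWithinAt (g ∘ φ) ℓ (S ∩ halfSpace n) v := by
      have h2 : HasFDerivAt e.symm (A.symm : Euc n →L[ℝ] Euc n) ((χ ∘ φ) v) := by
        have := e.hasFDerivAt_symm (a := e v) (f' := A) (e.map_source hve)
          (by rw [e.left_inv hve]; exact hA)
        rwa [hev] at this
      have h3 := (ℓ.hasFDerivAt.comp _ h2).comp_hasFDerivWithinAt v hFA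
      refine h3.congr_fderiv ?_
      ext1 w
      simp
    have h4 : HasMFDerivWithinAt 𝓘(ℝ, Euc n) 𝓘(ℝ, ℝ) (g ∘ φ) (S ∩ halfSpace n) v
        ((mfderiv (𝓡∂ n) 𝓘(ℝ, ℝ) g x).comp
          (mfderivWithin 𝓘(ℝ, Euc n) (𝓡∂ n) φ (V ∩ halfSpace n) v)) := by
      have h5 : MDifferentiableAt (𝓡∂ n) 𝓘(ℝ, ℝ) g x :=
        ((hg x hxN).contMDiffAt (hN.mem_nhds hxN)).mdifferentiableAt (by simp)
      exact (h5.hasMFDerivAt.comp_hasMFDerivWithinAt v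
        (hφ.mdifferentiableWithinAt hv).hasMFDerivWithinAt).mono
          (Set.inter_subset_inter_left _ Set.inter_subset_left)
    have h6 := hasMFDerivWithinAt_iff_hasFDerivWithinAt.mp h4
    have h7 := (uniqueDiffOn_inter_halfSpace hS v hvS).eq h1 h6
    rw [h0] at h7
    have h8 := congrArg (fun f => f (EuclideanSpace.single 0 1)) h7
    apply hs
    have h9 : ℓ (EuclideanSpace.single 0 1) = s := by simp [ℓ]
    rw [← h9]
    exact h8
  · have := hside (e.symm (χ y)) hy.2.2
    rw [hΞN y hy] at this
    exact this

end ExteriorCollar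

end DefiningFunction

/-! ### Parametrizations by open sets -/

section OpenParam

variable {E : Type*} [NormedAddCommGroup E] [NormedSpace ℝ E] {H : Type*} [TopologicalSpace H]
  {I : ModelWithCorners ℝ E H} {X : Type u} [TopologicalSpace X] [ChartedSpace H X]
  {p : ℕ} {φ : Euc p → X} {V : Set (Euc p)} {S : Set X}

/-- A part of the domain of a local parametrization of `S` gives a local parametrization of every
set that has the same points near its image. -/
theorem IsLocalParam.restrict (h : IsLocalParam I p S V φ) {V' : Set (Euc p)} (hV' : IsOpen V')
    (hVV : V' ⊆ V) {S' : Set X} (himg : ∃ U, IsOpen U ∧ φ '' (V' ∩ halfSpace p) = S' ∩ U) :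
    IsLocalParam I p S' V' φ where
  isOpen := hV'
  smooth := h.smooth.mono (Set.inter_subset_inter_left _ hVV)
  immersion v hv := by
    have e : V' ∩ halfSpace p = (V ∩ halfSpace p) ∩ V' := by
      rw [Set.inter_right_comm, Set.inter_eq_self_of_subset_right hVV]
    rw [e, mfderivWithin_inter (hV'.mem_nhds hv.1)]
    exact h.immersion v ⟨hVV hv.1, hv.2⟩
  embedding := h.embedding.comp
    (Topology.IsEmbedding.inclusion (Set.inter_subset_inter_left _ hVV))
  image_open := himg

variable (I) in
/-- `φ`, restricted to the open set `V` of `ℝ^p`, is a smooth embedding onto a relatively open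
subset of `S`. -/
structure IsOpenParam (p : ℕ) (S : Set X) (V : Set (Euc p)) (φ : Euc p → X) : Prop where
  isOpen : IsOpen V
  smooth : ContMDiffOn 𝓘(ℝ, Euc p) I ∞ φ V
  immersion : ∀ v ∈ V, Function.Injective (mfderiv 𝓘(ℝ, Euc p) I φ v)
  embedding : Topology.IsEmbedding fun v : V => φ v
  image_open : ∃ U : Set X, IsOpen U ∧ φ '' V = S ∩ U

theorem IsLocalParam.isOpenParam (h : IsLocalParam I p S V φ) :
    IsOpenParam I p S (V ∩ openHalfSpace p) φ where
  isOpen := h.isOpen.inter isOpen_openHalfSpace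
  smooth := h.smooth.mono (Set.inter_subset_inter_right _ openHalfSpace_subset)
  immersion v hv := by
    rw [← mfderivWithin_of_mem_nhds (inter_halfSpace_mem_nhds h.isOpen hv)]
    exact h.immersion v ⟨hv.1, openHalfSpace_subset hv.2⟩
  embedding := h.embedding.comp
    (Topology.IsEmbedding.inclusion (Set.inter_subset_inter_right _ openHalfSpace_subset))
  image_open := by
    obtain ⟨O, hO, hOS⟩ := h.exists_isOpen (isOpen_openHalfSpace (p := p))
    refine ⟨O, hO, ?_⟩
    rw [← hOS, Set.inter_assoc, Set.inter_eq_self_of_subset_right openHalfSpace_subset]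

/-- Parametrizations of a neighbourhood of an interior point can be taken to be defined in the open
half-space. -/
theorem mem_manifoldInterior_iff {x : X} : x ∈ manifoldInterior I p S ↔
    ∃ V φ, IsOpenParam I p S V φ ∧ V ⊆ openHalfSpace p ∧ IsLocalParam I p S V φ ∧
      ∃ v ∈ V, φ v = x := by
  constructor
  · rintro ⟨V, φ, h, v, hv, rfl⟩
    refine ⟨V ∩ openHalfSpace p, φ, h.isOpenParam, Set.inter_subset_right, ?_, v, hv, rfl⟩
    refine h.restrict h.isOpenParam.isOpen Set.inter_subset_left ?_
    rw [Set.inter_assoc, Set.inter_eq_self_of_subset_left openHalfSpace_subset]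
    exact h.isOpenParam.image_open
  · rintro ⟨V, φ, -, hV, h, v, hv, rfl⟩
    exact ⟨V, φ, h, v, ⟨hv, hV hv⟩, rfl⟩

namespace IsOpenParam

theorem mapsTo (h : IsOpenParam I p S V φ) : Set.MapsTo φ V S := by
  obtain ⟨U, -, hU⟩ := h.image_open
  exact fun u hu => (hU.subset ⟨u, hu, rfl⟩).1

theorem injOn (h : IsOpenParam I p S V φ) : Set.InjOn φ V := fun a ha b hb hab =>
  congrArg Subtype.val (h.embedding.injective (a₁ := ⟨a, ha⟩) (a₂ := ⟨b, hb⟩) hab)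

theorem mdifferentiableAt (h : IsOpenParam I p S V φ) {v : Euc p} (hv : v ∈ V) :
    MDifferentiableAt 𝓘(ℝ, Euc p) I φ v :=
  ((h.smooth v hv).contMDiffAt (h.isOpen.mem_nhds hv)).mdifferentiableAt (by simp)

theorem exists_isOpen (h : IsOpenParam I p S V φ) {B : Set (Euc p)} (hB : IsOpen B) :
    ∃ O : Set X, IsOpen O ∧ φ '' (V ∩ B) = S ∩ O := by
  obtain ⟨U, hU, hUS⟩ := h.image_open
  obtain ⟨O, hO, hOB⟩ := h.embedding.isInducing.isOpen_iff.mp (hB.preimage continuous_subtype_val)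
  refine ⟨U ∩ O, hU.inter hO, ?_⟩
  ext y
  constructor
  · rintro ⟨u, ⟨hu, huB⟩, rfl⟩
    have h1 := hUS.subset ⟨u, hu, rfl⟩
    exact ⟨h1.1, h1.2, (Set.ext_iff.mp hOB ⟨u, hu⟩).mpr huB⟩
  · rintro ⟨hyS, hyU, hyO⟩
    obtain ⟨u, hu, rfl⟩ := hUS.symm.subset ⟨hyS, hyU⟩
    exact ⟨u, ⟨hu, (Set.ext_iff.mp hOB ⟨u, hu⟩).mp hyO⟩, rfl⟩

/-- If an open parametrization of `S` takes the half-space to a subset `S'`, then it restricts to a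
local parametrization of `S'` as a manifold with boundary. -/
theorem isLocalParam (h : IsOpenParam I p S V φ) {S' : Set X} (hS' : S' ⊆ S)
    (hV : ∀ v ∈ V, φ v ∈ S' ↔ v ∈ halfSpace p) : IsLocalParam I p S' V φ where
  isOpen := h.isOpen
  smooth := h.smooth.mono Set.inter_subset_left
  immersion v hv := by
    rw [mfderivWithin_eq_mfderiv
      (uniqueDiffOn_inter_halfSpace h.isOpen v hv).uniqueMDiffWithinAt
      (h.mdifferentiableAt hv.1)]
    exact h.immersion v hv.1
  embedding := h.embedding.comp (Topology.IsEmbedding.inclusion Set.inter_subset_left)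
  image_open := by
    obtain ⟨U, hU, hUS⟩ := h.image_open
    refine ⟨U, hU, ?_⟩
    ext y
    constructor
    · rintro ⟨u, hu, rfl⟩
      exact ⟨(hV u hu.1).mpr hu.2, (hUS.subset ⟨u, hu.1, rfl⟩).2⟩
    · rintro ⟨hyS, hyU⟩
      obtain ⟨u, hu, rfl⟩ := hUS.symm.subset ⟨hS' hyS, hyU⟩
      exact ⟨u, ⟨hu, (hV u hu).mp hyS⟩, rfl⟩

/-- Reparametrization by a diffeomorphism. -/
theorem comp_symm (h : IsOpenParam I p S V φ) (e : OpenPartialHomeomorph (Euc p) (Euc p))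
    (heV : e.source ⊆ V) (hsymm : ContDiffOn ℝ ∞ e.symm e.target)
    (hder : ∀ u ∈ e.source, ∃ A : Euc p ≃L[ℝ] Euc p, HasFDerivAt e (A : Euc p →L[ℝ] Euc p) u) :
    IsOpenParam I p S e.target (φ ∘ e.symm) where
  isOpen := e.open_target
  smooth := h.smooth.comp (contMDiffOn_iff_contDiffOn.mpr hsymm)
    fun z hz => heV (e.map_target hz)
  immersion z hz := by
    obtain ⟨A, hA⟩ := hder _ (e.map_target hz)
    have h1 := e.hasFDerivAt_symm hz hA
    have h2 := (h.mdifferentiableAt (heV (e.map_target hz))).hasMFDerivAt.comp z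
      (hasMFDerivAt_iff_hasFDerivAt.mpr h1)
    rw [h2.mfderiv]
    exact (h.immersion _ (heV (e.map_target hz))).comp A.symm.injective
  embedding := by
    have h1 : Topology.IsEmbedding (fun z : e.target => (⟨e.symm z, heV (e.map_target z.2)⟩ : V)) :=
      (Topology.IsEmbedding.inclusion heV).comp
        (e.symm.toHomeomorphSourceTarget.isEmbedding)
    exact h.embedding.comp h1
  image_open := by
    obtain ⟨O, hO, hOS⟩ := h.exists_isOpen e.open_source
    refine ⟨O, hO, ?_⟩
    rw [← hOS, Set.image_comp, e.symm_image_target_eq_source,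
      Set.inter_eq_self_of_subset_right heV]

/-- A parametrization has, locally, a smooth inverse defined on an open set of the ambient
manifold. -/
theorem exists_smooth_inverse [FiniteDimensional ℝ E] [IsManifold I ∞ X]
    (h : IsOpenParam I p S V φ) {w : Euc p} (hw : w ∈ V) :
    ∃ (N : Set X) (r : X → Euc p), IsOpen N ∧ φ w ∈ N ∧ ContMDiffOn I 𝓘(ℝ, Euc p) ∞ r N ∧
      ∀ y ∈ S ∩ N, r y ∈ V ∧ φ (r y) = y := by
  set χ := extChartAt I (φ w) with hχ
  let S₁ := V ∩ φ ⁻¹' χ.source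
  have hS₁ : IsOpen S₁ := h.smooth.continuousOn.isOpen_inter_preimage h.isOpen
    (isOpen_extChartAt_source _)
  have hwS : w ∈ S₁ := ⟨hw, mem_extChartAt_source _⟩
  have hF : ContDiffOn ℝ ∞ (χ ∘ φ) S₁ := contDiffOn_extChartAt_comp h.smooth _
  have hd : HasFDerivAt (χ ∘ φ) (fderiv ℝ (χ ∘ φ) w) w :=
    ((hF.contDiffAt (hS₁.mem_nhds hwS)).differentiableAt (by simp)).hasFDerivAt
  have hinj : Function.Injective (fderiv ℝ (χ ∘ φ) w) := by
    have h1 := h.immersion w hw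
    rw [← mfderivWithin_univ, mfderivWithin_eq_fderivWithin_extChartAt
      (mdifferentiableWithinAt_univ.mpr (h.mdifferentiableAt hw)), fderivWithin_univ] at h1
    exact h1
  obtain ⟨A₀, hA₀⟩ := (fderiv ℝ (χ ∘ φ) w : Euc p →ₗ[ℝ] E).exists_leftInverse_of_injective
    (LinearMap.ker_eq_bot.mpr hinj)
  let A : E →L[ℝ] Euc p := LinearMap.toContinuousLinearMap A₀
  have hG : HasFDerivAt (A ∘ (χ ∘ φ))
      (ContinuousLinearEquiv.refl ℝ (Euc p) : Euc p →L[ℝ] Euc p) w := by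
    refine (A.hasFDerivAt.comp w hd).congr_fderiv ?_
    ext1 u
    exact LinearMap.congr_fun hA₀ u
  obtain ⟨e, he, hwe, heS, hsymm, -⟩ :=
    exists_smooth_localInverse hS₁ (A.contDiff.comp_contDiffOn hF) hwS hG
  obtain ⟨O, hO, hOS⟩ := h.exists_isOpen e.open_source
  have hAχ : ContMDiffOn I 𝓘(ℝ, Euc p) ∞ (A ∘ χ) χ.source := by
    refine ContMDiffOn.comp (t := Set.univ) (contMDiff_iff_contDiff.mpr A.contDiff).contMDiffOn
      ((contMDiffOn_extChartAt (I := I) (n := ∞) (x := φ w)).mono ?_) fun _ _ => trivial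
    rw [← extChartAt_source I]
  have hev : ∀ u, e u = A (χ (φ u)) := fun u => congrFun he u
  refine ⟨O ∩ (χ.source ∩ (A ∘ χ) ⁻¹' e.target), e.symm ∘ (A ∘ χ), ?_, ⟨?_, ?_, ?_⟩, ?_, ?_⟩
  · exact hO.inter (hAχ.continuousOn.isOpen_inter_preimage (isOpen_extChartAt_source _)
      e.open_target)
  · exact (hOS.subset ⟨w, ⟨hw, hwe⟩, rfl⟩).2
  · exact mem_extChartAt_source _
  · change A (χ (φ w)) ∈ e.target
    rw [← hev]
    exact e.map_source hwe
  · exact (contMDiffOn_iff_contDiffOn.mpr hsymm).comp (hAχ.mono fun y hy => hy.2.1)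
      fun y hy => hy.2.2
  · rintro y ⟨hyS, hyO, -⟩
    obtain ⟨u, ⟨hu, hue⟩, rfl⟩ := hOS.symm.subset ⟨hyS, hyO⟩
    have h1 : e.symm (A (χ (φ u))) = u := by rw [← hev, e.left_inv hue]
    refine ⟨?_, congrArg φ h1⟩
    change e.symm (A (χ (φ u))) ∈ V
    rwa [h1]

/-- If `g` is stationary at a point of `S` along an open parametrization, then it is stationary
along every differentiable map to `S`. -/
theorem hasFDerivWithinAt_zero [FiniteDimensional ℝ E] [IsManifold I ∞ X]
    (h : IsOpenParam I p S V φ) {w : Euc p} (hw : w ∈ V) {g : X → ℝ}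
    (hg : HasFDerivAt (g ∘ φ) (0 : Euc p →L[ℝ] ℝ) w) {q : ℕ} {η : Euc q → X} {s : Set (Euc q)}
    {v : Euc q} (hηS : Set.MapsTo η s S) (hv : v ∈ s) (hηv : η v = φ w)
    (hη : MDifferentiableWithinAt 𝓘(ℝ, Euc q) I η s v) :
    HasFDerivWithinAt (g ∘ η) (0 : Euc q →L[ℝ] ℝ) s v := by
  obtain ⟨N, r, hN, hwN, hr, hrS⟩ := h.exists_smooth_inverse hw
  have hrw : r (η v) = w := by
    obtain ⟨h1, h2⟩ := hrS (φ w) ⟨h.mapsTo hw, hwN⟩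
    rw [hηv]
    exact h.injOn h1 hw h2
  have hrd : MDifferentiableAt I 𝓘(ℝ, Euc p) r (η v) := by
    rw [hηv]
    exact ((hr _ hwN).contMDiffAt (hN.mem_nhds hwN)).mdifferentiableAt (by simp)
  have h1 : DifferentiableWithinAt ℝ (r ∘ η) s v :=
    mdifferentiableWithinAt_iff_differentiableWithinAt.mp
      (hrd.comp_mdifferentiableWithinAt v hη)
  have h2 : HasFDerivWithinAt ((g ∘ φ) ∘ (r ∘ η)) (0 : Euc q →L[ℝ] ℝ) s v := by
    have h3 : HasFDerivAt (g ∘ φ) (0 : Euc p →L[ℝ] ℝ) ((r ∘ η) v) := by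
      rw [Function.comp_apply (f := r), hrw]
      exact hg
    exact (h3.comp_hasFDerivWithinAt v h1.hasFDerivWithinAt).congr_fderiv (by ext; simp)
  have h4 : ∀ᶠ u in nhdsWithin v s, (g ∘ η) u = ((g ∘ φ) ∘ (r ∘ η)) u := by
    have h5 : ∀ᶠ u in nhdsWithin v s, η u ∈ N :=
      hη.continuousWithinAt.eventually (hN.mem_nhds (hηv ▸ hwN))
    filter_upwards [h5, self_mem_nhdsWithin] with u hu hus
    exact congrArg g (hrS _ ⟨hηS hus, hu⟩).2.symm
  exact h2.congr_of_eventuallyEq h4 (h4.self_of_nhdsWithin hv)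

end IsOpenParam

end OpenParam

/-! ### The intersection of an admissible submanifold with `M` -/

section Adapted

variable {p : ℕ}

/-- A smooth function on `ℝ^p` that is not stationary at a point is, up to a local diffeomorphism,
the first coordinate. -/
theorem exists_openPartialHomeomorph_coordinate [NeZero p] {h : Euc p → ℝ} {S : Set (Euc p)}
    (hS : IsOpen S) (hh : ContDiffOn ℝ ∞ h S) {w : Euc p} (hw : w ∈ S)
    (hd : fderiv ℝ h w ≠ 0) :
    ∃ e : OpenPartialHomeomorph (Euc p) (Euc p), w ∈ e.source ∧ e.source ⊆ S ∧
      ContDiffOn ℝ ∞ e.symm e.target ∧ (∀ u, (e u) 0 = h u) ∧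
      ∀ u ∈ e.source, ∃ A : Euc p ≃L[ℝ] Euc p, HasFDerivAt e (A : Euc p →L[ℝ] Euc p) u := by
  obtain ⟨j, hj⟩ : ∃ j, fderiv ℝ h w (EuclideanSpace.single j 1) ≠ 0 := by
    by_contra! hall
    refine hd ?_
    ext u
    rw [← (EuclideanSpace.basisFun (Fin p) ℝ).sum_repr u]
    simp [hall]
  -- The coordinates are permuted so that the one in whose direction `h` varies becomes the first.
  let P : Euc p →L[ℝ] Euc p :=
    (LinearIsometryEquiv.piLpCongrLeft 2 ℝ ℝ (Equiv.swap 0 j)).toContinuousLinearEquiv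
  have hP : ∀ u i, (P u) i = u (Equiv.swap 0 j i) := fun u i => by
    change (LinearIsometryEquiv.piLpCongrLeft 2 ℝ ℝ (Equiv.swap 0 j) u) i = _
    rw [LinearIsometryEquiv.piLpCongrLeft_apply]
    simp [Equiv.piCongrLeft'_apply]
  let π : Euc p →L[ℝ] ℝ := EuclideanSpace.proj (𝕜 := ℝ) (0 : Fin p)
  let e₀ : Euc p := EuclideanSpace.single 0 1
  let θ : Euc p → Euc p := fun u => P u + (h u - π (P u)) • e₀
  have hθ : ContDiffOn ℝ ∞ θ S := by
    refine P.contDiff.contDiffOn.add ((hh.sub ?_).smul contDiffOn_const)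
    exact (π.contDiff.comp P.contDiff).contDiffOn
  let T : Euc p →L[ℝ] Euc p := P + (fderiv ℝ h w - π.comp P).smulRight e₀
  have hT : HasFDerivAt θ T w := by
    have h1 : HasFDerivAt h (fderiv ℝ h w) w :=
      ((hh.contDiffAt (hS.mem_nhds hw)).differentiableAt (by simp)).hasFDerivAt
    exact P.hasFDerivAt.add ((h1.sub (π.comp P).hasFDerivAt).smul_const e₀)
  have hinj : Function.Injective T := by
    refine (injective_iff_map_eq_zero T).mpr fun u hu => ?_
    have hcoord : ∀ i, i ≠ 0 → u (Equiv.swap 0 j i) = 0 := fun i hi => by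
      have := congrArg (fun z : Euc p => z i) hu
      simpa [T, e₀, hP, hi] using this
    have huj : u = u j • EuclideanSpace.single j 1 := by
      ext i
      by_cases hi : i = j
      · subst hi; simp
      · have := hcoord (Equiv.swap 0 j i) (fun h0 => hi (by
          have := congrArg (Equiv.swap 0 j) h0
          simpa using this))
        simp only [Equiv.swap_apply_self] at this
        simp [this, hi]
    have h0 := congrArg (fun z : Euc p => z 0) hu
    have h1 : fderiv ℝ h w u = 0 := by simpa [T, e₀, π] using h0
    rw [huj, map_smul, smul_eq_mul] at h1
    rw [huj, (mul_eq_zero.mp h1).resolve_right hj, zero_smul]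
  let A : Euc p ≃L[ℝ] Euc p :=
    (LinearEquiv.ofInjectiveEndo (T : Euc p →ₗ[ℝ] Euc p) hinj).toContinuousLinearEquiv
  have hA : (A : Euc p →L[ℝ] Euc p) = T := by
    ext1 x
    rfl
  obtain ⟨e, he, hwe, heS, hsymm, hder⟩ := exists_smooth_localInverse hS hθ hw (hA ▸ hT)
  refine ⟨e, hwe, heS, hsymm, fun u => ?_, by rw [he]; exact hder⟩
  rw [he]
  simp [θ, e₀, π]

end Adapted

section Transverse

variable {n p : ℕ} [NeZero n] {X : Type u} [TopologicalSpace X]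
  [ChartedSpace (EuclideanHalfSpace n) X] {M : Set X}

/-- If `g` is stationary at `x` along all local parametrizations of `S`, then its differential
vanishes on the tangent space of `S`. -/
theorem submanifoldTangent_le_ker {S : Set X} {x : X} {g : X → ℝ}
    (hg : MDifferentiableAt (𝓡∂ n) 𝓘(ℝ, ℝ) g x)
    (h : ∀ V φ, IsLocalParam (𝓡∂ n) p S V φ → ∀ v ∈ V ∩ halfSpace p, φ v = x →
      HasFDerivWithinAt (g ∘ φ) (0 : Euc p →L[ℝ] ℝ) (V ∩ halfSpace p) v) :
    submanifoldTangent (𝓡∂ n) p S x ≤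
      (mfderiv (𝓡∂ n) 𝓘(ℝ, ℝ) g x).ker := by
  refine Submodule.span_le.mpr ?_
  rintro _ ⟨V, φ, hφ, v, hv, rfl, a, rfl⟩
  have h1 := hasMFDerivWithinAt_iff_hasFDerivWithinAt.mp
    (hg.hasMFDerivAt.comp_hasMFDerivWithinAt v (hφ.mdifferentiableWithinAt hv).hasMFDerivWithinAt)
  have h2 := (uniqueDiffOn_inter_halfSpace hφ.isOpen v hv).eq (h V φ hφ v hv rfl) h1
  exact (congrArg (fun f => f a) h2).symm

namespace ExteriorCollar

variable (C : ExteriorCollar (n := n) M)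

theorem mem_manifoldInterior_of_mem_bd {K : OrientedSubmanifold (𝓡∂ n) X p} (hK : C.Admissible K)
    {x : X} (hx : x ∈ K.carrier) (hxM : x ∈ M) : x ∈ K.interior := by
  by_contra h
  have := hK.boundary_subset (show x ∈ K.boundary from ⟨hx, h⟩)
  rw [C.openA_eq] at this
  exact this hxM

/-- At a boundary point of `M`, an admissible submanifold `K` is parametrized by an open set so that
the first coordinate is a given local defining function `g` of `M`. -/
theorem exists_adapted_param [IsManifold (𝓡∂ n) ∞ X]
    {K : OrientedSubmanifold (𝓡∂ n) X p} (hK : C.Admissible K) {x : X}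
    (hx : x ∈ K.carrier ∩ C.bd) {N : Set X} {g : X → ℝ} (hN : IsOpen N) (hxN : x ∈ N)
    (hg : ContMDiffOn (𝓡∂ n) 𝓘(ℝ, ℝ) ∞ g N) (hgx : mfderiv (𝓡∂ n) 𝓘(ℝ, ℝ) g x ≠ 0)
    (hside : ∀ y ∈ N, (y ∈ M ↔ 0 ≤ g y) ∧ (y ∈ C.A ↔ g y ≤ 0)) :
    ∃ (i : Fin p) (V : Set (Euc p)) (φ : Euc p → X), i.val = 0 ∧
      IsOpenParam (𝓡∂ n) p K.carrier V φ ∧ (∃ w ∈ V, φ w = x) ∧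
      ∀ u ∈ V, φ u ∈ N ∧ g (φ u) = u i := by
  have hxM := C.bd_subset hx.2
  obtain ⟨V, ψ, hψ, -, -, w, hw, rfl⟩ :=
    mem_manifoldInterior_iff.mp (C.mem_manifoldInterior_of_mem_bd hK hx.1 hxM)
  have hgat : ∀ y ∈ N, MDifferentiableAt (𝓡∂ n) 𝓘(ℝ, ℝ) g y := fun y hy =>
    ((hg y hy).contMDiffAt (hN.mem_nhds hy)).mdifferentiableAt (by simp)
  have hvan : ∀ y ∈ C.bd, y ∈ N → g y = 0 := fun y hy hyN =>
    le_antisymm ((hside y hyN).2.mp (C.bd_subset_A hy)) ((hside y hyN).1.mp (C.bd_subset hy))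
  have hd : fderiv ℝ (g ∘ ψ) w ≠ 0 := by
    intro h0
    have hdiff : DifferentiableAt ℝ (g ∘ ψ) w := mdifferentiableAt_iff_differentiableAt.mp
      ((hgat _ hxN).comp w (hψ.mdifferentiableAt hw))
    have h1 : HasFDerivAt (g ∘ ψ) (0 : Euc p →L[ℝ] ℝ) w := h0 ▸ hdiff.hasFDerivAt
    have hle1 := submanifoldTangent_le_ker (p := p) (S := K.carrier) (hgat _ hxN)
      fun V' φ hφ v hv hvx => hψ.hasFDerivWithinAt_zero hw h1 hφ.mapsTo hv hvx
        (hφ.mdifferentiableWithinAt hv)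
    have hle2 := submanifoldTangent_le_ker (p := n - 1) (S := C.bd) (hgat _ hxN) (by
      intro V' φ hφ v hv hvx
      have h2 : ∀ᶠ u in nhdsWithin v (V' ∩ halfSpace (n - 1)), (g ∘ φ) u = 0 := by
        have h3 := (hφ.smooth.continuousOn v hv).eventually (hN.mem_nhds (hvx ▸ hxN))
        filter_upwards [h3, self_mem_nhdsWithin] with u hu hus
        exact hvan _ (hφ.mapsTo hus) hu
      exact (hasFDerivWithinAt_const (0 : ℝ) v _).congr_of_eventuallyEq h2
        (h2.self_of_nhdsWithin hv))
    have htop := (hK.transverse (ψ w) hx).symm.le.trans (sup_le hle1 hle2)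
    refine hgx ?_
    ext1 u
    exact htop (show u ∈ (⊤ : Submodule ℝ _) from trivial)
  have : NeZero p := ⟨by
    rintro rfl
    exact hd (Subsingleton.elim _ _)⟩
  let S := V ∩ ψ ⁻¹' N
  have hS : IsOpen S := hψ.smooth.continuousOn.isOpen_inter_preimage hψ.isOpen hN
  have hh : ContDiffOn ℝ ∞ (g ∘ ψ) S := contMDiffOn_iff_contDiffOn.mp
    (hg.comp (hψ.smooth.mono Set.inter_subset_left) fun u hu => hu.2)
  obtain ⟨e, hwe, heS, hsymm, heh, hder⟩ :=
    exists_openPartialHomeomorph_coordinate hS hh ⟨hw, hxN⟩ hd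
  refine ⟨0, e.target, ψ ∘ e.symm, rfl,
    hψ.comp_symm e (fun u hu => (heS hu).1) hsymm hder, ⟨e w, e.map_source hwe, ?_⟩, ?_⟩
  · rw [Function.comp_apply, e.left_inv hwe]
  · intro u hu
    refine ⟨(heS (e.map_target hu)).2, ?_⟩
    have := heh (e.symm u)
    rw [e.right_inv hu] at this
    exact this.symm

/-- At a point of `K ∩ ∂M`, the defining function of `M` would have a minimum along a parametrization
of `K ∩ M` by an open set, contrary to transversality; hence such a point is a boundary point. -/
theorem manifoldInterior_disjoint_bd [IsManifold (𝓡∂ n) ∞ X]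
    {K : OrientedSubmanifold (𝓡∂ n) X p} (hK : C.Admissible K)
    {x : X} (hx : x ∈ K.carrier ∩ C.bd) : x ∉ manifoldInterior (𝓡∂ n) p (K.carrier ∩ M) := by
  obtain ⟨N, g, hN, hxN, hg, hgx, hside⟩ := C.exists_defining_function hx.2
  obtain ⟨i, V, φ, hi, hφ, ⟨w, hw, hwx⟩, hφg⟩ := C.exists_adapted_param hK hx hN hxN hg hgx hside
  intro hint
  obtain ⟨V', ψ, hψ, -, -, v, hv, hvx⟩ := mem_manifoldInterior_iff.mp hint
  have hgx0 : g x = 0 := le_antisymm ((hside x hxN).2.mp (C.bd_subset_A hx.2))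
    ((hside x hxN).1.mp (C.bd_subset hx.2))
  -- The function `g` has a minimum at `x` on `K ∩ M`.
  have hmin : IsLocalMin (g ∘ ψ) v := by
    have h3 := (hψ.smooth.continuousOn.continuousAt (hψ.isOpen.mem_nhds hv)).eventually
      (hN.mem_nhds (hvx ▸ hxN))
    filter_upwards [h3, hψ.isOpen.mem_nhds hv] with u hu huV
    change g (ψ v) ≤ g (ψ u)
    rw [hvx, hgx0]
    exact (hside _ hu).1.mp (hψ.mapsTo huV).2
  have hgψ : HasFDerivAt (g ∘ ψ) (0 : Euc p →L[ℝ] ℝ) v := by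
    have hdiff : DifferentiableAt ℝ (g ∘ ψ) v := mdifferentiableAt_iff_differentiableAt.mp
      ((((hg (ψ v) (hvx ▸ hxN)).contMDiffAt (hN.mem_nhds (hvx ▸ hxN))).mdifferentiableAt
        (by simp)).comp v (hψ.mdifferentiableAt hv))
    rw [← hmin.fderiv_eq_zero]
    exact hdiff.hasFDerivAt
  have hw0 : w i = 0 := by rw [← (hφg w hw).2, hwx, hgx0]
  have hwh : w ∈ V ∩ halfSpace p := ⟨hw, (mem_halfSpace_iff hi).mpr hw0.ge⟩
  have h1 : HasFDerivWithinAt (g ∘ φ) (0 : Euc p →L[ℝ] ℝ) (V ∩ halfSpace p) w :=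
    hψ.hasFDerivWithinAt_zero hv hgψ (fun u hu => ⟨hφ.mapsTo hu.1, by
      rw [(hside _ (hφg u hu.1).1).1, (hφg u hu.1).2]
      exact (mem_halfSpace_iff hi).mp hu.2⟩) hwh (hwx.trans hvx.symm)
      ((hφ.mdifferentiableAt hw).mdifferentiableWithinAt)
  have h2 : HasFDerivWithinAt (g ∘ φ) (EuclideanSpace.proj (𝕜 := ℝ) i) (V ∩ halfSpace p) w :=
    (EuclideanSpace.proj (𝕜 := ℝ) i).hasFDerivWithinAt.congr (fun u hu => (hφg u hu.1).2)
      (hφg w hw).2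
  have h3 := (uniqueDiffOn_inter_halfSpace hφ.isOpen w hwh).eq h1 h2
  have h4 := DFunLike.congr_fun h3 (EuclideanSpace.single i 1)
  simp at h4

theorem isLocalParam_inter {K : Set X} {V : Set (Euc p)} {φ : Euc p → X}
    (hφ : IsOpenParam (𝓡∂ n) p K V φ) {N : Set X} {g : X → ℝ} {i : Fin p} (hi : i.val = 0)
    (hside : ∀ y ∈ N, (y ∈ M ↔ 0 ≤ g y) ∧ (y ∈ C.A ↔ g y ≤ 0))
    (hφg : ∀ u ∈ V, φ u ∈ N ∧ g (φ u) = u i) : IsLocalParam (𝓡∂ n) p (K ∩ M) V φ :=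
  hφ.isLocalParam Set.inter_subset_left fun u hu => by
    rw [Set.mem_inter_iff, (hside _ (hφg u hu).1).1, (hφg u hu).2, mem_halfSpace_iff hi]
    exact ⟨fun h => h.2, fun h => ⟨hφ.mapsTo hu, h⟩⟩

theorem mem_manifoldInterior_inter {K : OrientedSubmanifold (𝓡∂ n) X p} (hK : C.Admissible K)
    {x : X} (hx : x ∈ K.carrier ∩ M) (hxb : x ∉ C.bd) :
    x ∈ manifoldInterior (𝓡∂ n) p (K.carrier ∩ M) := by
  obtain ⟨V, φ, hφ, hV, hφ', v, hv, rfl⟩ :=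
    mem_manifoldInterior_iff.mp (C.mem_manifoldInterior_of_mem_bd hK hx.1 hx.2)
  have hvA : φ v ∈ C.Aᶜ := fun h => hxb (by rw [← C.M_inter_A]; exact ⟨hx.2, h⟩)
  have hVo : V ∩ openHalfSpace p = V := Set.inter_eq_self_of_subset_left hV
  have hV'h : V ∩ φ ⁻¹' C.Aᶜ ∩ halfSpace p = V ∩ φ ⁻¹' C.Aᶜ :=
    Set.inter_eq_self_of_subset_left fun u hu => openHalfSpace_subset (hV hu.1)
  refine ⟨V ∩ φ ⁻¹' C.Aᶜ, φ, hφ'.restrict ?_ Set.inter_subset_left ?_, v,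
    ⟨⟨hv, hvA⟩, hV hv⟩, rfl⟩
  · exact hφ.smooth.continuousOn.isOpen_inter_preimage hφ.isOpen C.isClosed_A.isOpen_compl
  · obtain ⟨U, hU, hUS⟩ := hφ.image_open
    refine ⟨U ∩ C.Aᶜ, hU.inter C.isClosed_A.isOpen_compl, ?_⟩
    rw [hV'h]
    ext y
    constructor
    · rintro ⟨u, hu, rfl⟩
      have h1 := hUS.subset ⟨u, hu.1, rfl⟩
      exact ⟨⟨h1.1, (C.mem_or_mem _).resolve_right hu.2⟩, h1.2, hu.2⟩
    · rintro ⟨hyS, hyU, hyA⟩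
      obtain ⟨u, hu, rfl⟩ := hUS.symm.subset ⟨hyS.1, hyU⟩
      exact ⟨u, ⟨hu, hyA⟩, rfl⟩

theorem manifoldInterior_inter [IsManifold (𝓡∂ n) ∞ X]
    {K : OrientedSubmanifold (𝓡∂ n) X p} (hK : C.Admissible K) :
    manifoldInterior (𝓡∂ n) p (K.carrier ∩ M) = (K.carrier ∩ M) \ C.bd := by
  ext x
  constructor
  · intro hx
    have hxS : x ∈ K.carrier ∩ M := by
      obtain ⟨V, φ, hφ, -, -, v, hv, rfl⟩ := mem_manifoldInterior_iff.mp hx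
      exact hφ.mapsTo hv
    exact ⟨hxS, fun hb => C.manifoldInterior_disjoint_bd hK ⟨hxS.1, hb⟩ hx⟩
  · exact fun hx => C.mem_manifoldInterior_inter hK hx.1 hx.2

theorem isSubmanifold_inter [IsManifold (𝓡∂ n) ∞ X]
    {K : OrientedSubmanifold (𝓡∂ n) X p} (hK : C.Admissible K) :
    IsSubmanifold (𝓡∂ n) p (K.carrier ∩ M) := by
  intro x hx
  by_cases hxb : x ∈ C.bd
  · obtain ⟨N, g, hN, hxN, hg, hgx, hside⟩ := C.exists_defining_function hxb
    obtain ⟨i, V, φ, hi, hφ, ⟨w, hw, rfl⟩, hφg⟩ :=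
      C.exists_adapted_param hK ⟨hx.1, hxb⟩ hN hxN hg hgx hside
    refine ⟨V, φ, C.isLocalParam_inter hφ hi hside hφg, w, ⟨hw, ?_⟩, rfl⟩
    rw [mem_halfSpace_iff hi, ← (hφg w hw).2, ← (hside _ hxN).1]
    exact hx.2
  · obtain ⟨V, φ, hφ, v, hv, hvx⟩ := C.mem_manifoldInterior_inter hK hx hxb
    exact ⟨V, φ, hφ, v, ⟨hv.1, openHalfSpace_subset hv.2⟩, hvx⟩

end ExteriorCollar

end Transverse

section Restriction

variable {E : Type*} [NormedAddCommGroup E] [NormedSpace ℝ E] {H : Type*} [TopologicalSpace H]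
  {I : ModelWithCorners ℝ E H} {X : Type u} [TopologicalSpace X] [ChartedSpace H X]
  {p : ℕ} {S U : Set X}

theorem IsLocalParam.exists_inter_isOpen {φ : Euc p → X} {V : Set (Euc p)}
    (h : IsLocalParam I p S V φ) (hU : IsOpen U) {v : Euc p} (hv : v ∈ V ∩ halfSpace p)
    (hvU : φ v ∈ U) : ∃ V', IsLocalParam I p (S ∩ U) V' φ ∧ v ∈ V' := by
  obtain ⟨O, hO, hOeq⟩ := continuousOn_iff'.mp h.smooth.continuousOn U hU
  have heq : V ∩ O ∩ halfSpace p = V ∩ halfSpace p ∩ φ ⁻¹' U := by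
    rw [Set.inter_right_comm, Set.inter_comm _ O, ← hOeq, Set.inter_comm]
  refine ⟨V ∩ O, h.restrict (h.isOpen.inter hO) Set.inter_subset_left ?_, ?_⟩
  · obtain ⟨W, hW, hWS⟩ := h.image_open
    refine ⟨W, hW, ?_⟩
    rw [heq]
    ext y
    constructor
    · rintro ⟨u, hu, rfl⟩
      have h1 := hWS.subset ⟨u, hu.1, rfl⟩
      exact ⟨⟨h1.1, hu.2⟩, h1.2⟩
    · rintro ⟨⟨hyS, hyU⟩, hyW⟩
      obtain ⟨u, hu, rfl⟩ := hWS.symm.subset ⟨hyS, hyW⟩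
      exact ⟨u, ⟨hu, hyU⟩, rfl⟩
  · exact (heq.symm.subset ⟨hv, hvU⟩).1

theorem IsSubmanifold.inter_isOpen (h : IsSubmanifold I p S) (hU : IsOpen U) :
    IsSubmanifold I p (S ∩ U) := by
  rintro x ⟨hxS, hxU⟩
  obtain ⟨V, φ, hφ, v, hv, rfl⟩ := h x hxS
  obtain ⟨V', hφ', hv'⟩ := hφ.exists_inter_isOpen hU hv hxU
  exact ⟨V', φ, hφ', v, ⟨hv', hv.2⟩, rfl⟩

theorem manifoldInterior_inter_isOpen (hU : IsOpen U) :
    manifoldInterior I p (S ∩ U) = manifoldInterior I p S ∩ U := by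
  ext x
  constructor
  · rintro ⟨V, φ, hφ, v, hv, rfl⟩
    have hvh : v ∈ V ∩ halfSpace p := ⟨hv.1, openHalfSpace_subset hv.2⟩
    obtain ⟨W, hW, hWS⟩ := hφ.image_open
    refine ⟨⟨V, φ, hφ.restrict hφ.isOpen subset_rfl ⟨U ∩ W, hU.inter hW, ?_⟩, v, hv, rfl⟩,
      (hφ.mapsTo hvh).2⟩
    rw [hWS, Set.inter_assoc]
  · rintro ⟨⟨V, φ, hφ, v, hv, rfl⟩, hxU⟩
    obtain ⟨V', hφ', hv'⟩ :=
      hφ.exists_inter_isOpen hU ⟨hv.1, openHalfSpace_subset hv.2⟩ hxU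
    exact ⟨V', φ, hφ', v, ⟨hv', hv.2⟩, rfl⟩

end Restriction

/-! ### Pushing a neighbourhood of the collar into the collar -/

section Push

variable {Y : Type u} [TopologicalSpace Y]

/-- A deformation of `Y` that preserves `M` and fixes `A` pointwise. -/
structure IsPush (M A : Set Y) (D : C(Y × unitInterval, Y)) : Prop where
  map_zero : ∀ y, D (y, 0) = y
  map_left : ∀ y ∈ M, ∀ s, D (y, s) ∈ M
  map_right : ∀ y ∈ A, ∀ s, D (y, s) = y

variable {M A : Set Y}

theorem IsPush.fst : IsPush M A (ContinuousMap.fst : C(Y × unitInterval, Y)) where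
  map_zero _ := rfl
  map_left _ hy _ := hy
  map_right _ _ _ := rfl

theorem IsPush.comp {D D' : C(Y × unitInterval, Y)} (h : IsPush M A D) (h' : IsPush M A D') :
    IsPush M A (D'.comp (D.prodMk ContinuousMap.snd)) where
  map_zero y := by
    change D' (D (y, 0), 0) = y
    rw [h'.map_zero, h.map_zero]
  map_left y hy s := h'.map_left _ (h.map_left y hy s) s
  map_right y hy s := by
    change D' (D (y, s), s) = y
    rw [h.map_right y hy, h'.map_right y hy]

/-- Lowering the coordinate `i`, where it is positive, by at most `s * (ε - dist v w)`. -/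
def lowerCoordinate {p : ℕ} (i : Fin p) (w : Euc p) (ε : ℝ) (v : Euc p) (s : ℝ) : Euc p :=
  v + (min (v i) (max 0 (v i - s * max 0 (ε - dist v w))) - v i) • EuclideanSpace.single i 1

section LowerCoordinate

variable {p : ℕ} {i : Fin p} {w v : Euc p} {ε s : ℝ}

theorem continuous_lowerCoordinate :
    Continuous fun z : Euc p × ℝ => lowerCoordinate i w ε z.1 z.2 := by
  unfold lowerCoordinate
  fun_prop

theorem lowerCoordinate_apply :
    (lowerCoordinate i w ε v s) i = min (v i) (max 0 (v i - s * max 0 (ε - dist v w))) := by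
  simp [lowerCoordinate]

theorem lowerCoordinate_zero : lowerCoordinate i w ε v 0 = v := by
  simp [lowerCoordinate]

theorem lowerCoordinate_of_nonpos (h : v i ≤ 0) : lowerCoordinate i w ε v s = v := by
  rw [lowerCoordinate, min_eq_left (h.trans (le_max_left _ _)), sub_self, zero_smul, add_zero]

theorem lowerCoordinate_of_notMem (h : v ∉ Metric.closedBall w ε) :
    lowerCoordinate i w ε v s = v := by
  have h1 : max 0 (ε - dist v w) = 0 := max_eq_left (by
    rw [Metric.mem_closedBall, not_le] at h
    linarith)
  rw [lowerCoordinate, h1, mul_zero, sub_zero, min_eq_left (le_max_right _ _), sub_self, zero_smul,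
    add_zero]

theorem lowerCoordinate_mem (h : v ∈ Metric.closedBall w ε) (hs : s ∈ Set.Icc (0 : ℝ) 1) :
    lowerCoordinate i w ε v s ∈ Metric.closedBall w ε := by
  rw [Metric.mem_closedBall] at h ⊢
  have h1 : max 0 (ε - dist v w) = ε - dist v w := max_eq_right (by linarith)
  have h2 : dist (lowerCoordinate i w ε v s) v ≤ ε - dist v w := by
    rw [dist_eq_norm, lowerCoordinate, add_sub_cancel_left, norm_smul, PiLp.norm_single, norm_one,
      mul_one, h1, Real.norm_eq_abs]
    have h3 : s * (ε - dist v w) ≤ ε - dist v w := mul_le_of_le_one_left (by linarith) hs.2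
    have h4 : 0 ≤ s * (ε - dist v w) := mul_nonneg hs.1 (by linarith)
    rw [abs_le]
    constructor
    · have : v i - s * (ε - dist v w) ≤ min (v i) (max 0 (v i - s * (ε - dist v w))) :=
        le_min (by linarith) (le_max_right _ _)
      linarith
    · have := min_le_left (v i) (max 0 (v i - s * (ε - dist v w)))
      linarith
  linarith [dist_triangle (lowerCoordinate i w ε v s) v w]

theorem lowerCoordinate_nonneg (h : 0 ≤ v i) : 0 ≤ (lowerCoordinate i w ε v s) i := by
  rw [lowerCoordinate_apply]
  exact le_min h (le_max_left _ _)

theorem lowerCoordinate_one_nonpos (hw : w i = 0) (h : v ∈ Metric.ball w (ε / 2)) :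
    (lowerCoordinate i w ε v 1) i ≤ 0 := by
  rw [lowerCoordinate_apply, one_mul]
  rw [Metric.mem_ball] at h
  refine (min_le_right _ _).trans (max_le le_rfl ?_)
  have h1 : |(v - w) i| ≤ ‖v - w‖ := PiLp.norm_apply_le (p := 2) (v - w) i
  rw [← dist_eq_norm, PiLp.sub_apply, hw, sub_zero] at h1
  have h2 := le_max_right 0 (ε - dist v w)
  linarith [le_abs_self (v i)]

end LowerCoordinate

/-- In the domain of a parametrization in which `M` and `A` are the half-spaces `0 ≤ vᵢ` and
`vᵢ ≤ 0`, lowering `vᵢ` pushes a neighbourhood of a point of `M ∩ A` into `A`. -/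
theorem exists_isPush_of_param [T2Space Y] {p : ℕ} {V : Set (Euc p)} (hV : IsOpen V) {j : V → Y}
    (hj : Topology.IsOpenEmbedding j) {i : Fin p} (hM : ∀ v : V, j v ∈ M ↔ 0 ≤ v.1 i)
    (hA : ∀ v : V, j v ∈ A ↔ v.1 i ≤ 0) (w : V) (hw : w.1 i = 0) :
    ∃ D, IsPush M A D ∧ {y | D (y, 1) ∈ A} ∈ nhds (j w) := by
  classical
  obtain ⟨ε, hε, hball⟩ := Metric.nhds_basis_closedBall.mem_iff.mp (hV.mem_nhds w.2)
  have hmem : ∀ (v : V) (s : unitInterval), lowerCoordinate i w.1 ε v.1 s ∈ V := fun v s => by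
    by_cases h : v.1 ∈ Metric.closedBall w.1 ε
    · exact hball (lowerCoordinate_mem h s.2)
    · rw [lowerCoordinate_of_notMem h]
      exact v.2
  let d : V × unitInterval → V := fun z => ⟨lowerCoordinate i w.1 ε z.1.1 z.2, hmem z.1 z.2⟩
  have hd : Continuous d := by
    refine Continuous.subtype_mk ?_ _
    exact continuous_lowerCoordinate.comp
      (f := fun z : V × unitInterval => ((z.1.1, z.2.1) : Euc p × ℝ)) (by fun_prop)
  let D : Y × unitInterval → Y := fun z =>
    if h : ∃ v, j v = z.1 then j (d (h.choose, z.2)) else z.1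
  have hDj : ∀ v s, D (j v, s) = j (d (v, s)) := fun v s => by
    have h : ∃ v', j v' = j v := ⟨v, rfl⟩
    have h1 : h.choose = v := hj.injective h.choose_spec
    change dite _ _ _ = _
    rw [dif_pos h, h1]
  have hD : ∀ y s, (∀ v, j v ≠ y) → D (y, s) = y := fun y s h => dif_neg (fun ⟨v, hv⟩ => h v hv)
  have hcases : ∀ y, (∃ v, j v = y) ∨ ∀ v, j v ≠ y := fun y => by
    by_cases h : ∃ v, j v = y
    · exact Or.inl h
    · exact Or.inr fun v hv => h ⟨v, hv⟩
  have hcont : Continuous D := by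
    refine continuous_iff_continuousAt.mpr ?_
    rintro ⟨y, s⟩
    rcases hcases y with ⟨v, rfl⟩ | hy
    · have h1 : Topology.IsOpenEmbedding (Prod.map j (id : unitInterval → unitInterval)) :=
        hj.prodMap Topology.IsOpenEmbedding.id
      refine (h1.continuousAt_iff (x := (v, s))).mp ?_
      have h2 : D ∘ Prod.map j id = j ∘ d := funext fun z => hDj z.1 z.2
      rw [h2]
      exact (hj.continuous.comp hd).continuousAt
    · -- Outside the compact image of a closed ball, the deformation is constant.
      let B : Set Y := j '' (Subtype.val ⁻¹' Metric.closedBall w.1 ε)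
      have hB : IsClosed B := by
        refine IsCompact.isClosed (IsCompact.image ?_ hj.continuous)
        exact hV.isOpenEmbedding_subtypeVal.isInducing.isCompact_preimage'
          (isCompact_closedBall _ _) (by simpa using hball)
      have hyB : Bᶜ ×ˢ Set.univ ∈ nhds (y, s) :=
        (hB.isOpen_compl.prod isOpen_univ).mem_nhds ⟨fun ⟨v, _, hv⟩ => hy v hv, trivial⟩
      refine continuousAt_fst.congr ?_
      filter_upwards [hyB]
      rintro ⟨y', s'⟩ ⟨hy', -⟩
      rcases hcases y' with ⟨v, rfl⟩ | h
      · rw [hDj]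
        refine congrArg j (Subtype.ext ?_)
        exact (lowerCoordinate_of_notMem fun h => hy' ⟨v, h, rfl⟩).symm
      · exact (hD y' s' h).symm
  refine ⟨⟨D, hcont⟩, ⟨fun y => ?_, fun y hy s => ?_, fun y hy s => ?_⟩, ?_⟩
  · rcases hcases y with ⟨v, rfl⟩ | h
    · exact (hDj v 0).trans (congrArg j (Subtype.ext lowerCoordinate_zero))
    · exact hD y 0 h
  · rcases hcases y with ⟨v, rfl⟩ | h
    · change D (j v, s) ∈ M
      rw [hDj, hM]
      exact lowerCoordinate_nonneg ((hM v).mp hy)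
    · change D (y, s) ∈ M
      rwa [hD y s h]
  · rcases hcases y with ⟨v, rfl⟩ | h
    · exact (hDj v s).trans
        (congrArg j (Subtype.ext (lowerCoordinate_of_nonpos ((hA v).mp hy))))
    · exact hD y s h
  · have h1 : (Subtype.val ⁻¹' Metric.ball w.1 (ε / 2) : Set V) ∈ nhds w :=
      continuous_subtype_val.continuousAt.preimage_mem_nhds
        (Metric.ball_mem_nhds w.1 (half_pos hε))
    refine Filter.mem_of_superset (hj.isOpenMap.image_mem_nhds h1) ?_
    rintro _ ⟨v, hv, rfl⟩
    change D (j v, 1) ∈ A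
    rw [hDj, hA]
    exact lowerCoordinate_one_nonpos hw hv

/-- Finitely many local pushes compose to a push of a whole neighbourhood of `A` into `A`. -/
theorem exists_isPush [CompactSpace Y] (hM : IsClosed M) (hA : IsClosed A)
    (hMA : ∀ y, y ∈ M ∨ y ∈ A)
    (hloc : ∀ b ∈ M ∩ A, ∃ D, IsPush M A D ∧ {y | D (y, 1) ∈ A} ∈ nhds b) :
    ∃ D, IsPush M A D ∧ ∀ y ∈ A, {y | D (y, 1) ∈ A} ∈ nhds y := by
  have key : ∃ D, IsPush M A D ∧ ∀ b ∈ M ∩ A, b ∈ M ∩ A → {y | D (y, 1) ∈ A} ∈ nhds b := by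
    refine (hM.inter hA).isCompact.induction_on (p := fun s => ∃ D, IsPush M A D ∧
      ∀ b ∈ s, b ∈ M ∩ A → {y | D (y, 1) ∈ A} ∈ nhds b) ?_ ?_ ?_ ?_
    · exact ⟨_, IsPush.fst, fun b hb => hb.elim⟩
    · rintro s t hst ⟨D, hD, h⟩
      exact ⟨D, hD, fun b hb => h b (hst hb)⟩
    · rintro s t ⟨D, hD, h⟩ ⟨D', hD', h'⟩
      refine ⟨_, hD.comp hD', fun b hb hbMA => ?_⟩
      rcases hb with hb | hb
      · filter_upwards [h b hb hbMA] with y hy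
        have hy : D (y, 1) ∈ A := hy
        change D' (D (y, 1), 1) ∈ A
        rwa [hD'.map_right _ hy]
      · have hc : ContinuousAt (fun y => D (y, 1)) b := by fun_prop
        change (fun y => D (y, 1)) ⁻¹' {z | D' (z, 1) ∈ A} ∈ nhds b
        refine hc.preimage_mem_nhds ?_
        rw [hD.map_right b hbMA.2]
        exact h' b hb hbMA
    · intro b hb
      obtain ⟨D, hD, h⟩ := hloc b hb
      exact ⟨interior {y | D (y, 1) ∈ A}, mem_nhdsWithin_of_mem_nhds (interior_mem_nhds.mpr h),
        D, hD, fun y hy _ => mem_interior_iff_mem_nhds.mp hy⟩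
  obtain ⟨D, hD, h⟩ := key
  refine ⟨D, hD, fun y hy => ?_⟩
  by_cases hyM : y ∈ M
  · exact h y ⟨hyM, hy⟩ ⟨hyM, hy⟩
  · filter_upwards [hM.isOpen_compl.mem_nhds hyM] with z hz
    have hzA := (hMA z).resolve_left hz
    change D (z, 1) ∈ A
    rwa [hD.map_right z hzA]

end Push

section PushSubmanifold

variable {n p : ℕ} [NeZero n] {X : Type u} [TopologicalSpace X] [T2Space X]
  [ChartedSpace (EuclideanHalfSpace n) X] [IsManifold (𝓡∂ n) ∞ X] {M : Set X}

/-- A compact admissible submanifold `K` has a deformation that preserves `K ∩ M`, fixes the part of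
`K` in the collar, and ends by mapping a neighbourhood of this part to the collar. -/
theorem ExteriorCollar.exists_push (C : ExteriorCollar (n := n) M)
    {K : OrientedSubmanifold (𝓡∂ n) X p} (hK : C.Admissible K) :
    ∃ D : C(K.carrier × unitInterval, K.carrier),
      IsPush (Subtype.val ⁻¹' M) (Subtype.val ⁻¹' C.A) D ∧
      ∃ G : Set X, IsOpen G ∧ C.A ∩ K.carrier ⊆ G ∧
        ∀ y : K.carrier, y.1 ∈ G → (D (y, 1)).1 ∈ C.A := by
  have : CompactSpace K.carrier := isCompact_iff_compactSpace.mp K.isCompact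
  obtain ⟨D, hD, hDA⟩ := exists_isPush (Y := K.carrier) (M := Subtype.val ⁻¹' M)
    (A := Subtype.val ⁻¹' C.A) (C.isClosed.preimage continuous_subtype_val)
    (C.isClosed_A.preimage continuous_subtype_val) (fun y => C.mem_or_mem y.1) (by
      intro b hb
      have hbb : b.1 ∈ C.bd := by rw [← C.M_inter_A]; exact hb
      obtain ⟨N, g, hN, hbN, hg, hgb, hside⟩ := C.exists_defining_function hbb
      obtain ⟨i, V, φ, hi, hφ, ⟨w, hw, hwb⟩, hφg⟩ :=
        C.exists_adapted_param hK ⟨b.2, hbb⟩ hN hbN hg hgb hside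
      have hj : Topology.IsOpenEmbedding
          (fun v : V => (⟨φ v, hφ.mapsTo v.2⟩ : K.carrier)) := by
        refine ⟨Topology.IsEmbedding.of_comp ?_ continuous_subtype_val hφ.embedding, ?_⟩
        · exact (hφ.smooth.continuousOn.domRestrict).subtype_mk _
        · obtain ⟨U, hU, hUK⟩ := hφ.image_open
          refine isOpen_induced_iff.mpr ⟨U, hU, ?_⟩
          ext y
          constructor
          · intro hy
            obtain ⟨v, hv, hvy⟩ := hUK.symm.subset ⟨y.2, hy⟩
            exact ⟨⟨v, hv⟩, Subtype.ext hvy⟩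
          · rintro ⟨v, rfl⟩
            exact (hUK.subset ⟨v, v.2, rfl⟩).2
      have hwi : w i = 0 := by
        rw [← (hφg w hw).2, hwb]
        exact le_antisymm ((hside _ hbN).2.mp hb.2) ((hside _ hbN).1.mp hb.1)
      have h := exists_isPush_of_param hφ.isOpen hj (i := i) (M := Subtype.val ⁻¹' M)
        (A := Subtype.val ⁻¹' C.A)
        (fun v => by rw [← (hφg v v.2).2]; exact (hside _ (hφg v v.2).1).1)
        (fun v => by rw [← (hφg v v.2).2]; exact (hside _ (hφg v v.2).1).2) ⟨w, hw⟩ hwi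
      rwa [show (⟨φ w, hφ.mapsTo hw⟩ : K.carrier) = b from Subtype.ext hwb] at h)
  obtain ⟨G, hG, hGeq⟩ := isOpen_induced_iff.mp
    (isOpen_interior (s := {y : K.carrier | D (y, 1) ∈ Subtype.val ⁻¹' C.A}))
  refine ⟨D, hD, G, hG, fun y hy => ?_, fun y hy => ?_⟩
  · exact hGeq.symm.subset (mem_interior_iff_mem_nhds.mpr (hDA ⟨y, hy.2⟩ hy.1))
  · exact interior_subset (s := {y : K.carrier | D (y, 1) ∈ Subtype.val ⁻¹' C.A})
      (hGeq.subset hy)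

end PushSubmanifold

/-! ### Restricting orientations -/

section Orientation

variable {E : Type*} [NormedAddCommGroup E] [NormedSpace ℝ E] {H : Type*} [TopologicalSpace H]
  {I : ModelWithCorners ℝ E H} {X : Type u} [TopologicalSpace X] [ChartedSpace H X]
  {p : ℕ} {S S' : Set X}

/-- `H_p(S', S' \ U) ≅ H_p(S, S \ U)` if `S` and `S'` agree near the closure of `U`. -/
theorem relHomologyMap_compl_bijective (hS : S' ⊆ S) {U O : Set X} (hUO : closure U ⊆ O)
    (hO : IsOpen O) (hSO : S ∩ O ⊆ S') :
    Function.Bijective (relHomologyMap p hS (Set.inter_subset_right : S' ∩ Uᶜ ⊆ Uᶜ)) :=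
  relHomologyMap_bijective_of_excision hS hO isClosed_closure.isOpen_compl
    (fun y _ => (Classical.em (y ∈ closure U)).imp (fun h => hUO h) id) hSO
    fun _ hy hyU => hy.2 (subset_closure hyU)

/-- The local orientations of `S'` that correspond to those of a set `S` containing `S'`, at the
points near which `S` and `S'` agree. At the other points, the value is arbitrary where the local
orientation of `S` does not come from `S'`. -/
def pullbackOrientation (hS : S' ⊆ S) (o : ∀ x : X, relHomology p S {x}ᶜ) (x : X) :
    relHomology p S' {x}ᶜ :=
  Function.invFun (relHomologyMap p hS (Set.inter_subset_right : S' ∩ {x}ᶜ ⊆ {x}ᶜ)) (o x)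

variable [T1Space X]

theorem relHomologyMap_pullbackOrientation (hS : S' ⊆ S) (o : ∀ x : X, relHomology p S {x}ᶜ) {x : X}
    {O : Set X} (hO : IsOpen O) (hx : x ∈ O) (hSO : S ∩ O ⊆ S') :
    relHomologyMap p hS (Set.inter_subset_right : S' ∩ {x}ᶜ ⊆ {x}ᶜ)
      (pullbackOrientation hS o x) = o x :=
  Function.invFun_eq ((relHomologyMap_compl_bijective hS
    (by rwa [closure_singleton, Set.singleton_subset_iff]) hO hSO).2 (o x))

/-- An orientation of `S` restricts to a submanifold `S'` of the same dimension that agrees with `S`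
near each of its interior points. -/
theorem IsOrientation.pullback [RegularSpace X] {o : ∀ x : X, relHomology p S {x}ᶜ}
    (ho : IsOrientation I p S o) (hS : S' ⊆ S)
    (hint : manifoldInterior I p S' ⊆ manifoldInterior I p S)
    (hnear : ∀ x ∈ manifoldInterior I p S', ∃ O, IsOpen O ∧ x ∈ O ∧ S ∩ O ⊆ S') :
    IsOrientation I p S' (pullbackOrientation hS o) where
  generator x hx := by
    obtain ⟨O, hO, hxO, hSO⟩ := hnear x hx
    have hbij := relHomologyMap_compl_bijective (p := p) hS (U := {x})
      (by rwa [closure_singleton, Set.singleton_subset_iff]) hO hSO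
    refine Submodule.map_injective_of_injective hbij.1 ?_
    rw [Submodule.map_span, Set.image_singleton,
      relHomologyMap_pullbackOrientation hS o hO hxO hSO, ho.generator x (hint hx),
      Submodule.map_top, LinearMap.range_eq_top.mpr hbij.2]
  locally_consistent x hx := by
    obtain ⟨O, hO, hxO, hSO⟩ := hnear x hx
    obtain ⟨U, hU, hxU, α, hα⟩ := ho.locally_consistent x (hint hx)
    obtain ⟨F, hF, hFc, hFU⟩ := exists_mem_nhds_isClosed_subset
      ((hU.inter hO).mem_nhds ⟨hxU, hxO⟩)
    have hcl : closure (interior F) ⊆ F := hFc.closure_subset_iff.mpr interior_subset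
    have hbij := relHomologyMap_compl_bijective (p := p) hS (U := interior F)
      (fun y hy => (hFU (hcl hy)).2) hO hSO
    have hFU' : S ∩ Uᶜ ⊆ (interior F)ᶜ := fun y hy hyF => hy.2 (hFU (interior_subset hyF)).1
    obtain ⟨β, hβ⟩ := hbij.2 (relHomologyMap p subset_rfl hFU' α)
    refine ⟨interior F, isOpen_interior, mem_interior_iff_mem_nhds.mpr hF, β,
      fun y hy hyint => ?_⟩
    have hyO : y ∈ O := (hFU (interior_subset hy)).2
    have hyU : y ∈ U := (hFU (interior_subset hy)).1
    refine (relHomologyMap_compl_bijective (p := p) hS (U := {y})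
      (by rwa [closure_singleton, Set.singleton_subset_iff]) hO hSO).1 ?_
    rw [relHomologyMap_pullbackOrientation hS o hO hyO hSO, ← hα y hyU (hint hyint)]
    have hFy : ∀ R : Set X, R ∩ (interior F)ᶜ ⊆ {y}ᶜ := fun R =>
      inter_subset_compl_singleton fun h => h.2 hy
    exact (relHomologyMap_comp subset_rfl (hFy S') hS _ _ β).trans
      ((relHomologyMap_comp hS Set.inter_subset_right subset_rfl (hFy S) (hFy S') β).symm.trans
        ((congrArg _ hβ).trans (relHomologyMap_comp subset_rfl hFU' subset_rfl (hFy S)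
          (inter_subset_compl_singleton fun h => h.2 hyU) α)))

end Orientation

/-! ### The connected components of a compact submanifold -/

section Components

variable {E : Type*} [NormedAddCommGroup E] [NormedSpace ℝ E] {H : Type*} [TopologicalSpace H]
  {I : ModelWithCorners ℝ E H} {X : Type u} [TopologicalSpace X] [ChartedSpace H X]
  {p : ℕ} {S : Set X}

/-- The images of half-balls are connected neighbourhoods. -/
theorem IsSubmanifold.locallyConnectedSpace (h : IsSubmanifold I p S) :
    LocallyConnectedSpace S := by
  rw [locallyConnectedSpace_iff_connected_subsets]
  rintro x U hU
  obtain ⟨W, hW, hWU⟩ := mem_nhds_subtype S x U |>.mp hU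
  obtain ⟨V, φ, hφ, v, hv, hvx⟩ := h x x.2
  have h1 : φ ⁻¹' W ∈ nhdsWithin v (V ∩ halfSpace p) :=
    (hφ.smooth.continuousOn v hv).preimage_mem_nhdsWithin (hvx ▸ hW)
  rw [Set.inter_comm, nhdsWithin_inter_of_mem' (mem_nhdsWithin_of_mem_nhds
    (hφ.isOpen.mem_nhds hv.1))] at h1
  obtain ⟨ε, hε, hball⟩ := Metric.mem_nhdsWithin_iff.mp (Filter.inter_mem h1
    (mem_nhdsWithin_of_mem_nhds (hφ.isOpen.mem_nhds hv.1)))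
  obtain ⟨O, hO, hOS⟩ := hφ.exists_isOpen (Metric.isOpen_ball (x := v) (ε := ε))
  have heq : V ∩ halfSpace p ∩ Metric.ball v ε = Metric.ball v ε ∩ halfSpace p := by
    ext u
    exact ⟨fun hu => ⟨hu.2, hu.1.2⟩, fun hu => ⟨⟨(hball hu).2, hu.2⟩, hu.1⟩⟩
  have himg : Subtype.val '' (Subtype.val ⁻¹' O : Set S) =
      φ '' (Metric.ball v ε ∩ halfSpace p) := by
    rw [Subtype.image_preimage_coe, ← hOS, heq]
  refine ⟨Subtype.val ⁻¹' O, ?_, ?_, ?_⟩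
  · refine (hO.preimage continuous_subtype_val).mem_nhds ?_
    exact (hOS.subset ⟨v, ⟨hv, Metric.mem_ball_self hε⟩, hvx⟩).2
  · rw [← Topology.IsInducing.subtypeVal.isPreconnected_image, himg]
    refine ((convex_ball v ε).inter convex_halfSpace).isPreconnected.image _ ?_
    exact hφ.smooth.continuousOn.mono (heq ▸ Set.inter_subset_left)
  · intro y hy
    obtain ⟨u, hu, huy⟩ := himg.subset ⟨y, hy, rfl⟩
    refine hWU ?_
    rw [Set.mem_preimage, ← huy]
    exact (hball hu).1

/-- A compact, locally connected subset is a finite disjoint union of connected compact subsets that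
are open in it. -/
theorem exists_components (hS : IsCompact S) [LocallyConnectedSpace S] :
    ∃ (r : ℕ) (U : Fin r → Set X), (∀ i, IsOpen (U i)) ∧ (∀ i, IsConnected (S ∩ U i)) ∧
      (∀ i, IsCompact (S ∩ U i)) ∧ (Pairwise fun i j => Disjoint (S ∩ U i) (S ∩ U j)) ∧
      ⋃ i, S ∩ U i = S := by
  have : CompactSpace S := isCompact_iff_compactSpace.mp hS
  have : Finite (ConnectedComponents S) := finite_of_compact_of_discrete
  let e : Fin (Nat.card (ConnectedComponents S)) ≃ ConnectedComponents S :=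
    (Finite.equivFin _).symm
  let Q : ConnectedComponents S → Set S := fun c => ConnectedComponents.mk ⁻¹' {c}
  have hQ : ∀ c, IsClopen (Q c) := fun c =>
    (isClopen_discrete {c}).preimage ConnectedComponents.continuous_coe
  have hQc : ∀ c, IsConnected (Q c) := fun c => by
    obtain ⟨x, rfl⟩ := ConnectedComponents.surjective_coe c
    change IsConnected (ConnectedComponents.mk ⁻¹' {ConnectedComponents.mk x})
    rw [connectedComponents_preimage_singleton]
    exact isConnected_connectedComponent
  choose U hU hUQ using fun i => isOpen_induced_iff.mp (hQ (e i)).isOpen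
  have himg : ∀ i, S ∩ U i = Subtype.val '' Q (e i) := fun i => by
    rw [← hUQ, Subtype.image_preimage_coe]
  refine ⟨_, U, hU, fun i => ?_, fun i => ?_, fun i j hij => ?_, ?_⟩
  · rw [himg]
    exact (hQc _).image _ continuous_subtype_val.continuousOn
  · rw [himg]
    exact (hQ _).isClosed.isCompact.image continuous_subtype_val
  · change Disjoint (S ∩ U i) (S ∩ U j)
    rw [himg, himg, Set.disjoint_image_iff Subtype.val_injective]
    exact (Set.disjoint_singleton.mpr (e.injective.ne hij)).preimage _
  · refine subset_antisymm (Set.iUnion_subset fun i => Set.inter_subset_left) fun x hx => ?_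
    refine Set.mem_iUnion.mpr ⟨e.symm (ConnectedComponents.mk ⟨x, hx⟩), ?_⟩
    rw [himg, e.apply_symm_apply]
    exact ⟨⟨x, hx⟩, rfl, rfl⟩

end Components

/-! ### Chains in a disjoint union -/

section ChainsUnion

variable {X : Type u} [TopologicalSpace X] {n r : ℕ} {S : Set X} {U : Fin r → Set X}

/-- A chain in a finite disjoint union of relatively open sets is a sum of chains in these sets, as
simplices are connected. -/
theorem exists_sum_chainsIn (hU : ∀ i, IsOpen (U i))
    (hd : Pairwise fun i j => Disjoint (S ∩ U i) (S ∩ U j)) (hcov : ⋃ i, S ∩ U i = S)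
    {c : Chains n X} (hc : c ∈ chainsIn n S) :
    ∃ a : Fin r → Chains n X, (∀ i, a i ∈ chainsIn n (S ∩ U i)) ∧ ∑ i, a i = c := by
  have key : chainsIn n S ≤ ⨆ i, chainsIn n (S ∩ U i) := by
    refine chainsIn_le fun σ hσ => ?_
    obtain ⟨t₀⟩ : Nonempty (stdSimplex ℝ (Fin (n + 1))) := inferInstance
    obtain ⟨i, hi⟩ := Set.mem_iUnion.mp (hcov.symm.subset (hσ t₀))
    have hpre : IsPreconnected (Set.range σ) := isPreconnected_range σ.continuous
    have hsub : Set.range σ ⊆ U i ∪ ⋃ j ∈ {j | j ≠ i}, U j := by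
      rintro _ ⟨t, rfl⟩
      obtain ⟨j, hj⟩ := Set.mem_iUnion.mp (hcov.symm.subset (hσ t))
      by_cases hji : j = i
      · exact Or.inl (hji ▸ hj.2)
      · exact Or.inr (Set.mem_biUnion (show j ∈ {j | j ≠ i} from hji) hj.2)
    have hsubU : Set.range σ ⊆ U i := by
      intro y hy
      refine (hsub hy).resolve_right fun hyU => ?_
      obtain ⟨z, ⟨t, rfl⟩, hzi, hzU⟩ := hpre (U i) (⋃ j ∈ {j | j ≠ i}, U j) (hU i)
        (isOpen_biUnion fun j _ => hU j) hsub ⟨_, ⟨t₀, rfl⟩, hi.2⟩ ⟨y, hy, hyU⟩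
      obtain ⟨j, hj, hzj⟩ := Set.mem_iUnion₂.mp hzU
      exact Set.disjoint_left.mp (hd hj) ⟨hσ t, hzj⟩ ⟨hσ t, hzi⟩
    exact Submodule.mem_iSup_of_mem i
      (single_mem_chainsIn (S := S ∩ U i) (σ := σ) (fun t => ⟨hσ t, hsubU ⟨t, rfl⟩⟩) 1)
  obtain ⟨a, ha, hac⟩ := (Submodule.mem_iSup_iff_exists_finsupp _ _).mp (key hc)
  exact ⟨a, ha, by rw [← hac, Finsupp.sum_fintype _ _ fun _ => rfl]⟩

theorem disjoint_chainsIn_support {S T : Set X} (h : Disjoint S T) {c c' : Chains n X}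
    (hc : c ∈ chainsIn n S) (hc' : c' ∈ chainsIn n T) : Disjoint c.support c'.support := by
  refine Finset.disjoint_left.mpr fun σ hσ hσ' => ?_
  obtain ⟨t₀⟩ : Nonempty (stdSimplex ℝ (Fin (n + 1))) := inferInstance
  exact Set.disjoint_left.mp h (hc hσ ⟨t₀, rfl⟩) (hc' hσ' ⟨t₀, rfl⟩)

/-- If a sum of chains in disjoint sets lies in `T`, then so do the summands: no simplex cancels. -/
theorem mem_chainsIn_of_sum_mem {W : Fin r → Set X} {T : Set X}
    (hd : Pairwise fun i j => Disjoint (W i) (W j)) {a : Fin r → Chains n X}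
    (ha : ∀ i, a i ∈ chainsIn n (W i)) (hT : ∑ i, a i ∈ chainsIn n T) (i : Fin r) :
    a i ∈ chainsIn n T := by
  intro σ hσ
  refine hT (Finsupp.mem_support_iff.mpr ?_)
  have h1 : (∑ j, a j) σ = a i σ := by
    rw [Finsupp.finsetSum_apply]
    refine Finset.sum_eq_single i (fun j _ hj => ?_) fun h => absurd (Finset.mem_univ i) h
    exact Finsupp.notMem_support_iff.mp
      (Finset.disjoint_right.mp (disjoint_chainsIn_support (hd hj) (ha j) (ha i)) hσ)
  rw [h1]
  exact Finsupp.mem_support_iff.mp hσ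

end ChainsUnion

/-! ### Cutting an admissible submanifold along the boundary of `M` -/

section Cut

/-- Charts make a Hausdorff manifold locally compact, hence regular. -/
theorem regularSpace_of_chartedSpace (n : ℕ) [NeZero n] (X : Type u) [TopologicalSpace X]
    [T2Space X] [ChartedSpace (EuclideanHalfSpace n) X] : RegularSpace X := by
  have : LocallyCompactSpace (EuclideanHalfSpace n) := (𝓡∂ n).locallyCompactSpace
  have : LocallyCompactSpace X := ChartedSpace.locallyCompactSpace (EuclideanHalfSpace n) X
  infer_instance

variable {n p : ℕ} [NeZero n] {X : Type u} [TopologicalSpace X]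
  [ChartedSpace (EuclideanHalfSpace n) X] {M : Set X}

namespace ExteriorCollar

variable (C : ExteriorCollar (n := n) M)

theorem boundary_subset_A {K : OrientedSubmanifold (𝓡∂ n) X p} (hK : C.Admissible K) :
    K.boundary ⊆ C.A :=
  hK.boundary_subset.trans (Set.image_subset_range _ _)

variable [IsManifold (𝓡∂ n) ∞ X]

/-- A relative cycle of `(K, ∂K)` is homologous, modulo the collar, to a relative cycle of
`(K ∩ M, K ∩ ∂M)`: excision makes it a cycle of `K ∩ M` modulo a neighbourhood of the collar, which
is then pushed into the collar. -/
theorem exists_cut_cycle [T2Space X] {K : OrientedSubmanifold (𝓡∂ n) X p} (hK : C.Admissible K)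
    (c : relCycles p K.carrier K.boundary) :
    ∃ a ∈ chainsIn p (K.carrier ∩ M), bdry p a ∈ chainsIn (p - 1) C.bd ∧
      ∃ d ∈ chainsIn (p + 1) K.carrier, c.1 - a - dChains p d ∈ chainsIn p (K.carrier ∩ C.A) := by
  obtain ⟨D, hD, G, hG, hAG, hGA⟩ := C.exists_push hK
  have hbij := relHomologyMap_bijective_of_excision (p := p) (S := K.carrier)
    (P := K.carrier ∩ M) (T := G) Set.inter_subset_left C.isClosed_A.isOpen_compl hG
    (fun x hx => (Classical.em (x ∈ C.A)).symm.imp id fun h => hAG ⟨h, hx⟩)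
    (fun x hx => ⟨hx.1, (C.mem_or_mem x).resolve_right hx.2⟩) Set.inter_subset_right
  have hcG : c.1 ∈ relCycles p K.carrier G := relCycles_mono subset_rfl
    (fun x hx => hAG ⟨C.boundary_subset_A hK hx.2, hx.1⟩) c.2
  obtain ⟨z, hz⟩ := hbij.2 (relClass p K.carrier G ⟨c.1, hcG⟩)
  obtain ⟨a, rfl⟩ := relClass_surjective _ _ _ z
  rw [relHomologyMap_relClass, ← sub_eq_zero, ← map_sub, relClass_eq_zero_iff] at hz
  obtain ⟨d, hd, hacd⟩ := hz
  -- All chains are transported to the subspace `K`, on which the push is defined.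
  obtain ⟨a₀, ha₀⟩ := exists_pushChains_inclMap (chainsIn_mono Set.inter_subset_left a.2.1)
  obtain ⟨c₀, hc₀⟩ := exists_pushChains_inclMap c.2.1
  obtain ⟨d₀, hd₀⟩ := exists_pushChains_inclMap hd
  let D₁ : C(K.carrier, K.carrier) := D.comp ((ContinuousMap.id _).prodMk (.const _ 1))
  let f : C(K.carrier, X) := (inclMap K.carrier).comp D₁
  have hfM : Set.MapsTo f (Subtype.val ⁻¹' M) (K.carrier ∩ M) := fun y hy =>
    ⟨(D (y, 1)).2, hD.map_left y hy 1⟩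
  have hfG : Set.MapsTo f (Subtype.val ⁻¹' G) (K.carrier ∩ C.A) := fun y hy =>
    ⟨(D (y, 1)).2, hGA y hy⟩
  have ha₀M : a₀ ∈ chainsIn p (Subtype.val ⁻¹' M : Set K.carrier) :=
    pushChains_inclMap_mem.mp (by rw [ha₀]; exact chainsIn_mono Set.inter_subset_right a.2.1)
  have hda₀ : bdry p a₀ ∈ chainsIn (p - 1) (Subtype.val ⁻¹' G : Set K.carrier) :=
    pushChains_inclMap_mem.mp (by
      rw [← bdry_pushChains, ha₀]; exact chainsIn_mono Set.inter_subset_right a.2.2)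
  obtain ⟨d₁, hd₁, hcd₁⟩ := exists_pushChains_homotopy (f := inclMap K.carrier) (g := f)
    ((inclMap K.carrier).comp D) (S := Set.univ) (T := Subtype.val ⁻¹' K.boundary)
    (S' := K.carrier) (T' := K.carrier ∩ C.A)
    (fun y => congrArg Subtype.val (hD.map_zero y)) (fun y => rfl) (fun y _ s => (D (y, s)).2)
    (fun y hy s => ⟨(D (y, s)).2, by
      have h1 : y.1 ∈ C.A := C.boundary_subset_A hK hy
      have h2 := hD.map_right y h1 s
      change (D (y, s)).1 ∈ C.A
      rwa [h2]⟩)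
    (mem_chainsIn_univ c₀) (pushChains_inclMap_mem.mp (by
      rw [← bdry_pushChains, hc₀]; exact chainsIn_mono Set.inter_subset_right c.2.2))
  rw [hc₀] at hcd₁
  have he : a₀ - c₀ - dChains p d₀ ∈ chainsIn p (Subtype.val ⁻¹' G : Set K.carrier) :=
    pushChains_inclMap_mem.mp (by
      rw [map_sub, map_sub, ← dChains_pushChains, ha₀, hc₀, hd₀]
      exact chainsIn_mono Set.inter_subset_right hacd)
  have hfe := pushChains_mem hfG he
  rw [map_sub, map_sub, ← dChains_pushChains] at hfe
  refine ⟨pushChains p f a₀, pushChains_mem hfM ha₀M, ?_, d₁ - pushChains (p + 1) f d₀,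
    Submodule.sub_mem _ hd₁ (pushChains_mem (fun y _ => (D (y, 1)).2) (mem_chainsIn_univ d₀)), ?_⟩
  · rw [bdry_pushChains, ← C.M_inter_A]
    exact mem_chainsIn_inter
      (chainsIn_mono Set.inter_subset_right (pushChains_mem hfM (bdry_mem ha₀M)))
      (chainsIn_mono Set.inter_subset_right (pushChains_mem hfG hda₀))
  · convert Submodule.sub_mem _ hcd₁ hfe using 1
    rw [map_sub]
    abel

theorem manifoldInterior_inter_inter {K : OrientedSubmanifold (𝓡∂ n) X p} (hK : C.Admissible K)
    {U : Set X} (hU : IsOpen U) :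
    manifoldInterior (𝓡∂ n) p (K.carrier ∩ M ∩ U) = (K.carrier ∩ M ∩ U) \ C.bd := by
  rw [manifoldInterior_inter_isOpen hU, C.manifoldInterior_inter hK, Set.sdiff_inter_right_comm]

variable [T2Space X] {K : OrientedSubmanifold (𝓡∂ n) X p} (hK : C.Admissible K)

/-- A relatively open part of `K ∩ M`, if compact, is a submanifold oriented compatibly with `K`. -/
def piece {U : Set X} (hU : IsOpen U) (hc : IsCompact (K.carrier ∩ M ∩ U)) :
    OrientedSubmanifold (𝓡∂ n) X p where
  carrier := K.carrier ∩ M ∩ U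
  isSubmanifold := (C.isSubmanifold_inter hK).inter_isOpen hU
  isCompact := hc
  orientation := pullbackOrientation
    (Set.inter_subset_left.trans Set.inter_subset_left) K.orientation
  isOrientation := by
    have := regularSpace_of_chartedSpace n X
    refine K.isOrientation.pullback _ (fun x hx => ?_) fun x hx => ?_
    · rw [C.manifoldInterior_inter_inter hK hU] at hx
      exact C.mem_manifoldInterior_of_mem_bd hK hx.1.1.1 hx.1.1.2
    · rw [C.manifoldInterior_inter_inter hK hU] at hx
      refine ⟨C.Aᶜ ∩ U, C.isClosed_A.isOpen_compl.inter hU, ⟨fun h => hx.2 ?_, hx.1.2⟩,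
        fun y hy => ⟨⟨hy.1, (C.mem_or_mem y).resolve_right hy.2.1⟩, hy.2.2⟩⟩
      rw [← C.M_inter_A]
      exact ⟨hx.1.1.2, h⟩

variable {U : Set X} (hU : IsOpen U) (hc : IsCompact (K.carrier ∩ M ∩ U))

theorem piece_interior : (C.piece hK hU hc).interior = (K.carrier ∩ M ∩ U) \ C.bd :=
  C.manifoldInterior_inter_inter hK hU

theorem piece_boundary : (C.piece hK hU hc).boundary = (K.carrier ∩ M ∩ U) ∩ C.bd := by
  change (K.carrier ∩ M ∩ U) \ (C.piece hK hU hc).interior = _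
  rw [C.piece_interior, Set.sdiff_sdiff_right_self]

theorem notMem_A_of_mem_piece_interior {x : X} (hx : x ∈ (C.piece hK hU hc).interior) :
    x ∉ C.A := by
  rw [C.piece_interior] at hx
  exact fun h => hx.2 (by rw [← C.M_inter_A]; exact ⟨hx.1.1.2, h⟩)

theorem piece_orientation {x : X} (hx : x ∈ (C.piece hK hU hc).interior) :
    relHomologyMap p (Set.inter_subset_left.trans Set.inter_subset_left :
        (C.piece hK hU hc).carrier ⊆ K.carrier) (fun _ hz => hz.2)
      ((C.piece hK hU hc).orientation x) = K.orientation x := by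
  have hxA := C.notMem_A_of_mem_piece_interior hK hU hc hx
  rw [C.piece_interior] at hx
  exact relHomologyMap_pullbackOrientation _ _ (C.isClosed_A.isOpen_compl.inter hU)
    ⟨hxA, hx.1.2⟩ fun y hy => ⟨⟨hy.1, (C.mem_or_mem y).resolve_right hy.2.1⟩, hy.2.2⟩

theorem piece_interior_subset : (C.piece hK hU hc).interior ⊆ K.interior := fun x hx => by
  rw [C.piece_interior] at hx
  exact C.mem_manifoldInterior_of_mem_bd hK hx.1.1.1 hx.1.1.2

theorem piece_isOrientedPieceOf : (C.piece hK hU hc).IsOrientedPieceOf K :=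
  ⟨Set.inter_subset_left.trans Set.inter_subset_left, C.piece_interior_subset hK hU hc,
    fun _ hx => C.piece_orientation hK hU hc hx⟩

/-- A relative cycle of the piece that is homologous to an orientation cycle of `K` modulo the
complement of every interior point represents the orientation class of the piece. -/
theorem isOrientationClass_relClass {c : relCycles p K.carrier K.boundary}
    (hκ : K.IsOrientationClass (relClass p K.carrier K.boundary c))
    (a : relCycles p (C.piece hK hU hc).carrier (C.piece hK hU hc).boundary)
    {d : Chains (p + 1) X} (hd : d ∈ chainsIn (p + 1) K.carrier)
    (had : ∀ x ∈ (C.piece hK hU hc).interior, a.1 - c.1 - dChains p d ∈ chainsIn p {x}ᶜ) :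
    (C.piece hK hU hc).IsOrientationClass (relClass p _ _ a) := by
  intro x hx
  have hxA := C.notMem_A_of_mem_piece_interior hK hU hc hx
  have hxU : x ∈ U := by
    rw [C.piece_interior] at hx
    exact hx.1.2
  -- It suffices to compare the images in the local homology of `K`.
  refine (relHomologyMap_compl_bijective (p := p)
    (Set.inter_subset_left.trans Set.inter_subset_left : (C.piece hK hU hc).carrier ⊆ K.carrier)
    (U := {x}) (O := C.Aᶜ ∩ U)
    (by rw [closure_singleton, Set.singleton_subset_iff]; exact ⟨hxA, hxU⟩)
    (C.isClosed_A.isOpen_compl.inter hU)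
    fun y hy => ⟨⟨hy.1, (C.mem_or_mem y).resolve_right hy.2.1⟩, hy.2.2⟩).1 ?_
  refine Eq.trans ?_ (C.piece_orientation hK hU hc hx).symm
  rw [← hκ x (C.piece_interior_subset hK hU hc hx), toLocalHomology, toLocalHomology,
    relHomologyMap_relClass, relHomologyMap_relClass]
  refine (relHomologyMap_relClass _ _ _).trans ?_
  refine relClass_eq_of_sub hd ?_
  exact had x hx

/-- Cutting an admissible submanifold along `∂M`. -/
theorem exists_pieces {K : OrientedSubmanifold (𝓡∂ n) X p} (hK : C.Admissible K) :
    ∃ (r : ℕ) (L : Fin r → OrientedSubmanifold (𝓡∂ n) X p),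
      (∀ i, IsConnected (L i).carrier ∧ (L i).boundary ⊆ C.bd ∧ (L i).IsOrientedPieceOf K) ∧
      (Pairwise fun i j => Disjoint (L i).carrier (L j).carrier) ∧
      (⋃ i, (L i).carrier) = K.carrier ∩ M ∧
      ∀ k : relHomology p (Set.univ : Set X) C.A, K.Represents k →
        ∃ l : Fin r → relHomology p M C.bd,
          (∀ i, (L i).Represents (l i)) ∧ C.homologyMap p (∑ i, l i) = k := by
  have hconn := (C.isSubmanifold_inter hK).locallyConnectedSpace
  obtain ⟨r, U, hU, hUconn, hUcomp, hdisj, hcov⟩ :=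
    exists_components (K.isCompact.inter_right C.isClosed)
  let L : Fin r → OrientedSubmanifold (𝓡∂ n) X p := fun i => C.piece hK (hU i) (hUcomp i)
  have hLbd : ∀ i, (L i).boundary ⊆ C.bd := fun i => by
    rw [C.piece_boundary]
    exact Set.inter_subset_right
  refine ⟨r, L, fun i => ⟨hUconn i, hLbd i, C.piece_isOrientedPieceOf hK _ _⟩, hdisj, hcov, ?_⟩
  rintro k ⟨-, hKA, κ, hκ, rfl⟩
  obtain ⟨c, rfl⟩ := relClass_surjective _ _ _ κ
  obtain ⟨a, ha, hda, d, hd, hcad⟩ := C.exists_cut_cycle hK c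
  obtain ⟨b, hb, rfl⟩ := exists_sum_chainsIn hU hdisj hcov ha
  have hdb : ∀ i, bdry p (b i) ∈ chainsIn (p - 1) C.bd := fun i =>
    mem_chainsIn_of_sum_mem hdisj (fun j => bdry_mem (hb j)) (by rwa [map_sum] at hda) i
  have hbL : ∀ i, b i ∈ relCycles p (L i).carrier (L i).boundary := fun i =>
    mem_relCycles (hb i) (by
      rw [C.piece_boundary]
      exact mem_chainsIn_inter (bdry_mem (hb i)) (hdb i))
  have hLM : ∀ i, (L i).carrier ⊆ M := fun i =>
    Set.inter_subset_left.trans Set.inter_subset_right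
  refine ⟨fun i => relClass p M C.bd ⟨b i, relCycles_mono (hLM i)
    (fun x hx => hLbd i hx.2) (hbL i)⟩, fun i => ?_, ?_⟩
  · refine ⟨hLM i, fun x hx => hLbd i hx.2, relClass p _ _ ⟨b i, hbL i⟩, ?_,
      relHomologyMap_relClass _ _ _⟩
    refine C.isOrientationClass_relClass hK (hU i) (hUcomp i) hκ ⟨b i, hbL i⟩
      (Submodule.neg_mem _ hd) fun x hx => ?_
    have hxA := C.notMem_A_of_mem_piece_interior hK (hU i) (hUcomp i) hx
    rw [C.piece_interior] at hx
    -- The other summands avoid `x`, and so does the rest of the difference, lying in the collar.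
    have h1 : ∑ j ∈ Finset.univ.erase i, b j ∈ chainsIn p {x}ᶜ := by
      refine Submodule.sum_mem _ fun j hj => chainsIn_mono ?_ (hb j)
      rintro y hy rfl
      exact Set.disjoint_left.mp (hdisj (Finset.ne_of_mem_erase hj)) hy hx.1
    have h2 : c.1 - ∑ j, b j - dChains p d ∈ chainsIn p {x}ᶜ :=
      chainsIn_mono (by rintro y hy rfl; exact hxA hy.2) hcad
    convert Submodule.neg_mem _ (Submodule.add_mem _ h2 h1) using 1
    rw [← Finset.add_sum_erase _ b (Finset.mem_univ i), map_neg]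
    abel
  · rw [← map_sum, relHomologyMap_relClass]
    refine (relHomologyMap_relClass _ _ _).trans ?_
    symm
    refine relClass_eq_of_sub (d := d) (mem_chainsIn_univ d) ?_
    have h3 := chainsIn_mono Set.inter_subset_right hcad
    convert h3 using 3
    rw [AddSubmonoidClass.coe_finsetSum]

end ExteriorCollar

end Cut

end

theorem proposition2p6 {n : ℕ} [NeZero n] {X : Type*} [TopologicalSpace X] [T2Space X]
    [ChartedSpace (EuclideanHalfSpace n) X] [IsManifold (𝓡∂ n) ∞ X] {M : Set X}
    (C : ExteriorCollar (n := n) M) (p : ℕ) :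
    -- the pieces of `K ∩ M`
    (∀ K : OrientedSubmanifold (𝓡∂ n) X p, C.Admissible K →
      ∃ (r : ℕ) (L : Fin r → OrientedSubmanifold (𝓡∂ n) X p),
        (∀ i, IsConnected (L i).carrier ∧ (L i).boundary ⊆ C.bd ∧ (L i).IsOrientedPieceOf K) ∧
        (Pairwise fun i j => Disjoint (L i).carrier (L j).carrier) ∧
        (⋃ i, (L i).carrier) = K.carrier ∩ M ∧
        ∀ k : relHomology p (Set.univ : Set X) C.A, K.Represents k →
          ∃ l : Fin r → relHomology p M C.bd,
            (∀ i, (L i).Represents (l i)) ∧ C.homologyMap p (∑ i, l i) = k) ∧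
    -- the map induced by inclusion is an isomorphism
    Function.Bijective (C.homologyMap p) ∧
    -- classes represented by linear combinations
    (∀ z' ∈ Submodule.span ℤ {k : relHomology p (Set.univ : Set X) C.A |
        ∃ K : OrientedSubmanifold (𝓡∂ n) X p, C.Admissible K ∧ K.Represents k},
      ∃ z ∈ Submodule.span ℤ {l : relHomology p M C.bd |
          ∃ L : OrientedSubmanifold (𝓡∂ n) X p, L.Represents l},
        C.homologyMap p z = z') := by
  refine ⟨fun K hK => C.exists_pieces hK, C.homologyMap_bijective p, fun z' hz' => ?_⟩
  refine (Submodule.span_le (p := Submodule.map (C.homologyMap p) _)).mpr ?_ hz'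
  rintro k ⟨K, hK, hk⟩
  obtain ⟨r, L, -, -, -, hL⟩ := C.exists_pieces hK
  obtain ⟨l, hl, rfl⟩ := hL k hk
  exact ⟨_, Submodule.sum_mem _ fun i _ => Submodule.subset_span ⟨L i, hl i⟩, rfl⟩
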